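/- Let $X$ and $X_0$ be smooth projective absolutely irreducible curves over a finite field $\mathbb{F}_q$, and let $f,g : X\to X_0$ be two $\mathbb{F}_q$-morphisms of the same degree $d\ge 2$. Let $$\Gamma=\Gamma_{f,g}=\{(P,Q)\in X\times X \mid f(P)=g(Q)\}$$ and let $\mathcal{T}(X,\Gamma)=(X_n)_{n\ge 1}$ be the associated recursive tower, $$X_n=\{(P_1,\dots,P_n)\in X^n \mid f(P_i)=g(P_{i+1})\ \text{for } i=1,\dots,n-1\}.$$ The geometric graph $\mathcal{G}_\infty(X,\Gamma)$ is the directed graph whose vertices are the points of $X(\overline{\mathbb{F}}_q)$, with an edge from $P$ to $Q$ whenever $f(P)=g(Q)$. A finite set $T\subset X(\overline{\mathbb{F}}_q)$ is called $d$-regular if in the subgraph with set of vertices $T$ every vertex has in-degree and out-degree $d$. A set $S\subset X(\overline{\mathbb{F}}_q)$ is called complete if $g^{-1}(f(S))\subset S$ and $f^{-1}(g(S))\subset S$. For $S_0\subset X_0(\overline{\mathbb{F}}_q)$ let $$\mathfrak{D}_f(S_0)=\sum_{P\in f^{-1}(S_0)}(e_f(P)-1)\,P,\qquad \mathfrak{D}_g(S_0)=\sum_{P\in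 g^{-1}(S_0)}(e_g(P)-1)\,P,$$ where $e_f(P)$ and $e_g(P)$ are the ramification indices of $f$ and $g$ at $P$. Suppose that the tower is irreducible, that is, every $X_n$ ($n\ge1$) is irreducible over $\mathbb{F}_q$, and that there exists a non-empty finite complete set $S\subset X(\overline{\mathbb{F}}_q)$ such that $\mathfrak{D}_f(S_0)=\mathfrak{D}_g(S_0)$, where $S_0=f(S)=g(S)$. Then there is no non-empty finite $d$-regular set $T\subset X(\overline{\mathbb{F}}_q)$ disjoint from $S$; in particular the geometric graph contains no non-empty finite $d$-regular component disjoint from $S$. -/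

import Mathlib

universe u

open AlgebraicGeometry CategoryTheory CategoryTheory.Limits

namespace RecursiveTower

noncomputable section

/-- The spectrum of a field `k`, as the base scheme of all curves. -/
abbrev Base (k : Type u) [Field k] : Scheme.{u} := Spec (CommRingCat.of k)

/-- A smooth projective absolutely irreducible curve over the field `k`: a `k`-scheme which is
smooth of relative dimension `1`, proper and geometrically irreducible. (For curves over a field,
proper and projective are the same.) -/
class IsCurve {k : Type u} [Field k] (X : Over (Base k)) : Prop where
  smooth : SmoothOfRelativeDimension 1 X.hom
  proper : IsProper X.hom
  geomIrreducible : GeometricallyIrreducible X.hom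

instance IsCurve.irreducibleSpace {k : Type u} [Field k] (X : Over (Base k)) [hX : IsCurve X] :
    IrreducibleSpace X.left := by
  have := hX.smooth
  have := hX.geomIrreducible
  have : Smooth X.hom := SmoothOfRelativeDimension.smooth 1 X.hom
  have : IrreducibleSpace (Base k) := inferInstance
  exact GeometricallyIrreducible.irreducibleSpace X.hom X.hom.isOpenMap

variable {k : Type u} [Field k]

/-- `f : X ⟶ Y` is a morphism of degree `d` between curves: it is dominant (equivalently, finite,
or non-constant), and the extension of function fields `k(X) / k(Y)`, that is, the extension of the
residue fields at the generic points, has degree `d`. -/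
def HasDegree {X Y : Over (Base k)} [IsCurve X] [IsCurve Y] (f : X ⟶ Y) (d : ℕ) : Prop :=
  IsDominant f.left ∧ f.left.residueDegree (genericPoint X.left) = d

/-! ### The recursive tower -/

/-- The floors of the recursive tower of the correspondence `f(P) = g(Q)`, each one with its last
coordinate `(P₁, …, Pₙ₊₁) ↦ Pₙ₊₁`. The entry with index `n` is the floor
`Xₙ₊₁ = {(P₁, …, Pₙ₊₁) ∈ Xⁿ⁺¹ | f(Pᵢ) = g(Pᵢ₊₁) for i = 1, …, n}`:
`X₁ = X`, and `Xₙ₊₂` is the fibre product over `X₀` of `Xₙ₊₁`, via `(P₁, …, Pₙ₊₁) ↦ f(Pₙ₊₁)`, and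
of `X`, via `g`. -/
def towerAux {X X₀ : Over (Base k)} (f g : X ⟶ X₀) : ℕ → Σ Y : Over (Base k), (Y ⟶ X)
  | 0 => ⟨X, 𝟙 X⟩
  | n + 1 => ⟨pullback ((towerAux f g n).2 ≫ f) g, pullback.snd ((towerAux f g n).2 ≫ f) g⟩

/-- The floor `Xₙ₊₁` of the (singular) recursive tower, a scheme over `k`. -/
abbrev floor {X X₀ : Over (Base k)} (f g : X ⟶ X₀) (n : ℕ) : Over (Base k) :=
  (towerAux f g n).1

/-- The recursive tower is irreducible: each of its floors `X₁, X₂, X₃, …` is irreducible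
(over `k`). -/
def IsIrreducibleTower {X X₀ : Over (Base k)} (f g : X ⟶ X₀) : Prop :=
  ∀ n : ℕ, IrreducibleSpace (floor f g n).left

/-! ### Geometric points and the geometric graph -/

/-- The spectrum of an algebraic closure of `k`, as a scheme over `k`. -/
def geomBase (k : Type u) [Field k] : Over (Base k) :=
  Over.mk (Spec.map (CommRingCat.ofHom (algebraMap k (AlgebraicClosure k))))

/-- The set `X(k̄)` of geometric points of `X`: the `k`-morphisms `Spec k̄ ⟶ X`. -/
abbrev GeomPoint (X : Over (Base k)) : Type u := geomBase k ⟶ X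

/-- The map `X(k̄) → Y(k̄)` induced by a morphism `f : X ⟶ Y`. -/
def onPoints {X Y : Over (Base k)} (f : X ⟶ Y) (P : GeomPoint X) : GeomPoint Y := P ≫ f

/-- The (closed) point of the scheme `X` which underlies a geometric point. -/
def GeomPoint.toPoint {X : Over (Base k)} (P : GeomPoint X) : X.left :=
  P.left (IsLocalRing.closedPoint (AlgebraicClosure k))

/-- The geometric graph: its vertices are the geometric points of `X`, and there is an edge from
`P` to `Q` if `f(P) = g(Q)`. -/
def geomGraph {X X₀ : Over (Base k)} (f g : X ⟶ X₀) : Digraph (GeomPoint X) where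
  Adj P Q := onPoints f P = onPoints g Q

/-- A finite set `S` of vertices of a directed graph is `d`-regular if, in the subgraph with set of
vertices `S`, each vertex has out-degree `d` and in-degree `d`. -/
def IsRegularSet {V : Type*} (G : Digraph V) (d : ℕ) (S : Set V) : Prop :=
  S.Finite ∧ ∀ P ∈ S, {Q ∈ S | G.Adj P Q}.ncard = d ∧ {Q ∈ S | G.Adj Q P}.ncard = d

/-- Forward completeness: `g⁻¹(f(S)) ⊆ S`. -/
def IsForwardComplete {X X₀ : Over (Base k)} (f g : X ⟶ X₀) (S : Set (GeomPoint X)) : Prop :=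
  onPoints g ⁻¹' (onPoints f '' S) ⊆ S

/-- Backward completeness: `f⁻¹(g(S)) ⊆ S`. -/
def IsBackwardComplete {X X₀ : Over (Base k)} (f g : X ⟶ X₀) (S : Set (GeomPoint X)) : Prop :=
  onPoints f ⁻¹' (onPoints g '' S) ⊆ S

/-- Completeness: forward and backward completeness. -/
def IsComplete {X X₀ : Over (Base k)} (f g : X ⟶ X₀) (S : Set (GeomPoint X)) : Prop :=
  IsForwardComplete f g S ∧ IsBackwardComplete f g S

/-! ### Ramification -/

/-- The ramification index `e_f(x)` of a morphism of schemes at a point `x`: the largest `n` such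
that the maximal ideal of the local ring at `f(x)` generates an ideal contained in the `n`-th power
of the maximal ideal of the local ring at `x`. -/
def ramIndexAt {X Y : Scheme.{u}} (f : X ⟶ Y) (x : X) : ℕ :=
  letI : Algebra (Y.presheaf.stalk (f x)) (X.presheaf.stalk x) := (f.stalkMap x).hom.toAlgebra
  Ideal.ramificationIdx' (IsLocalRing.maximalIdeal (Y.presheaf.stalk (f x)))
    (IsLocalRing.maximalIdeal (X.presheaf.stalk x))

/-- The ramification index `e_f(P)` at a geometric point `P`. It is read off from the local rings
at the underlying closed points; over a perfect field `k` (in particular over a finite field) this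
is the same as doing so after base change to `k̄`. -/
def ramIndex {X Y : Over (Base k)} (f : X ⟶ Y) (P : GeomPoint X) : ℕ :=
  ramIndexAt f.left P.toPoint

open scoped Classical in
/-- The restricted different `𝔇_f(S₀) = ∑_{P ∈ f⁻¹(S₀)} (e_f(P) - 1) P`. A divisor is given by its
coefficients: this is the function which sends `P` to its coefficient in `𝔇_f(S₀)`. -/
def restrictedDifferent {X X₀ : Over (Base k)} (f : X ⟶ X₀) (S₀ : Set (GeomPoint X₀)) :
    GeomPoint X → ℤ :=
  fun P => if onPoints f P ∈ S₀ then (ramIndex f P : ℤ) - 1 else 0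

end

end RecursiveTower

/-!
# Regular sets in the geometric graph of an irreducible recursive tower

Suppose that a `d`-regular set `T` disjoint from `S` exists. The idea is to construct a non-constant
function `ψ` on `X₀`, defined over a finite extension `k'` of `k`, with the same pullback `h` under
`f` and `g`. Along a path `P₁, P₂, …` of the geometric graph the function `h` is then constant, as
`h(Pᵢ) = ψ(f(Pᵢ)) = ψ(g(Pᵢ₊₁)) = h(Pᵢ₊₁)`. Since `h` takes each value only finitely often, more
precisely since the function field of `X` is finite over `k'(h)`, two of the coordinates of the
generic point of a high floor of the tower agree (`exists_forall_chain_eq`). The floor is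
irreducible, so these two coordinates agree on all of it (`exists_comp_eq_of_chain`). On the other
hand, as `d ≥ 2`, there is a path in `T` for which they differ (`exists_path_ne`).

The function `ψ` is found as follows (`CurveModel.exists_transcendental_pullback_eq`). Both `f` and
`g` map `T` onto the same set `T₀`. Each point of `T₀` has `d` preimages in `T` under `f`, which is
of degree `d`; so `f⁻¹(T₀) = T`, and `f` is unramified there. The same holds for `g`. By
completeness, `f⁻¹(S₀) = S = g⁻¹(S₀)`, and the ramification indices of `f` and `g` at the points
of `S` agree. Hence a function `φ` on `X₀` with divisor `α T₀ - β S₀` has pullbacks with the same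
divisor under `f` and `g`. Their quotient is a constant in a finite field, and a power `ψ` of `φ`
has the same pullbacks. As the base field is finite, such a `φ` exists (`exists_ord_eq`): divisors
of degree zero are torsion in the class group. This follows from Riemann's inequality
(`exists_divDegree_sub_le_finrank`), which is proved here for function fields of one variable,
with places as valuation rings.

The structure `CurveModel` is the link with schemes. It records the geometric points of a curve with
their local rings in the function field `K` and the evaluation of functions, and the fact that
valuation rings of `K` have centres, by the valuative criterion of properness (`curveModel`). Curves
are étale over the affine line locally, which yields the discrete valuation rings. The points of `S`
and `T` become rational over a finite extension `k'` of `k`. The places of the field `k' ⊗ K`, which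
is a field by geometric irreducibility, are compared directly with the points of the given curve, so
that the curve over `k'` is not needed. The main fact is that a rational point has exactly one place
above it, at which a uniformizer stays a uniformizer (`CurveModel.IsCenter.place_eq`,
`CurveModel.IsCenter.ord_uniformizer`).
-/

set_option linter.unusedSectionVars false

namespace RecursiveTower

/-! ### Linear independence from residues -/

section Independence

variable {k E F : Type*} [Field k] [Field E] [Field F] [Algebra k F] [Algebra E F]

lemma mul_ne_one_of_mem_nonunits {O : ValuationSubring F} {z r : F} (hz : z ∈ O.nonunits)
    (hr : r ∈ O) : z * r ≠ 1 := by
  intro h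
  rw [ValuationSubring.mem_nonunits_iff] at hz
  have hr' := (O.valuation_le_one_iff r).2 hr
  have := congrArg O.valuation h
  rw [map_mul, map_one] at this
  exact absurd this (mul_lt_one_of_lt_of_le hz hr').ne

/-- Let `V` be a valuation ring of `E` whose elements are congruent to constants modulo `z` in each
of the valuation rings `O i` of an extension field `F`. Elements of `⋂ O i` which are linearly
independent over the constants modulo `⋂ z O i` are linearly independent over `E`: a relation over
`E`, divided by its dominant coefficient, reduces to a non-trivial relation modulo `z`. -/
theorem linearIndependent_of_residues (V : ValuationSubring E) {z : F} {ι : Type*} [Nonempty ι]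
    {O : ι → ValuationSubring F} (hz : ∀ i, z ∈ (O i).nonunits)
    (hV : ∀ c ∈ V, ∃ a : k, ∀ i, ∃ r ∈ O i, algebraMap E F c - algebraMap k F a = z * r)
    {J : Type*} [Fintype J] {b : J → F} (hb : ∀ i j, b j ∈ O i)
    (hind : ∀ a : J → k, (∀ i, ∃ r ∈ O i, ∑ j, a j • b j = z * r) → a = 0) :
    LinearIndependent E b := by
  classical
  rw [Fintype.linearIndependent_iff]
  by_contra! hcon
  obtain ⟨c, hc, j₁, hj₁⟩ := hcon
  obtain ⟨j₀, -, hj₀⟩ := Finset.exists_max_image Finset.univ (fun j => V.valuation (c j))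
    ⟨j₁, Finset.mem_univ _⟩
  have hc₀ : c j₀ ≠ 0 := by
    intro h
    have := hj₀ j₁ (Finset.mem_univ _)
    rw [h, map_zero, le_zero_iff, map_eq_zero] at this
    exact hj₁ this
  have hmem : ∀ j, c j / c j₀ ∈ V := by
    intro j
    rw [← V.valuation_le_one_iff, map_div₀]
    exact div_le_one_of_le₀ (hj₀ j (Finset.mem_univ _)) zero_le
  choose a ha using fun j => hV _ (hmem j)
  choose r hr hra using ha
  have hzero : a = 0 := by
    refine hind a fun i => ⟨-∑ j, r j i * b j,
      neg_mem (sum_mem fun j _ => mul_mem (hr j i) (hb i j)), ?_⟩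
    have h0 : ∑ j, algebraMap E F (c j / c j₀) * b j = 0 := by
      have : ∑ j, algebraMap E F (c j / c j₀) * b j
          = algebraMap E F (c j₀)⁻¹ * ∑ j, c j • b j := by
        rw [Finset.mul_sum]
        refine Finset.sum_congr rfl fun j _ => ?_
        rw [Algebra.smul_def, ← mul_assoc, ← map_mul]
        congr 2
        field_simp
      rw [this, hc, mul_zero]
    calc ∑ j, a j • b j
        = ∑ j, (algebraMap E F (c j / c j₀) * b j - z * (r j i * b j)) := by
          refine Finset.sum_congr rfl fun j _ => ?_
          rw [Algebra.smul_def]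
          linear_combination (-b j) * hra j i
      _ = z * (-∑ j, r j i * b j) := by
          rw [Finset.sum_sub_distrib, h0, ← Finset.mul_sum]; ring
  obtain ⟨i⟩ := ‹Nonempty ι›
  have h1 := hra j₀ i
  rw [hzero, div_self hc₀] at h1
  simp only [map_one, Pi.zero_apply, map_zero, sub_zero] at h1
  exact mul_ne_one_of_mem_nonunits (hz i) (hr j₀ i) h1.symm

lemma aeval_eq_coeff_zero_add (p : Polynomial k) (z : F) :
    Polynomial.aeval z p = algebraMap k F (p.coeff 0) + z * Polynomial.aeval z p.divX := by
  conv_lhs => rw [← Polynomial.divX_mul_X_add p]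
  simp only [map_add, map_mul, Polynomial.aeval_X, Polynomial.aeval_C]
  ring

lemma aeval_mem {O : ValuationSubring F} (hk : ∀ c : k, algebraMap k F c ∈ O) {z : F}
    (hz : z ∈ O) (p : Polynomial k) : Polynomial.aeval z p ∈ O := by
  rw [Polynomial.aeval_eq_sum_range]
  refine sum_mem fun i _ => ?_
  rw [Algebra.smul_def]
  exact mul_mem (hk _) (pow_mem hz _)

lemma valuation_algebraMap_eq_one {O : ValuationSubring F} (hk : ∀ c : k, algebraMap k F c ∈ O)
    {c : k} (hc : c ≠ 0) : O.valuation (algebraMap k F c) = 1 := by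
  refine le_antisymm ((O.valuation_le_one_iff _).2 (hk c)) ?_
  have h := (O.valuation_le_one_iff _).2 (hk c⁻¹)
  rw [map_inv₀, map_inv₀] at h
  exact (inv_le_one₀ (by simpa [zero_lt_iff] using hc)).1 h

lemma valuation_aeval_eq_one {O : ValuationSubring F} (hk : ∀ c : k, algebraMap k F c ∈ O) {z : F}
    (hz : z ∈ O.nonunits) {p : Polynomial k} (hp : p.coeff 0 ≠ 0) :
    O.valuation (Polynomial.aeval z p) = 1 := by
  have h1 := valuation_algebraMap_eq_one hk hp
  rw [aeval_eq_coeff_zero_add, Valuation.map_add_eq_of_lt_left, h1]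
  rw [h1, map_mul]
  exact mul_lt_one_of_lt_of_le ((O.mem_nonunits_iff).1 hz)
    ((O.valuation_le_one_iff _).2 (aeval_mem hk (O.nonunits_subset hz) _))

lemma exists_sub_eq_mul_of_div {ι : Type*} {O : ι → ValuationSubring F}
    (hk : ∀ i, ∀ c : k, algebraMap k F c ∈ O i) {z : F} (hz : ∀ i, z ∈ (O i).nonunits)
    (p q : Polynomial k) (hq : q.coeff 0 ≠ 0) :
    ∃ a : k, ∀ i, ∃ r ∈ O i,
      Polynomial.aeval z p / Polynomial.aeval z q - algebraMap k F a = z * r := by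
  refine ⟨p.coeff 0 / q.coeff 0, fun i => ?_⟩
  have hv := valuation_aeval_eq_one (hk i) (hz i) hq
  have hq0 : Polynomial.aeval z q ≠ 0 := by
    intro h; rw [h, map_zero] at hv; exact zero_ne_one hv
  have hqinv : (Polynomial.aeval z q)⁻¹ ∈ O i := by
    rw [← ValuationSubring.valuation_le_one_iff, map_inv₀, hv, inv_one]
  have hzi := (O i).nonunits_subset (hz i)
  refine ⟨(Polynomial.aeval z p.divX - algebraMap k F (p.coeff 0 / q.coeff 0) *
    Polynomial.aeval z q.divX) * (Polynomial.aeval z q)⁻¹,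
    mul_mem (sub_mem (aeval_mem (hk i) hzi _) (mul_mem (hk i _) (aeval_mem (hk i) hzi _))) hqinv, ?_⟩
  have hc : algebraMap k F (p.coeff 0 / q.coeff 0) * algebraMap k F (q.coeff 0)
      = algebraMap k F (p.coeff 0) := by
    rw [← map_mul, div_mul_cancel₀ _ hq]
  have hp := aeval_eq_coeff_zero_add p z
  have hq' := aeval_eq_coeff_zero_add q z
  field_simp
  rw [hp]
  linear_combination (-algebraMap k F (p.coeff 0 / q.coeff 0)) * hq' - hc

/-- An element of `k(z)` which is integral at one of the valuation rings at which `z` vanishes is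
congruent to a constant modulo `z` at all of them. -/
lemma exists_residue_of_mem_adjoin {ι : Type*} {O : ι → ValuationSubring F}
    (hk : ∀ i, ∀ c : k, algebraMap k F c ∈ O i) {z : F} (hz : ∀ i, z ∈ (O i).nonunits)
    (hz0 : z ≠ 0) (i₀ : ι) {c : F} (hc : c ∈ IntermediateField.adjoin k {z}) (hcO : c ∈ O i₀) :
    ∃ a : k, ∀ i, ∃ r ∈ O i, c - algebraMap k F a = z * r := by
  obtain ⟨p, q, rfl⟩ := (IntermediateField.mem_adjoin_simple_iff _ _).1 hc
  by_cases hp : p = 0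
  · exact ⟨0, fun i => ⟨0, zero_mem _, by simp [hp]⟩⟩
  by_cases hq : q = 0
  · exact ⟨0, fun i => ⟨0, zero_mem _, by simp [hq]⟩⟩
  obtain ⟨p', hp', hp0⟩ := Polynomial.exists_eq_pow_rootMultiplicity_mul_and_not_dvd p hp 0
  obtain ⟨q', hq', hq0⟩ := Polynomial.exists_eq_pow_rootMultiplicity_mul_and_not_dvd q hq 0
  set m := p.rootMultiplicity 0
  set n := q.rootMultiplicity 0
  rw [map_zero, sub_zero] at hp' hq' hp0 hq0
  rw [Polynomial.X_dvd_iff] at hp0 hq0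
  have hpz : Polynomial.aeval z p = z ^ m * Polynomial.aeval z p' := by
    conv_lhs => rw [hp']
    simp
  have hqz : Polynomial.aeval z q = z ^ n * Polynomial.aeval z q' := by
    conv_lhs => rw [hq']
    simp
  rcases lt_or_ge m n with hmn | hmn
  · exfalso
    obtain ⟨l, hl⟩ : ∃ l, n = m + (l + 1) := ⟨n - m - 1, by omega⟩
    rw [← ValuationSubring.valuation_le_one_iff, hpz, hqz, hl, map_div₀, map_mul, map_mul,
      valuation_aeval_eq_one (hk i₀) (hz i₀) hp0, valuation_aeval_eq_one (hk i₀) (hz i₀) hq0,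
      mul_one, mul_one, pow_add, map_mul, ← div_div, div_self (by simp [hz0]), one_div] at hcO
    have h1 : (O i₀).valuation (z ^ (l + 1)) < 1 := by
      rw [map_pow]
      exact pow_lt_one₀ zero_le (((O i₀).mem_nonunits_iff).1 (hz i₀)) (by omega)
    rw [inv_le_one₀ (by simp [zero_lt_iff, hz0])] at hcO
    exact absurd h1 (not_lt.2 hcO)
  · obtain ⟨l, hl⟩ : ∃ l, m = n + l := ⟨m - n, by omega⟩
    have : Polynomial.aeval z p / Polynomial.aeval z q
        = Polynomial.aeval z (Polynomial.X ^ l * p') / Polynomial.aeval z q' := by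
      rw [hpz, hqz, hl, pow_add, mul_assoc, mul_div_mul_left _ _ (pow_ne_zero _ hz0)]
      simp
    rw [this]
    exact exists_sub_eq_mul_of_div hk hz _ _ hq0

/-- The case `E = k(z)` of `linearIndependent_of_residues`, as a bound for the number of
elements. -/
theorem card_le_finrank_adjoin {z : F} (hz0 : z ≠ 0)
    [FiniteDimensional (IntermediateField.adjoin k {z}) F] {ι : Type*} [Nonempty ι]
    {O : ι → ValuationSubring F} (hk : ∀ i, ∀ c : k, algebraMap k F c ∈ O i)
    (hz : ∀ i, z ∈ (O i).nonunits) {J : Type*} [Fintype J] {b : J → F} (hb : ∀ i j, b j ∈ O i)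
    (hind : ∀ a : J → k, (∀ i, ∃ r ∈ O i, ∑ j, a j • b j = z * r) → a = 0) :
    Fintype.card J ≤ Module.finrank (IntermediateField.adjoin k {z}) F := by
  obtain ⟨i₀⟩ := ‹Nonempty ι›
  have : Nonempty ι := ⟨i₀⟩
  refine (linearIndependent_of_residues
    ((O i₀).comap (algebraMap (IntermediateField.adjoin k {z}) F)) hz ?_ hb
    hind).fintype_card_le_finrank
  exact fun c hc => exists_residue_of_mem_adjoin hk hz hz0 i₀ c.2 hc

end Independence

/-! ### Function fields of one variable and their places -/

/-- `F` is a function field of one variable over `k`: it is transcendental over `k`, and finite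
over each subfield generated by a transcendental element. -/
class IsFunctionField (k F : Type*) [Field k] [Field F] [Algebra k F] : Prop where
  exists_transcendental : ∃ t : F, Transcendental k t
  finite_adjoin : ∀ z : F, Transcendental k z →
    FiniteDimensional (IntermediateField.adjoin k {z}) F

/-- A place of `F` over `k`, given by its valuation ring: a valuation ring of `F`, other than `F`
itself, which contains `k`. -/
@[ext]
structure Place (k F : Type*) [Field k] [Field F] [Algebra k F] where
  /-- The valuation ring of the place. -/
  ring : ValuationSubring F
  algebraMap_mem : ∀ c : k, algebraMap k F c ∈ ring
  ne_top : ring ≠ ⊤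

namespace Place

variable {k F : Type*} [Field k] [Field F] [Algebra k F]

/-- An element of `F` which is integral over a subring of a valuation ring lies in it. -/
lemma mem_ring_of_isIntegralElem (w : Place k F) {R : Type*} [CommRing R] (φ : R →+* F)
    (hφ : ∀ r, φ r ∈ w.ring) {x : F} (hx : φ.IsIntegralElem x) : x ∈ w.ring := by
  obtain ⟨p, hp, hpx⟩ := hx
  refine (LocalSubring.mem_of_isMax_of_isIntegral w.ring.isMax_toLocalSubring (x := x) ?_)
  let ψ : R →+* w.ring.toLocalSubring.toSubring := φ.codRestrict w.ring.toSubring hφ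
  refine ⟨p.map ψ, hp.map _, ?_⟩
  rw [Polynomial.eval₂_map]
  exact hpx

lemma mem_ring_of_isAlgebraic (w : Place k F) {x : F} (hx : IsAlgebraic k x) : x ∈ w.ring :=
  w.mem_ring_of_isIntegralElem (algebraMap k F) w.algebraMap_mem hx.isIntegral

lemma transcendental_of_mem_nonunits (w : Place k F) {z : F} (hz0 : z ≠ 0)
    (hz : z ∈ w.ring.nonunits) : Transcendental k z := by
  intro h
  exact mul_ne_one_of_mem_nonunits hz (w.mem_ring_of_isAlgebraic h.inv) (mul_inv_cancel₀ hz0)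

lemma exists_mem_nonunits (w : Place k F) : ∃ z : F, z ≠ 0 ∧ z ∈ w.ring.nonunits := by
  obtain ⟨x, hx⟩ : ∃ x, x ∉ w.ring := by
    by_contra! h
    exact w.ne_top (SetLike.ext fun x => ⟨fun _ => trivial, fun _ => h x⟩)
  have hx0 : x ≠ 0 := by rintro rfl; exact hx (zero_mem _)
  exact ⟨x⁻¹, inv_ne_zero hx0, (w.ring.inv_mem_nonunits_iff).2 (Or.inr hx)⟩

end Place

noncomputable section

namespace Place

variable {k F : Type*} [Field k] [Field F] [Algebra k F]

instance (w : Place k F) : Algebra k w.ring :=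
  ((algebraMap k F).codRestrict w.ring.toSubring w.algebraMap_mem).toAlgebra

lemma coe_algebraMap (w : Place k F) (c : k) :
    ((algebraMap k w.ring c : w.ring) : F) = algebraMap k F c := rfl

lemma coe_smul (w : Place k F) (c : k) (x : w.ring) : ((c • x : w.ring) : F) = c • (x : F) := by
  rw [Algebra.smul_def, Algebra.smul_def]; rfl

variable [IsFunctionField k F]

/-- The quotient of a valuation ring by a non-zero element is finite-dimensional over the
constants, by `card_le_finrank_adjoin`. -/
lemma finite_quotient_span (w : Place k F) {z : w.ring} (hz0 : z ≠ 0)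
    (hz : (z : F) ∈ w.ring.nonunits) : Module.Finite k (w.ring ⧸ Ideal.span {z}) := by
  have hz0' : (z : F) ≠ 0 := by simpa using hz0
  have := IsFunctionField.finite_adjoin (k := k) (z : F) (w.transcendental_of_mem_nonunits hz0' hz)
  rw [← Module.rank_lt_aleph0_iff]
  refine lt_of_le_of_lt (rank_le (n := Module.finrank (IntermediateField.adjoin k {(z : F)}) F)
    fun s hs => ?_) (Cardinal.natCast_lt_aleph0)
  choose b hb using fun j : s => Ideal.Quotient.mk_surjective (j : w.ring ⧸ Ideal.span {z})
  rw [← Fintype.card_coe]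
  refine card_le_finrank_adjoin (ι := Unit) (O := fun _ => w.ring) (b := fun j => (b j : F)) hz0'
    (fun _ => w.algebraMap_mem) (fun _ => hz) (fun _ j => (b j).2) fun a ha => ?_
  obtain ⟨r, hr, h⟩ := ha ()
  have h' : ∑ j, a j • b j = z * ⟨r, hr⟩ := by
    apply Subtype.ext
    rw [MulMemClass.coe_mul, ← h, AddSubmonoidClass.coe_finsetSum]
    simp only [coe_smul]
  have h0 : ∑ j : s, a j • (j : w.ring ⧸ Ideal.span {z}) = 0 := by
    have := congrArg (Ideal.Quotient.mkₐ k (Ideal.span {z})) h'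
    simp only [map_sum, map_smul, Ideal.Quotient.mkₐ_eq_mk, hb] at this
    rw [this, Ideal.Quotient.eq_zero_iff_mem]
    exact Ideal.mem_span_singleton.2 (dvd_mul_right _ _)
  exact funext fun j => (Fintype.linearIndependent_iff.1 hs) a h0 j

instance (w : Place k F) : IsNoetherianRing w.ring := by
  refine ⟨fun I => ?_⟩
  by_cases hI : I = ⊥
  · subst hI; exact Submodule.fg_bot
  obtain ⟨y, hyI, hy0⟩ := Submodule.exists_mem_ne_zero_of_ne_bot hI
  by_cases hy : IsUnit y
  · rw [Ideal.eq_top_of_isUnit_mem I hyI hy]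
    exact Module.Finite.fg_top
  have hy' : (y : F) ∈ w.ring.nonunits := ValuationSubring.coe_mem_nonunits_iff.2
    ((IsLocalRing.mem_maximalIdeal _).2 hy)
  have := w.finite_quotient_span hy0 hy'
  have : IsNoetherian k (w.ring ⧸ Ideal.span {y}) := inferInstance
  have : IsNoetherian w.ring (w.ring ⧸ Ideal.span {y}) := isNoetherian_of_tower k this
  refine Submodule.fg_of_fg_map_of_fg_inf_ker (Submodule.mkQ (Ideal.span {y}))
    (IsNoetherian.noetherian _) ?_
  rw [Submodule.ker_mkQ, inf_eq_right.2 ((Ideal.span_singleton_le_iff_mem _).2 hyI)]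
  exact Submodule.fg_span_singleton y

instance isDiscreteValuationRing (w : Place k F) : IsDiscreteValuationRing w.ring := by
  have : IsPrincipalIdealRing w.ring := 
    ((IsBezout.TFAE (R := w.ring)).out 0 1).mp (inferInstance : IsNoetherianRing w.ring)
  refine { not_a_field' := fun h => ?_ }
  obtain ⟨z, hz0, hz⟩ := w.exists_mem_nonunits
  obtain ⟨hz1, hz2⟩ := ValuationSubring.mem_nonunits_iff_exists_mem_maximalIdeal.1 hz
  rw [h, Ideal.mem_bot] at hz2
  exact hz0 (congrArg Subtype.val hz2)

/-- The degree of a place: the degree of its residue field over the constants. -/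
def degree (w : Place k F) : ℕ := Module.finrank k (IsLocalRing.ResidueField w.ring)

instance (w : Place k F) : Module.Finite k (IsLocalRing.ResidueField w.ring) := by
  obtain ⟨z, hz0, hz⟩ := w.exists_mem_nonunits
  obtain ⟨hz1, hz2⟩ := ValuationSubring.mem_nonunits_iff_exists_mem_maximalIdeal.1 hz
  have := w.finite_quotient_span (z := ⟨z, hz1⟩) (fun h => hz0 (congrArg Subtype.val h)) hz
  have hle : Ideal.span {(⟨z, hz1⟩ : w.ring)} ≤ IsLocalRing.maximalIdeal w.ring :=
    (Ideal.span_singleton_le_iff_mem _).2 hz2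
  exact Module.Finite.of_surjective (Ideal.Quotient.factorₐ k hle).toLinearMap
    (Ideal.Quotient.factor_surjective hle)

lemma degree_pos (w : Place k F) : 0 < w.degree := Module.finrank_pos

/-- The normalized discrete valuation of a place. -/
def val (w : Place k F) : Valuation F (WithZero (Multiplicative ℤ)) :=
  (IsDiscreteValuationRing.maximalIdeal w.ring).valuation F

lemma val_le_one_iff (w : Place k F) {x : F} : w.val x ≤ 1 ↔ x ∈ w.ring := by
  constructor
  · intro h
    obtain ⟨a, rfl⟩ := IsDiscreteValuationRing.exists_lift_of_le_one h
    exact a.2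
  · intro h
    exact IsDedekindDomain.HeightOneSpectrum.valuation_le_one _ (⟨x, h⟩ : w.ring)

lemma val_lt_one_iff (w : Place k F) {x : F} : w.val x < 1 ↔ x ∈ w.ring.nonunits := by
  by_cases hx : x ∈ w.ring
  · rw [ValuationSubring.mem_nonunits_iff_exists_mem_maximalIdeal, exists_prop_of_true hx]
    exact IsDedekindDomain.HeightOneSpectrum.valuation_lt_one_iff_mem _ (⟨x, hx⟩ : w.ring)
  · refine ⟨fun h => absurd (w.val_le_one_iff.1 h.le) hx,
      fun h => absurd (w.ring.nonunits_subset h) hx⟩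

/-- The order of vanishing at a place (with the value `0` at the element `0`). -/
def ord (w : Place k F) (x : F) : ℤ := -(w.val x).log

lemma val_eq (w : Place k F) {x : F} (hx : x ≠ 0) : w.val x = WithZero.exp (-w.ord x) := by
  rw [ord, neg_neg, WithZero.exp_log ((w.val.ne_zero_iff).2 hx)]

lemma ord_mul (w : Place k F) {x y : F} (hx : x ≠ 0) (hy : y ≠ 0) :
    w.ord (x * y) = w.ord x + w.ord y := by
  rw [ord, map_mul, WithZero.log_mul ((w.val.ne_zero_iff).2 hx) ((w.val.ne_zero_iff).2 hy), neg_add]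
  rfl

lemma ord_inv (w : Place k F) (x : F) : w.ord x⁻¹ = -w.ord x := by
  rw [ord, ord, map_inv₀, WithZero.log_inv]

lemma ord_div (w : Place k F) {x y : F} (hx : x ≠ 0) (hy : y ≠ 0) :
    w.ord (x / y) = w.ord x - w.ord y := by
  rw [div_eq_mul_inv, ord_mul _ hx (inv_ne_zero hy), ord_inv, sub_eq_add_neg]

lemma ord_pow (w : Place k F) (x : F) (n : ℕ) : w.ord (x ^ n) = n * w.ord x := by
  rw [ord, ord, map_pow, WithZero.log_pow]; simp

lemma ord_zpow (w : Place k F) (x : F) (n : ℤ) : w.ord (x ^ n) = n * w.ord x := by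
  rw [ord, ord, map_zpow₀, WithZero.log_zpow]; simp

lemma exists_uniformizer (w : Place k F) : ∃ π : F, π ≠ 0 ∧ w.ord π = 1 := by
  obtain ⟨π, hπ⟩ := (IsDiscreteValuationRing.maximalIdeal w.ring).valuation_exists_uniformizer F
  refine ⟨π, ?_, ?_⟩
  · rintro rfl
    rw [map_zero] at hπ
    exact WithZero.exp_ne_zero hπ.symm
  · rw [ord, val, hπ, WithZero.log_exp, neg_neg]

lemma ord_nonneg_iff (w : Place k F) {x : F} (hx : x ≠ 0) : 0 ≤ w.ord x ↔ x ∈ w.ring := by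
  rw [← val_le_one_iff, val_eq w hx, ← WithZero.exp_zero, WithZero.exp_le_exp]; omega

lemma ord_pos_iff (w : Place k F) {x : F} (hx : x ≠ 0) : 0 < w.ord x ↔ x ∈ w.ring.nonunits := by
  rw [← val_lt_one_iff, val_eq w hx, ← WithZero.exp_zero, WithZero.exp_lt_exp]; omega

lemma ord_eq_zero_of_isAlgebraic (w : Place k F) {x : F} (hx : IsAlgebraic k x) :
    w.ord x = 0 := by
  by_cases hx0 : x = 0
  · simp [hx0, ord]
  have h1 := (w.ord_nonneg_iff hx0).2 (w.mem_ring_of_isAlgebraic hx)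
  have h2 := (w.ord_nonneg_iff (inv_ne_zero hx0)).2 (w.mem_ring_of_isAlgebraic hx.inv)
  rw [ord_inv] at h2
  omega

lemma val_algebraMap_le_one (w : Place k F) (c : k) : w.val (algebraMap k F c) ≤ 1 :=
  w.val_le_one_iff.2 (w.algebraMap_mem c)

/-- The elements of order at least `n` at a place, together with `0`. -/
def ge (w : Place k F) (n : ℤ) : Submodule k F where
  carrier := {x | w.val x ≤ WithZero.exp (-n)}
  add_mem' hx hy := w.val.map_add_le hx hy
  zero_mem' := by simp
  smul_mem' c x hx := by
    rw [Set.mem_ofPred_eq, Algebra.smul_def, map_mul]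
    exact mul_le_of_le_one_of_le (w.val_algebraMap_le_one c) hx

lemma mem_ge (w : Place k F) {n : ℤ} {x : F} : x ∈ w.ge n ↔ w.val x ≤ WithZero.exp (-n) := Iff.rfl

lemma mem_ge_iff (w : Place k F) {n : ℤ} {x : F} (hx : x ≠ 0) : x ∈ w.ge n ↔ n ≤ w.ord x := by
  rw [mem_ge, val_eq w hx, WithZero.exp_le_exp]; omega

lemma mem_ge_zero (w : Place k F) {x : F} : x ∈ w.ge 0 ↔ x ∈ w.ring := by
  rw [mem_ge, neg_zero, WithZero.exp_zero, val_le_one_iff]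

lemma mem_ge_one (w : Place k F) {x : F} : x ∈ w.ge 1 ↔ x ∈ w.ring.nonunits := by
  by_cases hx : x = 0
  · subst hx; simp
  · rw [mem_ge_iff w hx, ← ord_pos_iff w hx]; omega

lemma mem_ge_ord (w : Place k F) (x : F) : x ∈ w.ge (w.ord x) := by
  by_cases hx : x = 0
  · subst hx; exact zero_mem _
  · rw [mem_ge_iff w hx]

lemma ge_anti (w : Place k F) {m n : ℤ} (h : m ≤ n) : w.ge n ≤ w.ge m := fun x hx => by
  rw [mem_ge] at *
  exact hx.trans (WithZero.exp_le_exp.2 (by omega))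

lemma mul_mem_ge (w : Place k F) {m n : ℤ} {x y : F} (hx : x ∈ w.ge m) (hy : y ∈ w.ge n) :
    x * y ∈ w.ge (m + n) := by
  rw [mem_ge] at *
  rw [map_mul, neg_add, WithZero.exp_add]
  exact mul_le_mul' hx hy

lemma mul_mem_ge_iff (w : Place k F) {n : ℤ} {x y : F} (hy : y ≠ 0) :
    x * y ∈ w.ge n ↔ x ∈ w.ge (n - w.ord y) := by
  constructor
  · intro h
    have := w.mul_mem_ge h (w.mem_ge_ord y⁻¹)
    rwa [mul_assoc, mul_inv_cancel₀ hy, mul_one, ord_inv, ← sub_eq_add_neg] at this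
  · intro h
    simpa using w.mul_mem_ge h (w.mem_ge_ord y)

/-- A uniformizer of a place. -/
def uniformizer (w : Place k F) : F := w.exists_uniformizer.choose

lemma uniformizer_ne_zero (w : Place k F) : w.uniformizer ≠ 0 := w.exists_uniformizer.choose_spec.1

lemma ord_uniformizer (w : Place k F) : w.ord w.uniformizer = 1 := w.exists_uniformizer.choose_spec.2

lemma mul_zpow_mem_ring (w : Place k F) {n : ℤ} {x : F} (hx : x ∈ w.ge n) :
    x * w.uniformizer ^ (-n) ∈ w.ring := by
  rw [← mem_ge_zero, mul_mem_ge_iff _ (zpow_ne_zero _ w.uniformizer_ne_zero), ord_zpow,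
    ord_uniformizer]
  simpa using hx

/-- The leading coefficient at a place of an element of order at least `n`. -/
def leadingCoeff (w : Place k F) (n : ℤ) : w.ge n →ₗ[k] IsLocalRing.ResidueField w.ring where
  toFun x := IsLocalRing.residue w.ring ⟨x * w.uniformizer ^ (-n), w.mul_zpow_mem_ring x.2⟩
  map_add' x y := by
    rw [← map_add]; congr 1; apply Subtype.ext; simp [add_mul]
  map_smul' c x := by
    rw [RingHom.id_apply, Algebra.smul_def c (IsLocalRing.residue _ _),
      IsScalarTower.algebraMap_apply k w.ring (IsLocalRing.ResidueField w.ring),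
      IsLocalRing.ResidueField.algebraMap_eq, ← map_mul]
    congr 1; apply Subtype.ext
    simp [Algebra.smul_def, mul_assoc, coe_algebraMap]

lemma leadingCoeff_eq_zero_iff (w : Place k F) {n : ℤ} (x : w.ge n) :
    w.leadingCoeff n x = 0 ↔ (x : F) ∈ w.ge (n + 1) := by
  change IsLocalRing.residue w.ring _ = 0 ↔ _
  rw [IsLocalRing.residue_eq_zero_iff, ← ValuationSubring.coe_mem_nonunits_iff, ← mem_ge_one,
    mul_mem_ge_iff _ (zpow_ne_zero _ w.uniformizer_ne_zero), ord_zpow, ord_uniformizer]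
  rw [show (1 : ℤ) - -n * 1 = n + 1 by ring]

lemma leadingCoeff_surjective (w : Place k F) (n : ℤ) : Function.Surjective (w.leadingCoeff n) := by
  intro c
  obtain ⟨r, rfl⟩ := IsLocalRing.residue_surjective c
  have hr : (r : F) * w.uniformizer ^ n ∈ w.ge n := by
    rw [mul_mem_ge_iff _ (zpow_ne_zero _ w.uniformizer_ne_zero), ord_zpow, ord_uniformizer]
    simpa using w.mem_ge_zero.2 r.2
  refine ⟨⟨_, hr⟩, ?_⟩
  change IsLocalRing.residue w.ring _ = _
  congr 1; apply Subtype.ext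
  change (r : F) * w.uniformizer ^ n * w.uniformizer ^ (-n) = r
  rw [mul_assoc, ← zpow_add₀ w.uniformizer_ne_zero]; simp

/-- The absolute value `x ↦ 2 ^ (- ord x)` of a place. -/
def abv (w : Place k F) : AbsoluteValue F ℝ :=
  (IsDiscreteValuationRing.maximalIdeal w.ring).adicAbv (K := F) (b := 2) one_lt_two

lemma abv_eq (w : Place k F) {x : F} (hx : x ≠ 0) : w.abv x = (2 : ℝ) ^ (-w.ord x) := by
  change ((WithZeroMulInt.toNNReal (two_ne_zero : (2 : NNReal) ≠ 0) (w.val x) : NNReal) : ℝ) = _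
  rw [val_eq w hx, WithZeroMulInt.toNNReal_neg_apply _ WithZero.exp_ne_zero]
  norm_cast

lemma abv_le_one_iff (w : Place k F) {x : F} : w.abv x ≤ 1 ↔ x ∈ w.ring := by
  by_cases hx : x = 0
  · subst hx; simp
  · rw [abv_eq w hx, ← ord_nonneg_iff w hx, ← zpow_zero (2 : ℝ),
      zpow_le_zpow_iff_right₀ one_lt_two]
    omega

lemma isNontrivial_abv (w : Place k F) : w.abv.IsNontrivial := by
  refine ⟨w.uniformizer, w.uniformizer_ne_zero, ?_⟩
  rw [abv_eq w w.uniformizer_ne_zero, ord_uniformizer]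
  norm_num

/-- Weak approximation at finitely many places. -/
theorem exists_sub_mem_ge (s : Finset (Place k F)) (x : Place k F → F) (n : ℤ) :
    ∃ y : F, ∀ w ∈ s, y - x w ∈ w.ge n := by
  have hd := AbsoluteValue.denseRange_algebraMap_pi (v := fun w : s => w.1.abv)
    (fun w => w.1.isNontrivial_abv) (fun v w hvw h => hvw (Subtype.ext (Place.ext
      (SetLike.ext fun z => by
        rw [← abv_le_one_iff, ← abv_le_one_iff]; exact h.le_one_iff))))
  obtain ⟨y, hy⟩ := Metric.denseRange_iff.1 hd (fun w => WithAbs.toAbs _ (x w)) ((2 : ℝ) ^ (-n))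
    (zpow_pos two_pos _)
  refine ⟨y, fun w hw => ?_⟩
  have h1 := (dist_le_pi_dist _ _ (⟨w, hw⟩ : s)).trans_lt hy
  rw [dist_comm, dist_eq_norm] at h1
  have h2 : w.abv (y - x w) < (2 : ℝ) ^ (-n) := by
    rw [← WithAbs.norm_toAbs_eq]; exact h1
  by_cases h0 : y - x w = 0
  · rw [h0]; exact zero_mem _
  rw [abv_eq w h0, zpow_lt_zpow_iff_right₀ one_lt_two] at h2
  rw [mem_ge_iff w h0]
  omega

end Place

end

noncomputable section

/-! ### Zeros and poles -/

section Zeros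

variable {k F : Type*} [Field k] [Field F] [Algebra k F]

open Place

/-- A function without poles is algebraic over the constants. -/
lemma isAlgebraic_of_forall_mem_ring {x : F} (hx : ∀ w : Place k F, x ∈ w.ring) :
    IsAlgebraic k x := by
  let R := (algebraMap k F).range
  have h : x ∈ (integralClosure (Subring.closure (R : Set F)) F).toSubring := by
    rw [← iInf_valuationSubring_superset, Subring.mem_iInf]
    rintro ⟨V, hV⟩
    by_cases hT : V = ⊤
    · subst hT; trivial
    · exact hx ⟨V, fun c => hV ⟨c, rfl⟩, hT⟩
  rw [Subring.closure_eq] at h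
  let _ : Algebra k R := (algebraMap k F).rangeRestrict.toAlgebra
  have : IsScalarTower k R F := IsScalarTower.of_algebraMap_eq fun _ => rfl
  have : Algebra.IsIntegral k R := ⟨fun ⟨_, c, hc⟩ => by
    convert (isIntegral_algebraMap (R := k) (A := R) (x := c))
    exact Subtype.ext hc.symm⟩
  have h' : IsIntegral R x := h
  exact (isIntegral_trans (R := k) x h').isAlgebraic

variable [IsFunctionField k F]

/-- By weak approximation, the functions which are regular at the places of `s`, modulo those which
vanish to order `n w` at each `w ∈ s`, contain a space of dimension `∑ n w * deg w`. -/
lemma exists_independent_modulo (s : Finset (Place k F)) (n : Place k F → ℕ) :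
    ∃ (J : Type) (_ : Fintype J) (b : J → F), Fintype.card J = ∑ w ∈ s, n w * w.degree ∧
      (∀ j, ∀ w ∈ s, b j ∈ w.ring) ∧
      ∀ a : J → k, (∀ w ∈ s, ∑ j, a j • b j ∈ w.ge (n w)) → a = 0 := by
  classical
  induction hN : ∑ w ∈ s, n w generalizing n with
  | zero =>
    refine ⟨Empty, inferInstance, Empty.elim, ?_, fun j => j.elim, fun a _ => Subsingleton.elim _ _⟩
    rw [Finset.sum_eq_zero_iff] at hN
    rw [Finset.sum_eq_zero fun w hw => by rw [hN w hw, zero_mul]]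
    rfl
  | succ N ih =>
    obtain ⟨w₀, hw₀, hpos⟩ : ∃ w ∈ s, 0 < n w := by
      by_contra! h
      rw [Finset.sum_eq_zero fun w hw => Nat.le_zero.1 (h w hw)] at hN
      omega
    obtain ⟨m, hm⟩ : ∃ m, n w₀ = m + 1 := ⟨n w₀ - 1, by omega⟩
    have hn' : ∀ w ∈ s.erase w₀, Function.update n w₀ m w = n w := fun w hw =>
      Function.update_of_ne (Finset.ne_of_mem_erase hw) _ _
    have hsum : ∑ w ∈ s, Function.update n w₀ m w = N := by
      rw [← Finset.add_sum_erase s _ hw₀] at hN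
      rw [← Finset.add_sum_erase s _ hw₀, Finset.sum_congr rfl hn', Function.update_self]
      change n w₀ + (s.erase w₀).sum n = N + 1 at hN
      omega
    obtain ⟨J, _, b, hJ, hb, hind⟩ := ih _ hsum
    have hJ' : Fintype.card J + w₀.degree = ∑ w ∈ s, n w * w.degree := by
      rw [hJ, ← Finset.add_sum_erase s _ hw₀, ← Finset.add_sum_erase s (fun w => n w * _) hw₀,
        Finset.sum_congr rfl fun w hw => by rw [hn' w hw], Function.update_self, hm]
      ring
    choose x hx using fun l => w₀.leadingCoeff_surjective m
      (Module.finBasis k (IsLocalRing.ResidueField w₀.ring) l)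
    choose y hy using fun l => exists_sub_mem_ge s (fun w => if w = w₀ then (x l : F) else 0)
      ((∑ w ∈ s, n w : ℕ) : ℤ)
    have hle : ∀ w ∈ s, (n w : ℤ) ≤ (∑ w ∈ s, n w : ℕ) := fun w hw => by
      exact_mod_cast Finset.single_le_sum (f := n) (fun _ _ => Nat.zero_le _) hw
    have hy0 : ∀ l, y l - x l ∈ w₀.ge (n w₀) := fun l =>
      w₀.ge_anti (hle w₀ hw₀) (by simpa using hy l w₀ hw₀)
    have hy1 : ∀ l, ∀ w ∈ s, w ≠ w₀ → y l ∈ w.ge (n w) := fun l w hw hne =>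
      w.ge_anti (hle w hw) (by simpa [hne] using hy l w hw)
    have hy2 : ∀ l, y l ∈ w₀.ge m := fun l => by
      have := add_mem (w₀.ge_anti (by omega) (hy0 l)) (x l).2
      simpa using this
    have hy3 : ∀ l, ∀ w ∈ s, y l ∈ w.ge (Function.update n w₀ m w) := fun l w hw => by
      by_cases h : w = w₀
      · subst h; simpa using hy2 l
      · rw [Function.update_of_ne h]; exact hy1 l w hw h
    have hge : ∀ w ∈ s, (Function.update n w₀ m w) ≤ n w := fun w hw => by
      by_cases h : w = w₀
      · subst h; simp [hm]
      · rw [Function.update_of_ne h]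
    refine ⟨J ⊕ Fin (Module.finrank k (IsLocalRing.ResidueField w₀.ring)), inferInstance,
      Sum.elim b y, by simpa [degree] using hJ', ?_, ?_⟩
    · rintro (j | l) w hw
      · exact hb j w hw
      · exact w.mem_ge_zero.1 (w.ge_anti (by positivity) (hy3 l w hw))
    · intro a ha
      simp only [Fintype.sum_sum_type, Sum.elim_inl, Sum.elim_inr] at ha
      have ha1 : (fun j => a (Sum.inl j)) = 0 := by
        refine hind _ fun w hw => ?_
        have h1 := w.ge_anti (Int.ofNat_le.2 (hge w hw)) (ha w hw)
        have h2 : ∑ l, a (Sum.inr l) • y l ∈ w.ge (Function.update n w₀ m w) :=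
          sum_mem fun l _ => Submodule.smul_mem _ _ (hy3 l w hw)
        simpa using sub_mem h1 h2
      have ha2 : ∑ l, a (Sum.inr l) • y l ∈ w₀.ge (n w₀) := by
        have := ha w₀ hw₀
        rwa [Finset.sum_eq_zero fun j _ => by rw [congrFun ha1 j, Pi.zero_apply, zero_smul],
          zero_add] at this
      have ha3 : ∑ l, a (Sum.inr l) • (x l : F) ∈ w₀.ge (n w₀) := by
        have h : ∑ l, a (Sum.inr l) • (y l - x l) ∈ w₀.ge (n w₀) :=
          sum_mem fun l _ => Submodule.smul_mem _ _ (hy0 l)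
        simp only [smul_sub, Finset.sum_sub_distrib] at h
        simpa using sub_mem ha2 h
      have ha4 : w₀.leadingCoeff m (∑ l, a (Sum.inr l) • x l) = 0 := by
        rw [leadingCoeff_eq_zero_iff]
        rw [hm] at ha3
        simpa using ha3
      rw [map_sum] at ha4
      simp only [map_smul, hx] at ha4
      have ha5 := (Fintype.linearIndependent_iff.1
        (Module.finBasis k (IsLocalRing.ResidueField w₀.ring)).linearIndependent) _ ha4
      ext (j | l)
      · exact congrFun ha1 j
      · exact ha5 l

/-- The fundamental inequality: if `z` vanishes at the places of `s`, all of which lie over the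
valuation ring `V` of `E`, whose elements are congruent to constants modulo `z`, then
`∑ ord_w(z) deg(w) ≤ [F : E]`. -/
theorem sum_ord_mul_degree_le_of_residues {E : Type*} [Field E] [Algebra E F]
    [FiniteDimensional E F] (V : ValuationSubring E) {z : F} (hz0 : z ≠ 0) (s : Finset (Place k F))
    (hz : ∀ w ∈ s, z ∈ w.ring.nonunits)
    (hV : ∀ c ∈ V, ∃ a : k, ∀ w ∈ s, ∃ r ∈ w.ring, algebraMap E F c - algebraMap k F a = z * r) :
    ∑ w ∈ s, w.ord z * w.degree ≤ Module.finrank E F := by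
  rcases s.eq_empty_or_nonempty with rfl | ⟨w₀, hw₀⟩
  · simp
  have : Nonempty s := ⟨⟨w₀, hw₀⟩⟩
  obtain ⟨J, _, b, hJ, hb, hind⟩ := exists_independent_modulo s fun w => (w.ord z).toNat
  have hcard := (linearIndependent_of_residues (k := k) V (z := z) (O := fun w : s => w.1.ring)
    (fun w => hz w w.2) (fun c hc => ?_) (b := b) (fun w j => hb j w w.2)
    (fun a ha => hind a fun w hw => ?_)).fintype_card_le_finrank
  · have : ∑ w ∈ s, w.ord z * w.degree = ((∑ w ∈ s, (w.ord z).toNat * w.degree : ℕ) : ℤ) := by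
      push_cast
      refine Finset.sum_congr rfl fun w hw => ?_
      rw [Int.toNat_of_nonneg ((w.ord_pos_iff hz0).2 (hz w hw)).le]
    rw [this]
    exact_mod_cast hJ ▸ hcard
  · obtain ⟨a, ha⟩ := hV c hc
    exact ⟨a, fun w => ha w w.2⟩
  · obtain ⟨r, hr, h⟩ := ha ⟨w, hw⟩
    rw [h, Int.toNat_of_nonneg ((w.ord_pos_iff hz0).2 (hz w hw)).le]
    simpa using w.mul_mem_ge (w.mem_ge_ord z) (w.mem_ge_zero.2 hr)

lemma sum_ord_mul_degree_le {z : F} (hz0 : z ≠ 0)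
    [FiniteDimensional (IntermediateField.adjoin k {z}) F] (s : Finset (Place k F))
    (hz : ∀ w ∈ s, 0 < w.ord z) :
    ∑ w ∈ s, w.ord z * w.degree ≤ Module.finrank (IntermediateField.adjoin k {z}) F := by
  rcases s.eq_empty_or_nonempty with rfl | ⟨w₀, hw₀⟩
  · simp
  have hz' : ∀ w ∈ s, z ∈ w.ring.nonunits := fun w hw => (w.ord_pos_iff hz0).1 (hz w hw)
  refine sum_ord_mul_degree_le_of_residues
    (w₀.ring.comap (algebraMap (IntermediateField.adjoin k {z}) F)) hz0 s hz' fun c hc => ?_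
  obtain ⟨a, ha⟩ := exists_residue_of_mem_adjoin (O := fun w : s => w.1.ring)
    (fun w => w.1.algebraMap_mem) (fun w => hz' w w.2) hz0 ⟨w₀, hw₀⟩ c.2 hc
  exact ⟨a, fun w hw => ha ⟨w, hw⟩⟩

lemma finite_setOf_ord_pos (z : F) : {w : Place k F | 0 < w.ord z}.Finite := by
  by_cases hz : Transcendental k z
  · have := IsFunctionField.finite_adjoin z hz
    have hz0 : z ≠ 0 := by rintro rfl; exact hz isAlgebraic_zero
    by_contra hinf
    obtain ⟨t, ht, hcard⟩ := Set.Infinite.exists_subset_card_eq hinf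
      (Module.finrank (IntermediateField.adjoin k {z}) F + 1)
    have h1 := sum_ord_mul_degree_le hz0 t fun w hw => ht hw
    have h2 : ∑ w ∈ t, (1 : ℤ) ≤ ∑ w ∈ t, w.ord z * w.degree := Finset.sum_le_sum fun w hw => by
      have h3 : 0 < w.ord z := ht hw
      have h4 : (0 : ℤ) < w.degree := by exact_mod_cast w.degree_pos
      exact Int.add_one_le_iff.2 (mul_pos h3 h4)
    rw [Finset.sum_const, hcard] at h2
    simp only [nsmul_eq_mul, mul_one, Nat.cast_add, Nat.cast_one] at h2
    omega
  · rw [Transcendental, not_not] at hz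
    convert Set.finite_empty (α := Place k F)
    ext w
    simp [w.ord_eq_zero_of_isAlgebraic hz]

lemma finite_support_ord (z : F) : (Function.support fun w : Place k F => w.ord z).Finite := by
  refine ((finite_setOf_ord_pos z).union (finite_setOf_ord_pos z⁻¹)).subset fun w hw => ?_
  have h : w.ord z ≠ 0 := hw
  rcases lt_or_gt_of_ne h with h | h
  · right
    change 0 < w.ord z⁻¹
    rw [ord_inv]; omega
  · left; exact h

instance : Nonempty (Place k F) := by
  by_contra hcon
  rw [not_nonempty_iff] at hcon
  obtain ⟨t, ht⟩ := IsFunctionField.exists_transcendental (k := k) (F := F)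
  exact ht (isAlgebraic_of_forall_mem_ring fun w => isEmptyElim w)

/-- The divisor of a function. -/
def divisor (k : Type*) {F : Type*} [Field k] [Field F] [Algebra k F] [IsFunctionField k F]
    (z : F) : Place k F →₀ ℤ :=
  Finsupp.ofSupportFinite (fun w => w.ord z) (finite_support_ord z)

@[simp] lemma divisor_apply (z : F) (w : Place k F) : divisor k z w = w.ord z := rfl

end Zeros

end

noncomputable section

/-! ### Riemann's inequality -/

section Riemann

variable {k F : Type*} [Field k] [Field F] [Algebra k F]

open Place

/-- The degree of a divisor. -/
def divDegree : (Place k F →₀ ℤ) →+ ℤ :=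
  Finsupp.liftAddHom fun w => AddMonoidHom.mulRight (w.degree : ℤ)

@[simp] lemma divDegree_single (w : Place k F) (n : ℤ) :
    divDegree (Finsupp.single w n) = n * w.degree := by
  simp [divDegree]

lemma divDegree_eq_sum (D : Place k F →₀ ℤ) :
    divDegree D = ∑ w ∈ D.support, D w * w.degree := by
  simp [divDegree, Finsupp.liftAddHom_apply, Finsupp.sum]

lemma divDegree_nonneg {D : Place k F →₀ ℤ} (hD : 0 ≤ D) : 0 ≤ divDegree D := by
  rw [divDegree_eq_sum]
  exact Finset.sum_nonneg fun w _ => mul_nonneg (hD w) (by positivity)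

lemma mul_degree_le_divDegree {D : Place k F →₀ ℤ} (hD : 0 ≤ D) (w : Place k F) :
    D w * w.degree ≤ divDegree D := by
  by_cases hw : w ∈ D.support
  · rw [divDegree_eq_sum]
    exact Finset.single_le_sum (f := fun w => D w * (w.degree : ℤ))
      (fun w _ => mul_nonneg (hD w) (by positivity)) hw
  · rw [Finsupp.notMem_support_iff.1 hw, zero_mul]
    exact divDegree_nonneg hD

lemma mapRange_toNat {E : Place k F →₀ ℤ} (hE : 0 ≤ E) :
    (E.mapRange Int.toNat Int.toNat_zero).mapRange (Nat.cast : ℕ → ℤ) Nat.cast_zero = E := by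
  ext w
  simpa using hE w

lemma adjoin_inv (z : F) : IntermediateField.adjoin k {z⁻¹} = IntermediateField.adjoin k {z} := by
  have h : ∀ y : F, IntermediateField.adjoin k {y⁻¹} ≤ IntermediateField.adjoin k {y} := fun y => by
    rw [IntermediateField.adjoin_simple_le_iff]
    exact inv_mem (IntermediateField.mem_adjoin_simple_self k y)
  refine le_antisymm (h z) ?_
  simpa using h z⁻¹

variable [IsFunctionField k F]

/-- The Riemann–Roch space of a divisor. -/
def riemannRochSpace (D : Place k F →₀ ℤ) : Submodule k F := ⨅ w : Place k F, w.ge (-D w)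

lemma mem_riemannRochSpace {D : Place k F →₀ ℤ} {x : F} :
    x ∈ riemannRochSpace D ↔ ∀ w : Place k F, x ∈ w.ge (-D w) := by
  simp [riemannRochSpace]

lemma riemannRochSpace_mono {D D' : Place k F →₀ ℤ} (h : D ≤ D') :
    riemannRochSpace D ≤ riemannRochSpace D' := fun x hx => by
  rw [mem_riemannRochSpace] at *
  exact fun w => w.ge_anti (neg_le_neg (h w)) (hx w)

lemma riemannRochSpace_add_single (D : Place k F →₀ ℤ)
    (hD : FiniteDimensional k (riemannRochSpace D)) (w : Place k F) :
    FiniteDimensional k (riemannRochSpace (D + Finsupp.single w 1)) ∧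
      Module.finrank k (riemannRochSpace (D + Finsupp.single w 1)) ≤
        Module.finrank k (riemannRochSpace D) + w.degree := by
  have hle : riemannRochSpace (D + Finsupp.single w 1) ≤ w.ge (-D w - 1) := fun x hx => by
    have := mem_riemannRochSpace.1 hx w
    rw [Finsupp.add_apply, Finsupp.single_eq_same] at this
    rwa [← neg_add']
  let f : riemannRochSpace (D + Finsupp.single w 1) →ₗ[k] IsLocalRing.ResidueField w.ring :=
    (w.leadingCoeff (-D w - 1)).comp (Submodule.inclusion hle)
  have hker : ∀ x : f.ker, ((x : riemannRochSpace (D + Finsupp.single w 1)) : F) ∈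
      riemannRochSpace D := by
    rintro ⟨⟨x, hx⟩, hfx⟩
    rw [mem_riemannRochSpace]
    intro v
    by_cases hv : v = w
    · subst hv
      have := (v.leadingCoeff_eq_zero_iff _).1 (LinearMap.mem_ker.1 hfx)
      rwa [sub_add_cancel] at this
    · have := mem_riemannRochSpace.1 hx v
      rwa [Finsupp.add_apply, Finsupp.single_eq_of_ne hv, add_zero] at this
  let g : f.ker →ₗ[k] riemannRochSpace D :=
    { toFun := fun x => ⟨_, hker x⟩
      map_add' := fun _ _ => rfl
      map_smul' := fun _ _ => rfl }
  have hg : Function.Injective g := fun x y h => by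
    apply Subtype.ext; apply Subtype.ext
    exact congrArg (fun z : riemannRochSpace D => (z : F)) h
  have : FiniteDimensional k f.ker := FiniteDimensional.of_injective g hg
  have : FiniteDimensional k (riemannRochSpace (D + Finsupp.single w 1) ⧸ f.ker) :=
    Module.Finite.equiv f.quotKerEquivRange.symm
  have hfin : FiniteDimensional k (riemannRochSpace (D + Finsupp.single w 1)) :=
    Module.Finite.of_submodule_quotient f.ker
  refine ⟨hfin, ?_⟩
  rw [← f.finrank_range_add_finrank_ker, add_comm]
  exact add_le_add (LinearMap.finrank_le_finrank_of_injective hg) (Submodule.finrank_le _)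

lemma riemannRochSpace_add (E : Place k F →₀ ℕ) (D : Place k F →₀ ℤ)
    (hD : FiniteDimensional k (riemannRochSpace D)) :
    FiniteDimensional k (riemannRochSpace (D + E.mapRange (Nat.cast : ℕ → ℤ) Nat.cast_zero)) ∧
      (Module.finrank k (riemannRochSpace (D + E.mapRange (Nat.cast : ℕ → ℤ) Nat.cast_zero)) : ℤ) ≤
        Module.finrank k (riemannRochSpace D) +
          divDegree (E.mapRange (Nat.cast : ℕ → ℤ) Nat.cast_zero) := by
  induction E using Finsupp.induction_linear generalizing D with
  | zero => rw [Finsupp.mapRange_zero, add_zero, map_zero, add_zero]; exact ⟨hD, le_rfl⟩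
  | add E₁ E₂ h₁ h₂ =>
    obtain ⟨a₁, b₁⟩ := h₁ D hD
    obtain ⟨a₂, b₂⟩ := h₂ _ a₁
    rw [Finsupp.mapRange_add (by simp), ← add_assoc, map_add]
    exact ⟨a₂, by linarith⟩
  | single w n =>
    rw [Finsupp.mapRange_single, divDegree_single]
    induction n with
    | zero => rw [Nat.cast_zero, Finsupp.single_zero, add_zero, zero_mul, add_zero]; exact ⟨hD, le_rfl⟩
    | succ n ih =>
      obtain ⟨a, b⟩ := riemannRochSpace_add_single _ ih.1 w
      rw [Nat.cast_succ, Finsupp.single_add, ← add_assoc]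
      refine ⟨a, ?_⟩
      have b' : (Module.finrank k (riemannRochSpace (D + Finsupp.single w (n : ℤ) +
        Finsupp.single w 1)) : ℤ) ≤ Module.finrank k (riemannRochSpace
          (D + Finsupp.single w (n : ℤ))) + w.degree := by exact_mod_cast b
      linarith [ih.2]

instance finiteDimensional_riemannRochSpace_zero :
    FiniteDimensional k (riemannRochSpace (0 : Place k F →₀ ℤ)) := by
  obtain ⟨w⟩ := (inferInstance : Nonempty (Place k F))
  have hle : riemannRochSpace (0 : Place k F →₀ ℤ) ≤ w.ge 0 := fun x hx => by
    simpa using mem_riemannRochSpace.1 hx w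
  refine FiniteDimensional.of_injective ((w.leadingCoeff 0).comp (Submodule.inclusion hle)) ?_
  rw [injective_iff_map_eq_zero]
  rintro ⟨x, hx⟩ h
  have h1 := (w.leadingCoeff_eq_zero_iff _).1 h
  rw [zero_add] at h1
  by_contra hx0
  refine w.transcendental_of_mem_nonunits (fun h => hx0 (Subtype.ext h)) (w.mem_ge_one.1 h1) ?_
  exact isAlgebraic_of_forall_mem_ring fun v => v.mem_ge_zero.1
    (by simpa using mem_riemannRochSpace.1 hx v)

instance finiteDimensional_riemannRochSpace (D : Place k F →₀ ℤ) :
    FiniteDimensional k (riemannRochSpace D) := by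
  have h0 : (0 : Place k F →₀ ℤ) ≤ D ⊔ 0 := le_sup_right
  have := (riemannRochSpace_add ((D ⊔ 0).mapRange Int.toNat Int.toNat_zero) 0 inferInstance).1
  rw [mapRange_toNat h0, zero_add] at this
  exact Submodule.finiteDimensional_of_le (riemannRochSpace_mono (le_sup_left : D ≤ D ⊔ 0))

lemma finrank_riemannRochSpace_le {D D' : Place k F →₀ ℤ} (h : D ≤ D') :
    (Module.finrank k (riemannRochSpace D') : ℤ) ≤
      Module.finrank k (riemannRochSpace D) + divDegree (D' - D) := by
  have := (riemannRochSpace_add ((D' - D).mapRange Int.toNat Int.toNat_zero) D inferInstance).2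
  rwa [mapRange_toNat (sub_nonneg.2 h), add_sub_cancel] at this

lemma finrank_riemannRochSpace_sub_divisor_le (D : Place k F →₀ ℤ) {z : F} (hz : z ≠ 0) :
    Module.finrank k (riemannRochSpace (D - divisor k z)) ≤
      Module.finrank k (riemannRochSpace D) := by
  have hmem : ∀ x ∈ riemannRochSpace (D - divisor k z), x * z⁻¹ ∈ riemannRochSpace D := by
    intro x hx
    rw [mem_riemannRochSpace] at *
    intro w
    rw [mul_mem_ge_iff _ (inv_ne_zero hz), ord_inv]
    convert hx w using 1
    simp; ring_nf
  refine LinearMap.finrank_le_finrank_of_injective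
    (f := ((LinearMap.mulRight k z⁻¹).restrict hmem)) ?_
  rintro ⟨x, hx⟩ ⟨y, hy⟩ h
  have h' : x * z⁻¹ = y * z⁻¹ := congrArg Subtype.val h
  exact Subtype.ext (mul_right_cancel₀ (inv_ne_zero hz) h')

/-- The divisor of poles of a function. -/
def poleDivisor (k : Type*) {F : Type*} [Field k] [Field F] [Algebra k F] [IsFunctionField k F]
    (z : F) : Place k F →₀ ℤ := (-divisor k z) ⊔ 0

lemma poleDivisor_nonneg (z : F) : 0 ≤ poleDivisor k z := le_sup_right

lemma mem_riemannRochSpace_poleDivisor (z : F) : z ∈ riemannRochSpace (poleDivisor k z) := by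
  rw [mem_riemannRochSpace]
  intro w
  refine w.ge_anti ?_ (w.mem_ge_ord z)
  have : (-divisor k z) w ≤ poleDivisor k z w := (le_sup_left : -divisor k z ≤ poleDivisor k z) w
  rw [Finsupp.neg_apply, divisor_apply] at this
  omega

lemma divisor_eq_sub (z : F) : divisor k z = poleDivisor k z⁻¹ - poleDivisor k z := by
  ext w
  simp only [poleDivisor, Finsupp.coe_sub, Pi.sub_apply, Finsupp.sup_apply, Finsupp.neg_apply,
    divisor_apply, Finsupp.coe_zero, Pi.zero_apply, ord_inv, neg_neg]
  rcases le_total 0 (w.ord z) with h | h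
  · rw [sup_eq_left.2 h, sup_eq_right.2 (by omega)]; omega
  · rw [sup_eq_right.2 h, sup_eq_left.2 (by omega)]; omega

lemma divDegree_poleDivisor_inv_le {z : F} (hz : Transcendental k z) :
    divDegree (poleDivisor k z⁻¹) ≤ Module.finrank (IntermediateField.adjoin k {z}) F := by
  have := IsFunctionField.finite_adjoin z hz
  have hz0 : z ≠ 0 := by rintro rfl; exact hz isAlgebraic_zero
  have hval : ∀ w : Place k F, poleDivisor k z⁻¹ w = w.ord z ⊔ 0 := fun w => by
    simp [poleDivisor, ord_inv]
  have hpos : ∀ w ∈ (poleDivisor k z⁻¹).support, 0 < w.ord z := fun w hw => by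
    rw [Finsupp.mem_support_iff, hval] at hw
    by_contra! h
    exact hw (sup_eq_right.2 h)
  refine le_trans (le_of_eq ?_) (sum_ord_mul_degree_le hz0 (poleDivisor k z⁻¹).support hpos)
  rw [divDegree_eq_sum]
  refine Finset.sum_congr rfl fun w hw => ?_
  rw [hval, sup_eq_left.2 (hpos w hw).le]

lemma linearIndependent_pow_of_transcendental {E : Type*} [Field E] [Algebra k E] {z : E}
    (hz : Transcendental k z) : LinearIndependent k fun n : ℕ => z ^ n := by
  have h := (Polynomial.basisMonomials k).linearIndependent.map' (Polynomial.aeval z).toLinearMap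
    (LinearMap.ker_eq_bot.2 (transcendental_iff_injective.1 hz))
  have he : (fun n : ℕ => z ^ n) =
      (Polynomial.aeval z).toLinearMap ∘ (Polynomial.basisMonomials k) := by
    ext n; simp
  rw [he]
  exact h

/-- A `k(z)`-basis of `F` produces many functions with poles bounded by multiples of the pole
divisor of `z`. -/
lemma exists_le_finrank_riemannRochSpace {z : F} (hz : Transcendental k z) :
    ∃ C : Place k F →₀ ℤ, 0 ≤ C ∧ ∀ n : ℕ,
      (n + 1) * Module.finrank (IntermediateField.adjoin k {z}) F ≤
        Module.finrank k (riemannRochSpace (n • poleDivisor k z + C)) := by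
  have := IsFunctionField.finite_adjoin z hz
  let u := Module.finBasis (IntermediateField.adjoin k {z}) F
  have hC : 0 ≤ ∑ i, poleDivisor k (u i) := Finset.sum_nonneg fun i _ => poleDivisor_nonneg _
  refine ⟨∑ i, poleDivisor k (u i), hC, fun n => ?_⟩
  have hz' : Transcendental k (IntermediateField.AdjoinSimple.gen k z) := by
    intro h
    exact hz (by simpa using h.algebraMap (A := F))
  have hind := linearIndependent_smul
    ((linearIndependent_pow_of_transcendental hz').comp (Fin.val : Fin (n + 1) → ℕ)
      Fin.val_injective) u.linearIndependent
  have hmem : ∀ p : Fin (n + 1) × Fin (Module.finrank (IntermediateField.adjoin k {z}) F),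
      (((fun m : ℕ => IntermediateField.AdjoinSimple.gen k z ^ m) ∘ Fin.val) p.1) • u p.2 ∈
        riemannRochSpace (n • poleDivisor k z + ∑ i, poleDivisor k (u i)) := by
    rintro ⟨⟨m, hm⟩, i⟩
    rw [mem_riemannRochSpace]
    intro w
    have h1 : ∀ m : ℕ, z ^ m ∈ w.ge (-(m * poleDivisor k z w)) := by
      intro m
      induction m with
      | zero => simpa using w.mem_ge_zero.2 (one_mem _)
      | succ m ih =>
        rw [pow_succ]
        refine w.ge_anti (le_of_eq ?_)
          (w.mul_mem_ge ih (mem_riemannRochSpace.1 (mem_riemannRochSpace_poleDivisor z) w))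
        push_cast; ring
    have h2 := w.mul_mem_ge (h1 m)
      (mem_riemannRochSpace.1 (mem_riemannRochSpace_poleDivisor (u i)) w)
    have h3 : poleDivisor k (u i) w ≤ (∑ i, poleDivisor k (u i)) w :=
      (Finset.single_le_sum (f := fun i => poleDivisor k (u i))
        (fun i _ => poleDivisor_nonneg _) (Finset.mem_univ i) :) w
    have h4 : (m : ℤ) * poleDivisor k z w ≤ n * poleDivisor k z w :=
      mul_le_mul_of_nonneg_right (by omega) (poleDivisor_nonneg z w)
    have h5 : ((((fun m : ℕ => IntermediateField.AdjoinSimple.gen k z ^ m) ∘ Fin.val)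
        (⟨m, hm⟩ : Fin (n + 1))) • u i) = z ^ m * u i := by
      rw [IntermediateField.smul_def]
      simp
    rw [h5]
    refine w.ge_anti ?_ h2
    rw [Finsupp.add_apply, Finsupp.smul_apply, nsmul_eq_mul]
    omega
  have hcard := (LinearIndependent.of_comp (v := fun p => (⟨_, hmem p⟩ : riemannRochSpace _))
    (Submodule.subtype _) hind).fintype_card_le_finrank
  simpa using hcard

/-- The degree of a pole divisor is at least the degree of the function; as the degree of the zero
divisor is at most that, the degree of a principal divisor is never positive. -/
lemma finrank_adjoin_le_divDegree_poleDivisor {z : F} (hz : Transcendental k z) :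
    (Module.finrank (IntermediateField.adjoin k {z}) F : ℤ) ≤ divDegree (poleDivisor k z) := by
  obtain ⟨C, hC, h⟩ := exists_le_finrank_riemannRochSpace hz
  by_contra! hlt
  set N := Module.finrank (IntermediateField.adjoin k {z}) F
  set c := Module.finrank k (riemannRochSpace C)
  have h1 : ((c + 1 : ℕ) * N : ℤ) ≤ c + c * divDegree (poleDivisor k z) := by
    have h2 := finrank_riemannRochSpace_le (D := C) (D' := c • poleDivisor k z + C)
      (le_add_of_nonneg_left (nsmul_nonneg (poleDivisor_nonneg z) c))
    rw [add_sub_cancel_right, map_nsmul, nsmul_eq_mul] at h2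
    have h3 : ((c + 1 : ℕ) * N : ℤ) ≤ Module.finrank k (riemannRochSpace
      (c • poleDivisor k z + C)) := by exact_mod_cast h c
    exact h3.trans h2
  push_cast at h1
  have hc : (0 : ℤ) ≤ c := by positivity
  have hd := divDegree_nonneg (poleDivisor_nonneg (k := k) z)
  nlinarith

lemma divDegree_divisor_nonpos (z : F) : divDegree (divisor k z) ≤ 0 := by
  by_cases hz : Transcendental k z
  · rw [divisor_eq_sub, map_sub]
    linarith [divDegree_poleDivisor_inv_le hz, finrank_adjoin_le_divDegree_poleDivisor hz]
  · rw [Transcendental, not_not] at hz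
    have : divisor k z = 0 := by
      ext w; simp [w.ord_eq_zero_of_isAlgebraic hz]
    rw [this, map_zero]

/-- Riemann's inequality. -/
theorem exists_divDegree_sub_le_finrank (k F : Type*) [Field k] [Field F] [Algebra k F]
    [IsFunctionField k F] :
    ∃ c : ℤ, ∀ D : Place k F →₀ ℤ,
      divDegree D - c ≤ Module.finrank k (riemannRochSpace D) := by
  obtain ⟨t, ht⟩ := IsFunctionField.exists_transcendental (k := k) (F := F)
  obtain ⟨C, hC, hn⟩ := exists_le_finrank_riemannRochSpace ht
  set B := poleDivisor k t
  have hB0 : 0 ≤ B := poleDivisor_nonneg t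
  set N := Module.finrank (IntermediateField.adjoin k {t}) F
  have hBN : divDegree B ≤ N := by
    have ht' : Transcendental k t⁻¹ := fun h => ht (by simpa using h.inv)
    have := divDegree_poleDivisor_inv_le ht'
    rwa [inv_inv, adjoin_inv] at this
  have hnB : ∀ n : ℕ, n * divDegree B - divDegree C ≤ Module.finrank k (riemannRochSpace (n • B)) := by
    intro n
    have h1 := finrank_riemannRochSpace_le (D := n • B) (D' := n • B + C)
      (le_add_of_nonneg_right hC)
    rw [add_sub_cancel_left] at h1
    have h2 : ((n + 1 : ℕ) * N : ℤ) ≤ Module.finrank k (riemannRochSpace (n • B + C)) := by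
      exact_mod_cast hn n
    push_cast at h2
    have h3 : (n : ℤ) * divDegree B ≤ n * N := mul_le_mul_of_nonneg_left hBN (by positivity)
    have h4 : (0 : ℤ) ≤ N := by positivity
    linarith
  have hBpos : 0 < divDegree B := by
    have h1 := finrank_adjoin_le_divDegree_poleDivisor ht
    have := IsFunctionField.finite_adjoin t ht
    have h2 : 0 < N := Module.finrank_pos
    exact lt_of_lt_of_le (by exact_mod_cast h2) h1
  refine ⟨divDegree C, fun D => ?_⟩
  obtain ⟨n, hnlarge⟩ : ∃ n : ℕ, divDegree C + divDegree (D ⊔ 0) < n * divDegree B := by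
    refine ⟨(divDegree C + divDegree (D ⊔ 0)).toNat + 1, ?_⟩
    have := Int.self_le_toNat (divDegree C + divDegree (D ⊔ 0))
    push_cast
    nlinarith
  have hpos : 0 < Module.finrank k (riemannRochSpace (n • B - D ⊔ 0)) := by
    have h1 := finrank_riemannRochSpace_le (D := n • B - D ⊔ 0) (D' := n • B)
      (sub_le_self _ le_sup_right)
    rw [sub_sub_cancel] at h1
    have := hnB n
    omega
  obtain ⟨⟨z, hz⟩, hz0⟩ := (Module.finrank_pos_iff_exists_ne_zero).1 hpos
  have hz0' : z ≠ 0 := fun h => hz0 (Subtype.ext h)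
  -- multiplication by `z` moves `D` below `n • B` without decreasing its degree
  have hle : D - divisor k z ≤ n • B := fun w => by
    have h1 := (w.mem_ge_iff hz0').1 (mem_riemannRochSpace.1 hz w)
    have h2 : D w ≤ (D ⊔ 0) w := (le_sup_left : D ≤ D ⊔ 0) w
    rw [Finsupp.sub_apply] at h1
    rw [Finsupp.sub_apply, divisor_apply]
    omega
  have h1 := finrank_riemannRochSpace_le hle
  have h2 : (Module.finrank k (riemannRochSpace (D - divisor k z)) : ℤ) ≤
    Module.finrank k (riemannRochSpace D) := by
      exact_mod_cast finrank_riemannRochSpace_sub_divisor_le D hz0'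
  have h3 := hnB n
  have h4 := divDegree_divisor_nonpos (k := k) z
  rw [map_sub, map_sub, map_nsmul, nsmul_eq_mul] at h1
  linarith

end Riemann

end

noncomputable section

/-! ### Torsion of the divisor class group over a finite field -/

section Torsion

variable {k F : Type*} [Field k] [Field F] [Algebra k F] [IsFunctionField k F]

open Place

lemma finite_setOf_degree_le [Finite k] (M : ℕ) : {w : Place k F | w.degree ≤ M}.Finite := by
  obtain ⟨t, ht⟩ := IsFunctionField.exists_transcendental (k := k) (F := F)
  set Q := Nat.card k ^ M.factorial
  have hQ : Q ≠ 1 := (one_lt_pow₀ (Finite.one_lt_card) (Nat.factorial_ne_zero M)).ne'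
  -- at a place of degree at most `M`, either `t` has a pole or `t ^ Q - t` has a zero
  have hy : t ^ Q - t ≠ 0 := fun h => hQ
    ((linearIndependent_pow_of_transcendental ht).injective (by simpa using sub_eq_zero.1 h))
  refine ((finite_support_ord t).union (finite_support_ord (t ^ Q - t))).subset fun w hw => ?_
  have hwM : w.degree ≤ M := hw
  by_cases htw : t ∈ w.ring
  · right
    refine ((w.ord_pos_iff hy).2 ?_).ne'
    have hκ : Finite (IsLocalRing.ResidueField w.ring) := Module.finite_of_finite k
    have := Fintype.ofFinite (IsLocalRing.ResidueField w.ring)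
    have hcard : Fintype.card (IsLocalRing.ResidueField w.ring) = Nat.card k ^ w.degree := by
      rw [← Nat.card_eq_fintype_card]
      exact Module.natCard_eq_pow_finrank
    obtain ⟨m, hm⟩ := Nat.dvd_factorial w.degree_pos hwM
    have h1 := FiniteField.pow_card_pow m (IsLocalRing.residue w.ring ⟨t, htw⟩)
    rw [hcard, ← pow_mul, ← hm] at h1
    have h2 : (⟨t, htw⟩ ^ Q - ⟨t, htw⟩ : w.ring) ∈ IsLocalRing.maximalIdeal w.ring := by
      rw [← IsLocalRing.residue_eq_zero_iff, map_sub, map_pow, h1, sub_self]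
    exact ValuationSubring.coe_mem_nonunits_iff.2 h2
  · left
    have ht0 : t ≠ 0 := by rintro rfl; exact htw (zero_mem _)
    exact fun h => htw ((w.ord_nonneg_iff ht0).1 (le_of_eq h.symm))

lemma finite_setOf_effective [Finite k] (M : ℕ) :
    {E : Place k F →₀ ℤ | 0 ≤ E ∧ divDegree E ≤ M}.Finite := by
  classical
  set P := (finite_setOf_degree_le (k := k) (F := F) M).toFinset
  refine (Set.finite_Icc 0 (∑ w ∈ P, Finsupp.single w (M : ℤ))).subset fun E hE => ⟨hE.1, fun w => ?_⟩
  have hle := (mul_degree_le_divDegree hE.1 w).trans hE.2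
  have hd : (1 : ℤ) ≤ w.degree := by exact_mod_cast w.degree_pos
  have hEw : 0 ≤ E w := hE.1 w
  rw [Finsupp.finsetSum_apply]
  by_cases hw : w ∈ P
  · have h1 : Finsupp.single w (M : ℤ) w ≤ ∑ v ∈ P, Finsupp.single v (M : ℤ) w :=
      Finset.single_le_sum (f := fun v => Finsupp.single v (M : ℤ) w) (fun v _ => by
        rw [Finsupp.single_apply]; split_ifs <;> positivity) hw
    rw [Finsupp.single_eq_same] at h1
    nlinarith
  · have h1 : (M : ℤ) < w.degree := by
      by_contra! h
      exact hw ((Set.Finite.mem_toFinset _).2 (by exact_mod_cast h))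
    have h2 : E w = 0 := by nlinarith
    rw [h2]
    refine Finset.sum_nonneg fun v _ => ?_
    rw [Finsupp.single_apply]; split_ifs <;> positivity

/-- A divisor of degree zero over a finite field has a non-zero multiple which is principal: by
Riemann's inequality its multiples are all equivalent to a divisor from a finite list. -/
theorem exists_divisor_eq_nsmul [Finite k] (D : Place k F →₀ ℤ) (hD : divDegree D = 0) :
    ∃ (φ : F) (n : ℕ), φ ≠ 0 ∧ 0 < n ∧ divisor k φ = n • D := by
  obtain ⟨c, hc⟩ := exists_divDegree_sub_le_finrank k F
  obtain ⟨w₀⟩ := (inferInstance : Nonempty (Place k F))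
  set E₀ : Place k F →₀ ℤ := Finsupp.single w₀ ((c.toNat + 1 : ℕ) : ℤ)
  have hE₀ : c < divDegree E₀ := by
    rw [divDegree_single]
    have hd : (1 : ℤ) ≤ w₀.degree := by exact_mod_cast w₀.degree_pos
    have := Int.self_le_toNat c
    push_cast
    nlinarith
  have hex : ∀ j : ℕ, ∃ φ : F, φ ≠ 0 ∧ φ ∈ riemannRochSpace (E₀ - j • D) := by
    intro j
    have h := hc (E₀ - j • D)
    rw [map_sub, map_nsmul, hD, smul_zero, sub_zero] at h
    have hpos : 0 < Module.finrank k (riemannRochSpace (E₀ - j • D)) := by omega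
    obtain ⟨⟨z, hz⟩, hz0⟩ := (Module.finrank_pos_iff_exists_ne_zero).1 hpos
    exact ⟨z, fun h => hz0 (Subtype.ext h), hz⟩
  choose φ hφ0 hφ using hex
  obtain ⟨i, j, hij, h⟩ := Set.Finite.exists_lt_map_eq_of_forall_mem
    (t := {E : Place k F →₀ ℤ | 0 ≤ E ∧ divDegree E ≤ (divDegree E₀).toNat})
    (f := fun j => divisor k (φ j) + (E₀ - j • D)) (fun j => ⟨fun w => by
      have := (w.mem_ge_iff (hφ0 j)).1 (mem_riemannRochSpace.1 (hφ j) w)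
      rw [Finsupp.add_apply, divisor_apply, Finsupp.zero_apply]
      omega, by
      rw [map_add, map_sub, map_nsmul, hD, smul_zero, sub_zero]
      have := divDegree_divisor_nonpos (k := k) (φ j)
      have := Int.self_le_toNat (divDegree E₀)
      omega⟩) (finite_setOf_effective (k := k) (F := F) (divDegree E₀).toNat)
  refine ⟨φ j / φ i, j - i, div_ne_zero (hφ0 j) (hφ0 i), by omega, ?_⟩
  ext w
  have hw := DFunLike.congr_fun h w
  simp only [Finsupp.add_apply, Finsupp.sub_apply, divisor_apply, Finsupp.smul_apply,
    nsmul_eq_mul] at hw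
  rw [divisor_apply, ord_div _ (hφ0 j) (hφ0 i), Finsupp.smul_apply, nsmul_eq_mul,
    Nat.cast_sub hij.le]
  linarith

/-- Over a finite field, some function has the same positive order at all places of `T`, the same
order at all places of `S`, and order zero elsewhere: a multiple of the divisor of degree zero
`(deg S) T - (deg T) S` is principal. -/
theorem exists_ord_eq [Finite k] {S T : Finset (Place k F)} (hS : S.Nonempty) (hST : Disjoint S T) :
    ∃ (φ : F) (α β : ℤ), φ ≠ 0 ∧ 0 < α ∧ (∀ w ∈ T, w.ord φ = α) ∧ (∀ w ∈ S, w.ord φ = β) ∧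
      ∀ w, w ∉ S → w ∉ T → w.ord φ = 0 := by
  classical
  have hpos : ∀ {R : Finset (Place k F)}, R.Nonempty → 0 < ∑ w ∈ R, (w.degree : ℤ) := fun hR =>
    Finset.sum_pos (fun w _ => by exact_mod_cast w.degree_pos) hR
  set a := ∑ w ∈ S, (w.degree : ℤ)
  set b := ∑ w ∈ T, (w.degree : ℤ)
  set D : Place k F →₀ ℤ := ∑ w ∈ T, Finsupp.single w a - ∑ w ∈ S, Finsupp.single w b
  have hD : divDegree D = 0 := by
    simp only [D, map_sub, map_sum, divDegree_single, ← Finset.mul_sum]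
    ring
  have hDw : ∀ w, D w = (if w ∈ T then a else 0) - (if w ∈ S then b else 0) := fun w => by
    simp only [D, Finsupp.sub_apply, Finsupp.finsetSum_apply, Finsupp.single_apply]
    simp
  obtain ⟨φ, n, hφ, hn, hφD⟩ := exists_divisor_eq_nsmul D hD
  have hord : ∀ w, w.ord φ = n * D w := fun w => by
    rw [← divisor_apply, hφD, Finsupp.smul_apply, nsmul_eq_mul]
  refine ⟨φ, n * a, n * (-b), hφ, mul_pos (by exact_mod_cast hn) (hpos hS), fun w hw => ?_,
    fun w hw => ?_, fun w hwS hwT => ?_⟩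
  · rw [hord, hDw, if_pos hw, if_neg (Finset.disjoint_right.1 hST hw), sub_zero]
  · rw [hord, hDw, if_pos hw, if_neg (Finset.disjoint_left.1 hST hw), zero_sub]
  · rw [hord, hDw, if_neg hwS, if_neg hwT, sub_zero, mul_zero]

/-- Over a finite field, a function without zeros and poles is a root of unity, being algebraic over
the constants. -/
lemma exists_pow_eq_one_of_forall_ord [Finite k] {u : F} (hu0 : u ≠ 0)
    (hu : ∀ w : Place k F, w.ord u = 0) : ∃ n : ℕ, 0 < n ∧ u ^ n = 1 := by
  have hint : IsIntegral k u := (isAlgebraic_of_forall_mem_ring fun w =>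
    (w.ord_nonneg_iff hu0).1 (hu w).ge).isIntegral
  have := IntermediateField.adjoin.finiteDimensional hint
  have : Finite (IntermediateField.adjoin k {u}) := Module.finite_of_finite k
  have := Fintype.ofFinite (IntermediateField.adjoin k {u})
  refine ⟨Fintype.card (IntermediateField.adjoin k {u}) - 1, ?_, ?_⟩
  · have := Fintype.one_lt_card (α := IntermediateField.adjoin k {u})
    omega
  · have hg : IntermediateField.AdjoinSimple.gen k u ≠ 0 := fun h =>
      hu0 (by simpa using congrArg Subtype.val h)
    simpa using congrArg Subtype.val (FiniteField.pow_card_sub_one_eq_one _ hg)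

end Torsion

end

noncomputable section

/-! ### Residue maps and restriction of places -/

section Residue

variable {k F Ω : Type*} [Field k] [Field F] [Field Ω] [Algebra k F] [Algebra k Ω]

/-- A homomorphism from the valuation ring of a place to `Ω` is a residue map if it is compatible
with the constants and factors through the residue field. -/
structure Place.IsResidueMap (w : Place k F) (ι : w.ring →+* Ω) : Prop where
  map_algebraMap : ∀ c : k, ι (algebraMap k w.ring c) = algebraMap k Ω c
  map_eq_zero : ∀ x : w.ring, (x : F) ∈ w.ring.nonunits → ι x = 0

namespace Place

lemma mem_nonunits_of_map_eq_zero {w : Place k F} {ι : w.ring →+* Ω}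
    {x : w.ring} (hx : ι x = 0) : (x : F) ∈ w.ring.nonunits := by
  by_contra h
  have hu : IsUnit x := by
    by_contra h'
    exact h (ValuationSubring.coe_mem_nonunits_iff.2 h')
  exact (hu.map ι).ne_zero hx

lemma exists_isResidueMap [IsFunctionField k F] [IsAlgClosed Ω] (w : Place k F) :
    ∃ ι : w.ring →+* Ω, w.IsResidueMap ι := by
  let σ : IsLocalRing.ResidueField w.ring →ₐ[k] Ω := IsAlgClosed.lift
  refine ⟨(σ : IsLocalRing.ResidueField w.ring →+* Ω).comp (IsLocalRing.residue w.ring), ?_, ?_⟩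
  · exact fun c => σ.commutes c
  · intro x hx
    have h : IsLocalRing.residue w.ring x = 0 := by
      rw [IsLocalRing.residue_eq_zero_iff]
      exact ValuationSubring.coe_mem_nonunits_iff.1 hx
    rw [RingHom.comp_apply, h, map_zero]

variable {F₀ : Type*} [Field F₀] [Algebra k F₀]

/-- The restriction of a place to a subfield. -/
def comap [IsFunctionField k F₀] [IsFunctionField k F] (w : Place k F) (φ : F₀ →ₐ[k] F) :
    Place k F₀ where
  ring := w.ring.comap (φ : F₀ →+* F)
  algebraMap_mem c := by
    rw [ValuationSubring.mem_comap, RingHom.coe_coe, AlgHom.commutes]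
    exact w.algebraMap_mem c
  ne_top h := by
    have hmem : ∀ x : F₀, φ x ∈ w.ring := fun x => by
      have : x ∈ w.ring.comap (φ : F₀ →+* F) := by rw [h]; trivial
      exact this
    obtain ⟨t, ht⟩ := IsFunctionField.exists_transcendental (k := k) (F := F₀)
    have htφ : Transcendental k (φ t) := fun h =>
      ht ((isAlgebraic_algHom_iff φ φ.injective).1 h)
    have := IsFunctionField.finite_adjoin (φ t) htφ
    refine w.ne_top (SetLike.ext fun x => ⟨fun _ => trivial, fun _ => ?_⟩)
    refine w.mem_ring_of_isIntegralElem
      (algebraMap (IntermediateField.adjoin k {φ t}) F) (fun r => ?_)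
      (Algebra.IsIntegral.isIntegral (R := IntermediateField.adjoin k {φ t}) x)
    have hle : IntermediateField.adjoin k {φ t} ≤ φ.fieldRange := by
      rw [IntermediateField.adjoin_simple_le_iff]; exact ⟨t, rfl⟩
    obtain ⟨y, hy⟩ := hle r.2
    change (r : F) ∈ _
    rw [← hy]
    exact hmem y

variable [IsFunctionField k F₀] [IsFunctionField k F]

lemma mem_comap_ring {w : Place k F} {φ : F₀ →ₐ[k] F} {x : F₀} :
    x ∈ (w.comap φ).ring ↔ φ x ∈ w.ring := Iff.rfl

lemma mem_comap_nonunits {w : Place k F} {φ : F₀ →ₐ[k] F} {x : F₀} :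
    x ∈ (w.comap φ).ring.nonunits ↔ φ x ∈ w.ring.nonunits := by
  by_cases hx : x = 0
  · subst hx; simp
  have h : φ x ≠ 0 := by simpa using hx
  have h1 := (w.comap φ).ring.inv_mem_nonunits_iff (x := x⁻¹)
  have h2 := w.ring.inv_mem_nonunits_iff (x := φ x⁻¹)
  rw [← map_inv₀, inv_inv] at h2
  rw [inv_inv] at h1
  rw [h1, h2, mem_comap_ring, map_eq_zero_iff φ φ.injective]

/-- Orders at a place and at its restriction differ by the factor `e`, the ramification index. -/
lemma ord_algHom (w : Place k F) (φ : F₀ →ₐ[k] F) {π : F₀} (hπ : (w.comap φ).ord π = 1)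
    {x : F₀} (hx : x ≠ 0) : w.ord (φ x) = w.ord (φ π) * (w.comap φ).ord x := by
  have hπ0 : π ≠ 0 := by rintro rfl; simp [ord] at hπ
  set n := (w.comap φ).ord x
  have hu0 : x * π ^ (-n) ≠ 0 := mul_ne_zero hx (zpow_ne_zero _ hπ0)
  have hu : (w.comap φ).ord (x * π ^ (-n)) = 0 := by
    rw [ord_mul _ hx (zpow_ne_zero _ hπ0), ord_zpow, hπ]; simp [n]
  have hw : w.ord (φ (x * π ^ (-n))) = 0 := by
    have hne : φ (x * π ^ (-n)) ≠ 0 := by rwa [Ne, map_eq_zero_iff φ φ.injective]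
    have h1 := (w.ord_nonneg_iff hne).2 (((w.comap φ).ord_nonneg_iff hu0).1 hu.ge)
    have h2 : ¬ 0 < w.ord (φ (x * π ^ (-n))) := by
      rw [ord_pos_iff _ hne, ← mem_comap_nonunits, ← ord_pos_iff _ hu0]; omega
    omega
  rw [map_mul, map_zpow₀, ord_mul _ (by simpa using hx) (zpow_ne_zero _ (by simpa using hπ0)),
    ord_zpow] at hw
  linarith

/-- The fundamental inequality `∑ e ≤ [F : F₀]`, over a place with residue field `k`. -/
theorem sum_ord_le_of_comap_eq (φ : F₀ →ₐ[k] F) (hfin : (φ : F₀ →+* F).Finite) {d : ℕ}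
    (hd : @Module.finrank F₀ F _ _ (φ : F₀ →+* F).toAlgebra.toModule ≤ d) {v : Place k F₀}
    (hv : ∀ c ∈ v.ring, ∃ a : k, c - algebraMap k F₀ a ∈ v.ring.nonunits)
    {π : F₀} (hπ : v.ord π = 1) (s : Finset (Place k F)) (hs : ∀ w ∈ s, w.comap φ = v) :
    (∀ w ∈ s, 1 ≤ w.ord (φ π)) ∧ ∑ w ∈ s, w.ord (φ π) ≤ d := by
  let _ : Algebra F₀ F := (φ : F₀ →+* F).toAlgebra
  have : FiniteDimensional F₀ F := hfin
  have hπ0 : π ≠ 0 := by rintro rfl; simp [ord] at hπ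
  have hφπ : φ π ≠ 0 := by simpa using hπ0
  have hnon : ∀ w ∈ s, φ π ∈ w.ring.nonunits := fun w hw => by
    rw [← mem_comap_nonunits, hs w hw, ← ord_pos_iff _ hπ0, hπ]; exact one_pos
  have hpos : ∀ w ∈ s, 1 ≤ w.ord (φ π) := fun w hw => (w.ord_pos_iff hφπ).2 (hnon w hw)
  refine ⟨hpos, ?_⟩
  refine le_trans (Finset.sum_le_sum fun w hw => ?_)
    (le_trans (sum_ord_mul_degree_le_of_residues v.ring hφπ s hnon fun c hc => ?_)
      (by exact_mod_cast hd))
  · have h1 : (1 : ℤ) ≤ w.degree := by exact_mod_cast w.degree_pos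
    nlinarith [hpos w hw]
  · obtain ⟨a, ha⟩ := hv c hc
    refine ⟨a, fun w hw => ⟨φ ((c - algebraMap k F₀ a) * π⁻¹), ?_, ?_⟩⟩
    · rw [← mem_comap_ring, hs w hw, ← mem_ge_zero, mul_mem_ge_iff _ (inv_ne_zero hπ0), ord_inv, hπ]
      simpa using v.mem_ge_one.2 ha
    · change φ c - _ = _
      rw [← AlgHom.commutes φ a, ← map_sub, ← map_mul]
      congr 1
      field_simp

end Place

end Residue

end

noncomputable section

/-! ### Points of a curve in terms of its function field -/

/-- The geometric points of a smooth complete curve, as seen from its function field `K`: each point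
`P` has a local ring `R P` inside `K`, with an evaluation map `ev P` to the algebraically closed
field `Ω`. The local rings are discrete valuation rings (`exists_uniformizer`), and each valuation
ring of `K` over `k` with a residue map to `Ω` dominates exactly one of them (`exists_center`,
`center_unique`), compatibly with the evaluation. -/
structure CurveModel (k Ω K : Type*) [Field k] [Field Ω] [Field K] [Algebra k Ω]
    [Algebra k K] where
  /-- the points -/
  Pt : Type*
  /-- the local ring of a point -/
  R : Pt → Type*
  [commRing : ∀ P, CommRing (R P)]
  /-- the inclusion of a local ring in the function field -/
  incl : ∀ P, R P →+* K
  /-- evaluation at a point -/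
  ev : ∀ P, R P →+* Ω
  /-- the constants of a local ring -/
  const : ∀ P, k →+* R P
  incl_const : ∀ P c, incl P (const P c) = algebraMap k K c
  ev_const : ∀ P c, ev P (const P c) = algebraMap k Ω c
  incl_injective : ∀ P, Function.Injective (incl P)
  exists_uniformizer : ∀ P, ∃ π : R P, ev P π = 0 ∧ π ≠ 0 ∧
    ∀ x : K, x ≠ 0 → ∃ (n : ℤ) (u : (R P)ˣ), x = incl P u * incl P π ^ n
  exists_center : ∀ (W : ValuationSubring K) (hW : ∀ c, algebraMap k K c ∈ W) (ι : W →+* Ω)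
    [IsLocalHom ι], (∀ c, ι ⟨algebraMap k K c, hW c⟩ = algebraMap k Ω c) →
    ∃ P, ∃ j : R P →+* W, (∀ r, (j r : K) = incl P r) ∧ ∀ r, ι (j r) = ev P r
  center_unique : ∀ (W : ValuationSubring K) (hW : ∀ c, algebraMap k K c ∈ W) (ι : W →+* Ω),
    (∀ c, ι ⟨algebraMap k K c, hW c⟩ = algebraMap k Ω c) →
    ∀ (P Q : Pt) (j : R P →+* W) (j' : R Q →+* W), (∀ r, (j r : K) = incl P r) →
      (∀ r, ι (j r) = ev P r) → (∀ r, (j' r : K) = incl Q r) → (∀ r, ι (j' r) = ev Q r) → P = Q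

attribute [instance] CurveModel.commRing

namespace CurveModel

section Basic

variable {k Ω K : Type*} [Field k] [Field Ω] [Field K] [Algebra k Ω] [Algebra k K]

/-- `π` is a uniformizer of the local ring at `P`. -/
def IsUniformizer (M : CurveModel k Ω K) (P : M.Pt) (π : M.R P) : Prop :=
  M.ev P π = 0 ∧ π ≠ 0 ∧
    ∀ x : K, x ≠ 0 → ∃ (n : ℤ) (u : (M.R P)ˣ), x = M.incl P u * M.incl P π ^ n

variable {M : CurveModel k Ω K} {P : M.Pt}

lemma IsUniformizer.incl_ne_zero {π : M.R P} (hπ : M.IsUniformizer P π) : M.incl P π ≠ 0 :=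
  fun h => hπ.2.1 (M.incl_injective P (by rw [h, map_zero]))

lemma IsUniformizer.dvd_of_ev_eq_zero {π : M.R P} (hπ : M.IsUniformizer P π) {x : M.R P}
    (hx : M.ev P x = 0) : π ∣ x := by
  by_cases hx0 : x = 0
  · rw [hx0]; exact dvd_zero _
  obtain ⟨n, u, hn⟩ := hπ.2.2 (M.incl P x) fun h => hx0 (M.incl_injective P (by rw [h, map_zero]))
  rcases lt_or_ge 0 n with h | h
  · obtain ⟨m, rfl⟩ : ∃ m : ℕ, n = m + 1 := ⟨(n - 1).toNat, by omega⟩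
    refine ⟨u * π ^ m, M.incl_injective P ?_⟩
    rw [hn, zpow_add₀ hπ.incl_ne_zero, zpow_one, zpow_natCast]
    simp only [map_mul, map_pow]
    ring
  · exfalso
    obtain ⟨m, rfl⟩ : ∃ m : ℕ, n = -m := ⟨(-n).toNat, by omega⟩
    have hu : x * π ^ m = u := M.incl_injective P (by
      rw [map_mul, hn, map_pow, mul_assoc, zpow_neg, zpow_natCast,
        inv_mul_cancel₀ (pow_ne_zero _ hπ.incl_ne_zero), mul_one])
    refine (u.isUnit.map (M.ev P)).ne_zero ?_
    rw [← hu, map_mul, hx, zero_mul]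

variable (M P) in
/-- The values at `P` of the functions regular there lie in the subfield `k'` of `Ω`. -/
def IsRational (k' : Type*) [Field k'] [Algebra k' Ω] : Prop :=
  ∀ r, ∃ c : k', M.ev P r = algebraMap k' Ω c

end Basic

/-! ### Constant field extensions -/

section Extension

variable {k Ω K k' K' : Type*} [Field k] [Field Ω] [Field K] [Algebra k Ω] [Algebra k K]
  [Field k'] [Field K'] [Algebra k k'] [Algebra k' Ω] [IsScalarTower k k' Ω] [Algebra K K']
  [Algebra k' K'] [Algebra k K'] [IsScalarTower k K K'] [IsScalarTower k k' K']

/-- A place of `K'` over `k'` with a residue map `ι` is centred at the point `P` of the curve with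
function field `K ⊆ K'`. -/
def IsCenter (M : CurveModel k Ω K) (w : Place k' K') (ι : w.ring →+* Ω) (P : M.Pt) : Prop :=
  ∀ r, ∃ h : algebraMap K K' (M.incl P r) ∈ w.ring, ι ⟨_, h⟩ = M.ev P r

variable {M : CurveModel k Ω K}

/-- The restriction to `K` of a residue map. -/
def restrictResidue (w : Place k' K') (ι : w.ring →+* Ω) :
    w.ring.comap (algebraMap K K') →+* Ω :=
  ι.comp (((algebraMap K K').comp (w.ring.comap (algebraMap K K')).subtype).codRestrict
    w.ring.toSubring fun x => x.2)

lemma exists_isCenter {w : Place k' K'} {ι : w.ring →+* Ω} (hι : w.IsResidueMap ι) :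
    ∃ P, M.IsCenter w ι P := by
  have hloc : IsLocalHom (restrictResidue (K := K) w ι) := by
    refine ⟨fun x hx => ?_⟩
    by_contra hxu
    have hx' : algebraMap K K' x ∈ w.ring.nonunits := by
      by_contra h
      have hu : IsUnit (⟨algebraMap K K' x, x.2⟩ : w.ring) := by
        by_contra h'
        exact h (ValuationSubring.coe_mem_nonunits_iff.2 h')
      obtain ⟨y, hy⟩ := hu.exists_right_inv
      have hxy : algebraMap K K' x * y = 1 := congrArg Subtype.val hy
      have hx0 : (x : K) ≠ 0 := by
        intro h0
        rw [h0, map_zero, zero_mul] at hxy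
        exact zero_ne_one hxy
      apply hxu
      refine isUnit_iff_exists_inv.2 ⟨⟨(x : K)⁻¹, ?_⟩, Subtype.ext (mul_inv_cancel₀ hx0)⟩
      rw [ValuationSubring.mem_comap, map_inv₀, inv_eq_of_mul_eq_one_right hxy]
      exact y.2
    exact hx.ne_zero (hι.map_eq_zero ⟨_, x.2⟩ hx')
  obtain ⟨P, j, hj, hιj⟩ := M.exists_center (w.ring.comap (algebraMap K K'))
    (fun c => by
      rw [ValuationSubring.mem_comap, ← IsScalarTower.algebraMap_apply k K K',
        IsScalarTower.algebraMap_apply k k' K']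
      exact w.algebraMap_mem _) (restrictResidue w ι) (fun c => by
        rw [IsScalarTower.algebraMap_apply k k' Ω, ← hι.map_algebraMap]
        refine congrArg ι (Subtype.ext ?_)
        change algebraMap K K' (algebraMap k K c) = algebraMap k' K' (algebraMap k k' c)
        rw [← IsScalarTower.algebraMap_apply, ← IsScalarTower.algebraMap_apply])
  refine ⟨P, fun r => ⟨?_, ?_⟩⟩
  · rw [← hj]; exact (j r).2
  · rw [← hιj]
    refine congrArg ι (Subtype.ext ?_)
    change algebraMap K K' (M.incl P r) = algebraMap K K' (j r)
    rw [hj]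

lemma IsCenter.eq {w : Place k' K'} {ι : w.ring →+* Ω} (hι : w.IsResidueMap ι) {P Q : M.Pt}
    (hP : M.IsCenter w ι P) (hQ : M.IsCenter w ι Q) : P = Q := by
  refine M.center_unique (w.ring.comap (algebraMap K K'))
    (fun c => by
      rw [ValuationSubring.mem_comap, ← IsScalarTower.algebraMap_apply k K K',
        IsScalarTower.algebraMap_apply k k' K']
      exact w.algebraMap_mem _) (restrictResidue w ι) (fun c => by
        rw [IsScalarTower.algebraMap_apply k k' Ω, ← hι.map_algebraMap]
        refine congrArg ι (Subtype.ext ?_)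
        change algebraMap K K' (algebraMap k K c) = algebraMap k' K' (algebraMap k k' c)
        rw [← IsScalarTower.algebraMap_apply, ← IsScalarTower.algebraMap_apply])
    P Q ((M.incl P).codRestrict (w.ring.comap (algebraMap K K')).toSubring fun r => (hP r).1)
    ((M.incl Q).codRestrict (w.ring.comap (algebraMap K K')).toSubring fun r => (hQ r).1)
    (fun _ => rfl) (fun r => (hP r).2) (fun _ => rfl) (fun r => (hQ r).2)

variable (k' K') in
/-- The functions on the constant field extension which are visibly regular at `P`: the polynomials
over `k'` in the elements of the local ring `R P`. -/
def extendedRing (M : CurveModel k Ω K) (P : M.Pt) : Subalgebra k' K' :=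
  Algebra.adjoin k' (Set.range fun r => algebraMap K K' (M.incl P r))

lemma incl_mem_extendedRing (P : M.Pt) (r : M.R P) :
    algebraMap K K' (M.incl P r) ∈ extendedRing k' K' M P :=
  Algebra.subset_adjoin ⟨r, rfl⟩

/-- At a rational point the value of an element of `extendedRing` is independent of the place. -/
lemma IsCenter.exists_value {P : M.Pt} (hrat : M.IsRational P k') {a : K'}
    (ha : a ∈ extendedRing k' K' M P) :
    ∃ c : k', ∀ (w : Place k' K') (ι : w.ring →+* Ω), w.IsResidueMap ι → M.IsCenter w ι P →
      ∃ h : a ∈ w.ring, ι ⟨a, h⟩ = algebraMap k' Ω c := by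
  induction ha using Algebra.adjoin_induction with
  | mem x hx =>
    obtain ⟨r, rfl⟩ := hx
    obtain ⟨c, hc⟩ := hrat r
    exact ⟨c, fun w ι _ hP => ⟨(hP r).1, (hP r).2.trans hc⟩⟩
  | algebraMap c => exact ⟨c, fun w ι hι _ => ⟨w.algebraMap_mem c, hι.map_algebraMap c⟩⟩
  | add x y _ _ hx hy =>
    obtain ⟨c, hc⟩ := hx
    obtain ⟨d, hd⟩ := hy
    refine ⟨c + d, fun w ι hι hP => ?_⟩
    obtain ⟨h1, h2⟩ := hc w ι hι hP
    obtain ⟨h3, h4⟩ := hd w ι hι hP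
    refine ⟨add_mem h1 h3, ?_⟩
    rw [map_add, ← h2, ← h4, ← map_add]
    rfl
  | mul x y _ _ hx hy =>
    obtain ⟨c, hc⟩ := hx
    obtain ⟨d, hd⟩ := hy
    refine ⟨c * d, fun w ι hι hP => ?_⟩
    obtain ⟨h1, h2⟩ := hc w ι hι hP
    obtain ⟨h3, h4⟩ := hd w ι hι hP
    refine ⟨mul_mem h1 h3, ?_⟩
    rw [map_mul, ← h2, ← h4, ← map_mul]
    rfl

/-- Constant field extensions of finite fields are unramified: up to factors which do not vanish
at `P`, the difference between a function and its value at `P` is divisible by the uniformizer of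
the small field. For a function `r` of the small field with value `c` this follows from
`r ^ q - r = (r - c) * s`, where `s` has the value `-1` and the left side, which has the
value `0`, is a multiple of the uniformizer. -/
lemma IsCenter.exists_mul_sub_eq [Finite k'] {P : M.Pt} (hrat : M.IsRational P k')
    {π : M.R P} (hπ : M.IsUniformizer P π) {w : Place k' K'} {ι : w.ring →+* Ω}
    (hι : w.IsResidueMap ι) (hP : M.IsCenter w ι P) {a : K'} (ha : a ∈ extendedRing k' K' M P) :
    ∃ (c : k') (s b : K'), s ∈ extendedRing k' K' M P ∧ b ∈ extendedRing k' K' M P ∧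
      s ∉ w.ring.nonunits ∧ s * (a - algebraMap k' K' c) = algebraMap K K' (M.incl P π) * b := by
  have hmul : ∀ {s t : K'}, s ∈ extendedRing k' K' M P → t ∈ extendedRing k' K' M P →
      s ∉ w.ring.nonunits → t ∉ w.ring.nonunits → s * t ∉ w.ring.nonunits := by
    intro s t _ _ hs ht h
    rw [ValuationSubring.mem_nonunits_iff] at hs ht h
    rw [map_mul] at h
    exact absurd h (not_lt.2 (one_le_mul (not_lt.1 hs) (not_lt.1 ht)))
  have hone : (1 : K') ∉ w.ring.nonunits := by
    rw [ValuationSubring.mem_nonunits_iff, map_one]; exact lt_irrefl _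
  induction ha using Algebra.adjoin_induction with
  | mem x hx =>
    obtain ⟨r, rfl⟩ := hx
    obtain ⟨c, hc⟩ := hrat r
    have := Fintype.ofFinite k'
    set q := Fintype.card k'
    set x := algebraMap K K' (M.incl P r)
    set y := algebraMap k' K' c
    have hy : y ∈ extendedRing k' K' M P := Subalgebra.algebraMap_mem _ c
    have hx : x ∈ extendedRing k' K' M P := incl_mem_extendedRing P r
    have hev : M.ev P (r ^ q - r) = 0 := by
      rw [map_sub, map_pow, hc, ← map_pow, FiniteField.pow_card, sub_self]
    obtain ⟨r', hr'⟩ := hπ.dvd_of_ev_eq_zero hev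
    refine ⟨c, (∑ i ∈ Finset.range q, x ^ i * y ^ (q - 1 - i)) - 1, algebraMap K K' (M.incl P r'),
      sub_mem (sum_mem fun i _ => mul_mem (pow_mem hx _) (pow_mem hy _)) (one_mem _),
      incl_mem_extendedRing P r', fun hs => ?_, ?_⟩
    · -- the value of this factor at `P` is `q * c ^ (q - 1) - 1 = -1`
      let X : w.ring := ⟨x, (hP r).1⟩
      let Y : w.ring := algebraMap k' w.ring c
      have hιX : ι X = algebraMap k' Ω c := (hP r).2.trans hc
      have hιY : ι Y = algebraMap k' Ω c := hι.map_algebraMap c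
      have hs' : (((∑ i ∈ Finset.range q, X ^ i * Y ^ (q - 1 - i)) - 1 : w.ring) : K')
          = (∑ i ∈ Finset.range q, x ^ i * y ^ (q - 1 - i)) - 1 := by
        push_cast
        rfl
      have h0 := hι.map_eq_zero _ (by rw [hs']; exact hs)
      have hterm : ∀ i ∈ Finset.range q, ι (X ^ i * Y ^ (q - 1 - i)) =
          algebraMap k' Ω c ^ (q - 1) := fun i hi => by
        rw [map_mul, map_pow, map_pow, hιX, hιY, ← pow_add]
        congr 1
        have := Finset.mem_range.1 hi
        omega
      rw [map_sub, map_sum, map_one, Finset.sum_congr rfl hterm, Finset.sum_const,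
        Finset.card_range, nsmul_eq_mul, ← map_natCast (algebraMap k' Ω),
        FiniteField.cast_card_eq_zero, map_zero, zero_mul, zero_sub, neg_eq_zero] at h0
      exact one_ne_zero h0
    · have h1 := (Commute.all x y).geom_sum₂_mul q
      have hyq : y ^ q = y := by rw [← map_pow, FiniteField.pow_card]
      have h2 : x ^ q - x = algebraMap K K' (M.incl P π) * algebraMap K K' (M.incl P r') := by
        rw [← map_mul, ← map_mul, ← hr', map_sub, map_sub, map_pow, map_pow]
      rw [← h2, sub_mul, h1, hyq]
      ring
  | algebraMap c =>
    exact ⟨c, 1, 0, one_mem _, zero_mem _, hone, by simp⟩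
  | add x y hx hy ihx ihy =>
    obtain ⟨c, s, b, hs, hb, hs0, h⟩ := ihx
    obtain ⟨c', s', b', hs', hb', hs0', h'⟩ := ihy
    refine ⟨c + c', s * s', s' * b + s * b', mul_mem hs hs',
      add_mem (mul_mem hs' hb) (mul_mem hs hb'), hmul hs hs' hs0 hs0', ?_⟩
    rw [map_add]
    linear_combination s' * h + s * h'
  | mul x y hx hy ihx ihy =>
    obtain ⟨c, s, b, hs, hb, hs0, h⟩ := ihx
    obtain ⟨c', s', b', hs', hb', hs0', h'⟩ := ihy
    refine ⟨c * c', s * s', s' * b * y + s * b' * algebraMap k' K' c, mul_mem hs hs',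
      add_mem (mul_mem (mul_mem hs' hb) hy) (mul_mem (mul_mem hs hb')
        (Subalgebra.algebraMap_mem _ c)), hmul hs hs' hs0 hs0', ?_⟩
    rw [map_mul]
    linear_combination s' * y * h + s * algebraMap k' K' c * h'

end Extension

end CurveModel

end

noncomputable section

/-! ### Places above a rational point -/

namespace CurveModel

section Rational

variable {k Ω K k' K' : Type*} [Field k] [Field Ω] [Field K] [Algebra k Ω] [Algebra k K]
  [Field k'] [Field K'] [Algebra k k'] [Algebra k' Ω] [IsScalarTower k k' Ω] [Algebra K K']
  [Algebra k' K'] [Algebra k K'] [IsScalarTower k K K'] [IsScalarTower k k' K']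
  {M : CurveModel k Ω K} {P : M.Pt}

lemma _root_.RecursiveTower.Place.IsResidueMap.map_eq_zero_iff {k F Ω : Type*} [Field k] [Field F]
    [Field Ω] [Algebra k F] [Algebra k Ω] {w : Place k F} {ι : w.ring →+* Ω}
    (hι : w.IsResidueMap ι) (x : w.ring) : ι x = 0 ↔ (x : F) ∈ w.ring.nonunits :=
  ⟨Place.mem_nonunits_of_map_eq_zero, hι.map_eq_zero x⟩

/-- If the centre of a place with respect to one residue map is rational, it is the centre with
respect to all residue maps. -/
lemma IsCenter.of_isRational (hrat : M.IsRational P k') {w : Place k' K'} {ι ι' : w.ring →+* Ω}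
    (hι : w.IsResidueMap ι) (hι' : w.IsResidueMap ι') (hP : M.IsCenter w ι P) :
    M.IsCenter w ι' P := by
  intro r
  obtain ⟨h, hr⟩ := hP r
  obtain ⟨c, hc⟩ := hrat r
  refine ⟨h, ?_⟩
  have h0 : ι (⟨_, h⟩ - algebraMap k' w.ring c) = 0 := by
    rw [map_sub, hr, hι.map_algebraMap, hc, sub_self]
  have h1 := hι'.map_eq_zero _ (Place.mem_nonunits_of_map_eq_zero h0)
  rw [map_sub, hι'.map_algebraMap, sub_eq_zero] at h1
  rw [h1, hc]

lemma IsCenter.mem_nonunits_iff {w : Place k' K'} {ι : w.ring →+* Ω}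
    (hι : w.IsResidueMap ι) (hP : M.IsCenter w ι P) (r : M.R P) :
    algebraMap K K' (M.incl P r) ∈ w.ring.nonunits ↔ M.ev P r = 0 := by
  obtain ⟨h, hr⟩ := hP r
  rw [← hr, hι.map_eq_zero_iff]

lemma IsCenter.mem_nonunits_extendedRing (hrat : M.IsRational P k') {a : K'}
    (ha : a ∈ extendedRing k' K' M P) {w w₁ : Place k' K'} {ι : w.ring →+* Ω} {ι₁ : w₁.ring →+* Ω}
    (hι : w.IsResidueMap ι) (hι₁ : w₁.IsResidueMap ι₁) (hP : M.IsCenter w ι P)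
    (hP₁ : M.IsCenter w₁ ι₁ P) (h : a ∈ w.ring.nonunits) : a ∈ w₁.ring.nonunits := by
  obtain ⟨c, hc⟩ := IsCenter.exists_value hrat ha
  obtain ⟨h1, h2⟩ := hc w ι hι hP
  obtain ⟨h3, h4⟩ := hc w₁ ι₁ hι₁ hP₁
  have := hι.map_eq_zero ⟨a, h1⟩ h
  exact Place.mem_nonunits_of_map_eq_zero (x := ⟨a, h3⟩) (by rw [h4, ← h2, this])

/-- The constant field extension is obtained from `extendedRing` by inverting a uniformizer. -/
lemma exists_pow_mul_mem_extendedRing [Algebra.IsPushout k k' K K'] {π : M.R P}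
    (hπ : M.IsUniformizer P π) (z : K') :
    ∃ N : ℕ, algebraMap K K' (M.incl P π) ^ N * z ∈ extendedRing k' K' M P := by
  have hout := Algebra.IsPushout.out (R := k) (S := k') (R' := K) (S' := K')
  have hπA := incl_mem_extendedRing (k' := k') (K' := K') P π
  induction z using hout.inductionOn with
  | zero => exact ⟨0, by simp⟩
  | tmul x =>
    change ∃ N : ℕ, _ * algebraMap K K' x ∈ _
    by_cases hx : x = 0
    · exact ⟨0, by simp [hx]⟩
    obtain ⟨n, u, rfl⟩ := hπ.2.2 x hx
    refine ⟨n.natAbs, ?_⟩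
    obtain ⟨m, hm⟩ : ∃ m : ℕ, (n.natAbs : ℤ) + n = m := ⟨((n.natAbs : ℤ) + n).toNat, by omega⟩
    have : algebraMap K K' (M.incl P π) ^ n.natAbs *
        algebraMap K K' (M.incl P u * M.incl P π ^ n) =
        algebraMap K K' (M.incl P u) * algebraMap K K' (M.incl P π) ^ m := by
      have h0 : algebraMap K K' (M.incl P π) ≠ 0 := by simpa using hπ.incl_ne_zero
      rw [← zpow_natCast _ m, ← hm, zpow_add₀ h0, map_mul, map_zpow₀, zpow_natCast]
      ring
    rw [this]
    exact mul_mem (incl_mem_extendedRing P _) (pow_mem hπA _)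
  | smul c x hx =>
    obtain ⟨N, hN⟩ := hx
    exact ⟨N, by rw [mul_smul_comm]; exact Subalgebra.smul_mem _ hN c⟩
  | add x y hx hy =>
    obtain ⟨N, hN⟩ := hx
    obtain ⟨N', hN'⟩ := hy
    refine ⟨N + N', ?_⟩
    rw [pow_add, mul_add]
    refine add_mem ?_ ?_
    · rw [mul_comm (_ ^ N), mul_assoc]
      exact mul_mem (pow_mem hπA _) hN
    · rw [mul_assoc]
      exact mul_mem (pow_mem hπA _) hN'

variable [Finite k'] [IsFunctionField k' K'] [Algebra.IsPushout k k' K K']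

/-- At a rational point, a uniformizer of the small field stays a uniformizer: each function is, up
to factors which do not vanish at the point, a power of it. -/
lemma IsCenter.exists_mul_eq_zpow_mul (hrat : M.IsRational P k') {π : M.R P}
    (hπ : M.IsUniformizer P π) {w : Place k' K'} {ι : w.ring →+* Ω} (hι : w.IsResidueMap ι)
    (hP : M.IsCenter w ι P) {z : K'} (hz : z ≠ 0) :
    ∃ (n : ℤ) (s b : K'), s ∈ extendedRing k' K' M P ∧ b ∈ extendedRing k' K' M P ∧
      s ∉ w.ring.nonunits ∧ b ∉ w.ring.nonunits ∧
      z * s = algebraMap K K' (M.incl P π) ^ n * b := by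
  set p := algebraMap K K' (M.incl P π) with hp
  have hp0 : p ≠ 0 := by simpa [hp] using hπ.incl_ne_zero
  have hpos : 0 < w.ord p := by
    rw [w.ord_pos_iff hp0, hp, hP.mem_nonunits_iff hι]; exact hπ.1
  have hone : (1 : K') ∉ w.ring.nonunits := by
    rw [ValuationSubring.mem_nonunits_iff, map_one]; exact lt_irrefl _
  have hmem : ∀ {a : K'}, a ∈ extendedRing k' K' M P → a ∈ w.ring := fun ha => by
    obtain ⟨c, hc⟩ := IsCenter.exists_value hrat ha
    exact (hc w ι hι hP).1
  have hord : ∀ {a : K'}, a ∈ extendedRing k' K' M P → a ∉ w.ring.nonunits →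
      a ≠ 0 ∧ w.ord a = 0 := fun {a} ha hau => by
    have ha0 : a ≠ 0 := by rintro rfl; simp at hau
    have h1 := (w.ord_nonneg_iff ha0).2 (hmem ha)
    rw [← w.ord_pos_iff ha0] at hau
    exact ⟨ha0, by omega⟩
  -- the statement for elements of `extendedRing`, by induction on the order
  have key : ∀ (m : ℕ) (a : K'), a ∈ extendedRing k' K' M P → a ≠ 0 → w.ord a < m →
      ∃ (n : ℤ) (s b : K'), s ∈ extendedRing k' K' M P ∧ b ∈ extendedRing k' K' M P ∧
      s ∉ w.ring.nonunits ∧ b ∉ w.ring.nonunits ∧ a * s = p ^ n * b := by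
    intro m
    induction m with
    | zero =>
      intro a ha ha0 hlt
      have := (w.ord_nonneg_iff ha0).2 (hmem ha)
      omega
    | succ m ih =>
      intro a ha ha0 hlt
      by_cases hau : a ∈ w.ring.nonunits
      swap
      · exact ⟨0, 1, a, one_mem _, ha, hone, hau, by simp⟩
      obtain ⟨c, s, b, hs, hb, hs0, h⟩ := hP.exists_mul_sub_eq hrat hπ hι ha
      rw [← hp] at h
      have hsn := hord hs hs0
      have hc : c = 0 := by
        have h1 : s * (a - algebraMap k' K' c) ∈ w.ge 1 := by
          rw [h]
          simpa using w.mul_mem_ge (w.mem_ge_one.2 ((w.ord_pos_iff hp0).1 hpos))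
            (w.mem_ge_zero.2 (hmem hb))
        rw [mul_comm, w.mul_mem_ge_iff hsn.1, hsn.2, sub_zero] at h1
        have h2 : algebraMap k' K' c ∈ w.ge 1 := by
          have := sub_mem (w.mem_ge_one.2 hau) h1
          rwa [sub_sub_cancel] at this
        by_contra hc0
        have h3 := w.mul_mem_ge h2 (w.mem_ge_zero.2 (w.algebraMap_mem c⁻¹))
        rw [← map_mul, mul_inv_cancel₀ hc0, map_one, add_zero, w.mem_ge_one] at h3
        exact hone h3
      rw [hc, map_zero, sub_zero] at h
      have hb0 : b ≠ 0 := by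
        rintro rfl
        rw [mul_zero] at h
        exact (mul_ne_zero hsn.1 ha0) h
      have hlt' : w.ord b < m := by
        have := congrArg w.ord h
        rw [w.ord_mul hsn.1 ha0, w.ord_mul hp0 hb0, hsn.2] at this
        omega
      obtain ⟨n, s', b', hs', hb', hs0', hb0', h'⟩ := ih b hb hb0 hlt'
      have hsn' := hord hs' hs0'
      refine ⟨n + 1, s * s', b', mul_mem hs hs', hb', fun hcon => ?_, hb0', ?_⟩
      · rw [← w.ord_pos_iff (mul_ne_zero hsn.1 hsn'.1), w.ord_mul hsn.1 hsn'.1] at hcon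
        omega
      · rw [zpow_add₀ hp0, zpow_one]
        linear_combination s' * h + p * h'
  obtain ⟨N, hN⟩ := exists_pow_mul_mem_extendedRing (k' := k') hπ z
  rw [← hp] at hN
  obtain ⟨n, s, b, hs, hb, hs0, hb0, h⟩ := key ((w.ord (p ^ N * z)).toNat + 1) _ hN
    (mul_ne_zero (pow_ne_zero _ hp0) hz) (by omega)
  refine ⟨n - N, s, b, hs, hb, hs0, hb0, ?_⟩
  rw [zpow_sub₀ hp0, zpow_natCast]
  field_simp
  linear_combination h

/-- The order of a function at a place above `P`, in terms of the order of a uniformizer at `P`,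
depends only on `P`. -/
lemma IsCenter.exists_ord_eq_mul (hrat : M.IsRational P k') {π : M.R P}
    (hπ : M.IsUniformizer P π) {w : Place k' K'} {ι : w.ring →+* Ω} (hι : w.IsResidueMap ι)
    (hP : M.IsCenter w ι P) {z : K'} (hz : z ≠ 0) :
    ∃ n : ℤ, ∀ (w₁ : Place k' K') (ι₁ : w₁.ring →+* Ω), w₁.IsResidueMap ι₁ →
      M.IsCenter w₁ ι₁ P → w₁.ord z = n * w₁.ord (algebraMap K K' (M.incl P π)) := by
  obtain ⟨n, s, b, hs, hb, hs0, hb0, h⟩ := hP.exists_mul_eq_zpow_mul hrat hπ hι hz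
  refine ⟨n, fun w₁ ι₁ hι₁ hP₁ => ?_⟩
  have hord : ∀ {a : K'}, a ∈ extendedRing k' K' M P → a ∉ w.ring.nonunits →
      a ≠ 0 ∧ w₁.ord a = 0 := fun {a} ha hau => by
    have ha0 : a ≠ 0 := by rintro rfl; simp at hau
    obtain ⟨c, hc⟩ := IsCenter.exists_value hrat ha
    have h1 := (w₁.ord_nonneg_iff ha0).2 (hc w₁ ι₁ hι₁ hP₁).1
    have h2 : a ∉ w₁.ring.nonunits := fun h =>
      hau (IsCenter.mem_nonunits_extendedRing hrat ha hι₁ hι hP₁ hP h)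
    rw [← w₁.ord_pos_iff ha0] at h2
    exact ⟨ha0, by omega⟩
  have hp0 : algebraMap K K' (M.incl P π) ≠ 0 := by simpa using hπ.incl_ne_zero
  have := congrArg w₁.ord h
  rw [w₁.ord_mul hz (hord hs hs0).1, w₁.ord_mul (zpow_ne_zero _ hp0) (hord hb hb0).1,
    (hord hs hs0).2, (hord hb hb0).2, w₁.ord_zpow] at this
  omega

lemma IsCenter.ord_uniformizer (hrat : M.IsRational P k') {π : M.R P}
    (hπ : M.IsUniformizer P π) {w : Place k' K'} {ι : w.ring →+* Ω} (hι : w.IsResidueMap ι)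
    (hP : M.IsCenter w ι P) : w.ord (algebraMap K K' (M.incl P π)) = 1 := by
  obtain ⟨n, hn⟩ := hP.exists_ord_eq_mul hrat hπ hι w.uniformizer_ne_zero
  have h := hn w ι hι hP
  rw [w.ord_uniformizer] at h
  have hp0 : algebraMap K K' (M.incl P π) ≠ 0 := by simpa using hπ.incl_ne_zero
  have hpos : 0 < w.ord (algebraMap K K' (M.incl P π)) := by
    rw [w.ord_pos_iff hp0, hP.mem_nonunits_iff hι]; exact hπ.1
  exact Int.eq_one_of_mul_eq_one_left hpos.le h.symm

/-- There is at most one place above a rational point. -/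
lemma IsCenter.place_eq (hrat : M.IsRational P k') {w w₁ : Place k' K'} {ι : w.ring →+* Ω}
    {ι₁ : w₁.ring →+* Ω} (hι : w.IsResidueMap ι) (hι₁ : w₁.IsResidueMap ι₁)
    (hP : M.IsCenter w ι P) (hP₁ : M.IsCenter w₁ ι₁ P) : w = w₁ := by
  obtain ⟨π, hπ⟩ : ∃ π, M.IsUniformizer P π := M.exists_uniformizer P
  refine Place.ext (SetLike.ext fun z => ?_)
  by_cases hz : z = 0
  · simp [hz, zero_mem]
  obtain ⟨n, hn⟩ := hP.exists_ord_eq_mul hrat hπ hι hz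
  rw [← w.ord_nonneg_iff hz, ← w₁.ord_nonneg_iff hz, hn w ι hι hP, hn w₁ ι₁ hι₁ hP₁,
    hP.ord_uniformizer hrat hπ hι, hP₁.ord_uniformizer hrat hπ hι₁]

/-- The place above a rational point has degree `1`. -/
lemma IsCenter.exists_sub_mem_nonunits (hrat : M.IsRational P k') {w : Place k' K'}
    {ι : w.ring →+* Ω} (hι : w.IsResidueMap ι) (hP : M.IsCenter w ι P) {z : K'}
    (hz : z ∈ w.ring) : ∃ a : k', z - algebraMap k' K' a ∈ w.ring.nonunits := by
  obtain ⟨π, hπ⟩ : ∃ π, M.IsUniformizer P π := M.exists_uniformizer P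
  by_cases hzu : z ∈ w.ring.nonunits
  · exact ⟨0, by simpa using hzu⟩
  have hz0 : z ≠ 0 := by rintro rfl; simp at hzu
  obtain ⟨n, s, b, hs, hb, hs0, hb0, h⟩ := hP.exists_mul_eq_zpow_mul hrat hπ hι hz0
  have hp0 : algebraMap K K' (M.incl P π) ≠ 0 := by simpa using hπ.incl_ne_zero
  obtain ⟨c, hc⟩ := IsCenter.exists_value hrat hs
  obtain ⟨c', hc'⟩ := IsCenter.exists_value hrat hb
  obtain ⟨hs1, hs2⟩ := hc w ι hι hP
  obtain ⟨hb1, hb2⟩ := hc' w ι hι hP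
  have hs00 : s ≠ 0 := by rintro rfl; simp at hs0
  have hb00 : b ≠ 0 := by rintro rfl; simp at hb0
  have hn : n = 0 := by
    have := congrArg w.ord h
    rw [w.ord_mul hz0 hs00, w.ord_mul (zpow_ne_zero _ hp0) hb00, w.ord_zpow,
      hP.ord_uniformizer hrat hπ hι] at this
    have h1 := (w.ord_nonneg_iff hz0).2 hz
    have h2 := (w.ord_nonneg_iff hs00).2 hs1
    have h3 := (w.ord_nonneg_iff hb00).2 hb1
    rw [← w.ord_pos_iff hs00] at hs0
    rw [← w.ord_pos_iff hb00] at hb0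
    rw [← w.ord_pos_iff hz0] at hzu
    omega
  rw [hn, zpow_zero, one_mul] at h
  have hc0 : algebraMap k' Ω c ≠ 0 := by
    rw [← hs2]
    exact fun h0 => hs0 (Place.mem_nonunits_of_map_eq_zero h0)
  refine ⟨c' / c, ?_⟩
  have h0 : ι (⟨z, hz⟩ - algebraMap k' w.ring (c' / c)) = 0 := by
    rw [map_sub, hι.map_algebraMap, map_div₀, sub_eq_zero, eq_div_iff hc0, ← hs2, ← hb2, ← map_mul]
    exact congrArg ι (Subtype.ext h)
  exact Place.mem_nonunits_of_map_eq_zero h0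

/-- There is a place above each rational point. -/
lemma exists_place [IsAlgClosed Ω] (hrat : M.IsRational P k') :
    ∃ (w : Place k' K') (ι : w.ring →+* Ω), w.IsResidueMap ι ∧ M.IsCenter w ι P := by
  let _ : Algebra k (M.R P) := (M.const P).toAlgebra
  let incl : M.R P →ₐ[k] K := { M.incl P with commutes' := M.incl_const P }
  let ev : M.R P →ₐ[k] Ω := { M.ev P with commutes' := M.ev_const P }
  let inclK : M.R P →ₐ[k] K' := (IsScalarTower.toAlgHom k K K').comp incl
  let j : TensorProduct k (M.R P) k' →ₐ[k] K' :=
    Algebra.TensorProduct.lift inclK (IsScalarTower.toAlgHom k k' K') fun _ _ => Commute.all _ _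
  let e : TensorProduct k (M.R P) k' →ₐ[k] Ω :=
    Algebra.TensorProduct.lift ev (IsScalarTower.toAlgHom k k' Ω) fun _ _ => Commute.all _ _
  have hj : Function.Injective j := by
    have h1 : Function.Injective (incl.toLinearMap.rTensor k') :=
      Module.Flat.rTensor_preserves_injective_linearMap _ (M.incl_injective P)
    have hout := Algebra.IsPushout.out (R := k) (S := k') (R' := K) (S' := K')
    have h2 := hout.equiv.injective.comp ((TensorProduct.comm k K k').injective.comp h1)
    convert h2 using 1
    refine congrArg DFunLike.coe (?_ : j.toLinearMap = (hout.equiv.toLinearMap.restrictScalars k) ∘ₗ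
      (TensorProduct.comm k K k').toLinearMap ∘ₗ (incl.toLinearMap.rTensor k'))
    refine TensorProduct.ext' fun r c => ?_
    change j (r ⊗ₜ c) = hout.equiv (c ⊗ₜ (incl r))
    rw [IsBaseChange.equiv_tmul, Algebra.TensorProduct.lift_tmul, mul_comm, Algebra.smul_def]
    rfl
  let E := RingEquiv.ofLeftInverse (f := (j : TensorProduct k (M.R P) k' →+* K'))
    (Function.leftInverse_invFun hj)
  obtain ⟨O, hO1, hO2⟩ := Ideal.image_subset_nonunits_valuationSubring
    (A := (j : TensorProduct k (M.R P) k' →+* K').range)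
    (RingHom.ker ((e : TensorProduct k (M.R P) k' →+* Ω).comp (E.symm : _ →+* _)))
    (RingHom.ker_ne_top _)
  have hmem : ∀ t, j t ∈ O := fun t => hO1 ⟨t, rfl⟩
  have hnon : ∀ t, e t = 0 → j t ∈ O.nonunits := fun t ht => by
    refine hO2 ⟨E t, ?_, rfl⟩
    change e (E.symm (E t)) = 0
    rw [E.symm_apply_apply, ht]
  have hjr : ∀ r, j (r ⊗ₜ 1) = algebraMap K K' (M.incl P r) := fun r => by
    rw [Algebra.TensorProduct.lift_tmul, map_one, mul_one]; rfl
  have her : ∀ r, e (r ⊗ₜ 1) = M.ev P r := fun r => by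
    rw [Algebra.TensorProduct.lift_tmul, map_one, mul_one]; rfl
  have hjc : ∀ c, j (1 ⊗ₜ c) = algebraMap k' K' c := fun c => by
    rw [Algebra.TensorProduct.lift_tmul, map_one, one_mul]; rfl
  have hec : ∀ c, e (1 ⊗ₜ c) = algebraMap k' Ω c := fun c => by
    rw [Algebra.TensorProduct.lift_tmul, map_one, one_mul]; rfl
  obtain ⟨π, hπ⟩ : ∃ π, M.IsUniformizer P π := M.exists_uniformizer P
  obtain ⟨w, hw⟩ : ∃ w : Place k' K', w.ring = O := by
    refine ⟨⟨O, fun c => by rw [← hjc]; exact hmem _, fun htop => ?_⟩, rfl⟩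
    have h := hnon (π ⊗ₜ 1) (by rw [her]; exact hπ.1)
    rw [hjr, ValuationSubring.mem_nonunits_iff_or, htop] at h
    have h0 : algebraMap K K' (M.incl P π) ≠ 0 := by simpa using hπ.incl_ne_zero
    exact h.elim h0 fun h => h trivial
  subst hw
  obtain ⟨ι, hι⟩ := w.exists_isResidueMap (Ω := Ω)
  refine ⟨w, ι, hι, fun r => ?_⟩
  have h : algebraMap K K' (M.incl P r) ∈ w.ring := by rw [← hjr]; exact hmem _
  refine ⟨h, ?_⟩
  obtain ⟨c, hc⟩ := hrat r
  have h0 : ι (⟨_, h⟩ - algebraMap k' w.ring c) = 0 := by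
    apply hι.map_eq_zero
    have := hnon (r ⊗ₜ 1 - 1 ⊗ₜ c) (by rw [map_sub, her, hec, hc, sub_self])
    rw [map_sub, hjr, hjc] at this
    exact this
  rw [map_sub, hι.map_algebraMap, sub_eq_zero] at h0
  rw [h0, hc]

end Rational

end CurveModel

end

noncomputable section

/-! ### Morphisms of curves in terms of function fields -/

namespace CurveModel

/-- A morphism of curves, in terms of the function fields and the local rings. -/
structure Hom {k Ω K K₀ : Type*} [Field k] [Field Ω] [Field K] [Field K₀] [Algebra k Ω]
    [Algebra k K] [Algebra k K₀] (M : CurveModel k Ω K) (M₀ : CurveModel k Ω K₀) where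
  /-- the pullback of rational functions -/
  pull : K₀ →ₐ[k] K
  /-- the map on points -/
  pt : M.Pt → M₀.Pt
  /-- the pullback of functions regular at a point -/
  loc : ∀ P, M₀.R (pt P) →+* M.R P
  incl_loc : ∀ P r, M.incl P (loc P r) = pull (M₀.incl (pt P) r)
  ev_loc : ∀ P r, M.ev P (loc P r) = M₀.ev (pt P) r

section Hom

variable {k Ω K K₀ : Type*} [Field k] [Field Ω] [Field K] [Field K₀] [Algebra k Ω]
    [Algebra k K] [Algebra k K₀] {M : CurveModel k Ω K} {M₀ : CurveModel k Ω K₀}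

/-- The ramification index of the morphism at `P` is `e`. -/
def Hom.HasRamIndex (f : M.Hom M₀) (P : M.Pt) (e : ℕ) : Prop :=
  ∀ π π₀, M.IsUniformizer P π → M₀.IsUniformizer (f.pt P) π₀ →
    ∃ u : (M.R P)ˣ, f.loc P π₀ = u * π ^ e

lemma IsRational.pt {k' : Type*} [Field k'] [Algebra k' Ω] {P : M.Pt} (h : M.IsRational P k')
    (f : M.Hom M₀) : M₀.IsRational (f.pt P) k' := fun r => by
  rw [← f.ev_loc]; exact h _

end Hom

/-- The residue map on the restriction of a place. -/
def _root_.RecursiveTower.Place.comapResidue {k F F₀ Ω : Type*} [Field k] [Field F] [Field F₀]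
    [Field Ω] [Algebra k F] [Algebra k F₀] [Algebra k Ω] [IsFunctionField k F₀]
    [IsFunctionField k F] (w : Place k F) (φ : F₀ →ₐ[k] F) (ι : w.ring →+* Ω) :
    (w.comap φ).ring →+* Ω :=
  ι.comp (((φ : F₀ →+* F).comp (w.comap φ).ring.subtype).codRestrict w.ring.toSubring fun x => x.2)

lemma _root_.RecursiveTower.Place.IsResidueMap.comapResidue {k F F₀ Ω : Type*} [Field k] [Field F]
    [Field F₀] [Field Ω] [Algebra k F] [Algebra k F₀] [Algebra k Ω] [IsFunctionField k F₀]
    [IsFunctionField k F] {w : Place k F} {ι : w.ring →+* Ω} (hι : w.IsResidueMap ι)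
    (φ : F₀ →ₐ[k] F) : (w.comap φ).IsResidueMap (w.comapResidue φ ι) where
  map_algebraMap c := by
    rw [← hι.map_algebraMap]
    exact congrArg ι (Subtype.ext (φ.commutes c))
  map_eq_zero x hx := hι.map_eq_zero _ (Place.mem_comap_nonunits.1 hx)

section Extension

variable {k Ω K k' K' : Type*} [Field k] [Field Ω] [Field K] [Algebra k Ω] [Algebra k K]
  [Field k'] [Field K'] [Algebra k k'] [Algebra k' Ω] [IsScalarTower k k' Ω] [Algebra K K']
  [Algebra k' K'] [Algebra k K'] [IsScalarTower k K K'] [IsScalarTower k k' K']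
  {M : CurveModel k Ω K}
  {K₀ K₀' : Type*} [Field K₀] [Algebra k K₀]
  [Field K₀'] [Algebra K₀ K₀']
  [Algebra k' K₀'] [Algebra k K₀'] [IsScalarTower k K₀ K₀'] [IsScalarTower k k' K₀']
  {M₀ : CurveModel k Ω K₀} [IsFunctionField k' K'] [IsFunctionField k' K₀']

lemma IsCenter.comap {w : Place k' K'} {ι : w.ring →+* Ω} {P : M.Pt} (hP : M.IsCenter w ι P)
    (f : M.Hom M₀) {f' : K₀' →ₐ[k'] K'}
    (hf' : ∀ x, f' (algebraMap K₀ K₀' x) = algebraMap K K' (f.pull x)) :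
    M₀.IsCenter (w.comap f') (w.comapResidue f' ι) (f.pt P) := by
  intro r
  obtain ⟨h, hr⟩ := hP (f.loc P r)
  rw [f.ev_loc] at hr
  have heq : f' (algebraMap K₀ K₀' (M₀.incl (f.pt P) r)) = algebraMap K K' (M.incl P (f.loc P r)) :=
    by rw [hf', f.incl_loc]
  refine ⟨by rw [Place.mem_comap_ring, heq]; exact h, ?_⟩
  rw [← hr]
  exact congrArg ι (Subtype.ext heq)

variable [Finite k'] [Algebra.IsPushout k k' K K'] [Algebra.IsPushout k k' K₀ K₀']

/-- At a rational point, orders are multiplied by the ramification index. -/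
lemma Hom.HasRamIndex.ord_eq {f : M.Hom M₀} {P : M.Pt} {e : ℕ} (he : f.HasRamIndex P e)
    (hrat : M.IsRational P k') {f' : K₀' →ₐ[k'] K'}
    (hf' : ∀ x, f' (algebraMap K₀ K₀' x) = algebraMap K K' (f.pull x)) {w : Place k' K'}
    {ι : w.ring →+* Ω} (hι : w.IsResidueMap ι) (hP : M.IsCenter w ι P) {x : K₀'} (hx : x ≠ 0) :
    w.ord (f' x) = e * (w.comap f').ord x := by
  obtain ⟨π, hπ⟩ : ∃ π, M.IsUniformizer P π := M.exists_uniformizer P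
  obtain ⟨π₀, hπ₀⟩ : ∃ π₀, M₀.IsUniformizer (f.pt P) π₀ := M₀.exists_uniformizer _
  obtain ⟨u, hu⟩ := he π π₀ hπ hπ₀
  have h1 := (hP.comap f hf').ord_uniformizer (hrat.pt f) hπ₀ (hι.comapResidue f')
  rw [w.ord_algHom f' h1 hx, hf', ← f.incl_loc, hu, map_mul, map_mul, map_pow, map_pow]
  have hu0 : algebraMap K K' (M.incl P u) ≠ 0 := by
    simpa using (u.isUnit.map (M.incl P)).ne_zero
  have hp0 : algebraMap K K' (M.incl P π) ≠ 0 := by simpa using hπ.incl_ne_zero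
  have hu1 : w.ord (algebraMap K K' (M.incl P u)) = 0 := by
    have h2 := (w.ord_nonneg_iff hu0).2 (hP u).1
    have h3 : ¬ 0 < w.ord (algebraMap K K' (M.incl P u)) := by
      rw [w.ord_pos_iff hu0, hP.mem_nonunits_iff hι]
      exact (u.isUnit.map (M.ev P)).ne_zero
    omega
  rw [w.ord_mul hu0 (pow_ne_zero _ hp0), hu1, w.ord_pow, hP.ord_uniformizer hrat hπ hι]
  ring

/-- If there are `d` rational points above a rational point, then by the fundamental inequality
there are no other points above it, and the morphism is unramified there. -/
lemma Hom.unramified_of_ncard [IsAlgClosed Ω] {f : M.Hom M₀} {f' : K₀' →ₐ[k'] K'}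
    (hf' : ∀ x, f' (algebraMap K₀ K₀' x) = algebraMap K K' (f.pull x))
    (hfin : (f' : K₀' →+* K').Finite) {d : ℕ}
    (hd : @Module.finrank K₀' K' _ _ (f' : K₀' →+* K').toAlgebra.toModule ≤ d)
    {P₀ : M₀.Pt} (hrat₀ : M₀.IsRational P₀ k') {T : Set M.Pt} (hTfin : T.Finite)
    (hT : ∀ P ∈ T, M.IsRational P k') (hcard : {Q ∈ T | f.pt Q = P₀}.ncard = d)
    {w : Place k' K'} {ι : w.ring →+* Ω} (hι : w.IsResidueMap ι)
    (hP₀ : M₀.IsCenter (w.comap f') (w.comapResidue f' ι) P₀) :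
    (∃ P ∈ T, M.IsCenter w ι P) ∧ ∀ x ≠ 0, w.ord (f' x) = (w.comap f').ord x := by
  classical
  have hfinT : {Q ∈ T | f.pt Q = P₀}.Finite := hTfin.subset fun _ h => h.1
  set s := hfinT.toFinset with hs
  have hscard : s.card = d := by rw [← hcard, Set.ncard_eq_toFinset_card _ hfinT]
  have hmem : ∀ Q ∈ s, Q ∈ T ∧ f.pt Q = P₀ := fun Q hQ => by simpa [hs] using hQ
  have hex : ∀ Q : s, ∃ (w : Place k' K') (ι : w.ring →+* Ω), w.IsResidueMap ι ∧
      M.IsCenter w ι Q := fun Q => exists_place (hT Q (hmem Q Q.2).1)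
  choose p ιp hιp hp using hex
  have hpinj : Function.Injective p := by
    intro Q Q' h
    have : ∀ (w₁ w₂ : Place k' K') (ι₁ : w₁.ring →+* Ω) (ι₂ : w₂.ring →+* Ω),
        w₁.IsResidueMap ι₁ → w₂.IsResidueMap ι₂ → M.IsCenter w₁ ι₁ Q → M.IsCenter w₂ ι₂ Q' →
        w₁ = w₂ → (Q : M.Pt) = Q' := by
      rintro w₁ w₂ ι₁ ι₂ h₁ h₂ hQ hQ' rfl
      exact (hQ.of_isRational (hT Q (hmem Q Q.2).1) h₁ h₂).eq h₂ hQ'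
    exact Subtype.ext (this _ _ _ _ (hιp Q) (hιp Q') (hp Q) (hp Q') h)
  have hpv : ∀ Q, (p Q).comap f' = w.comap f' := fun Q => by
    have h1 := (hp Q).comap f hf'
    rw [(hmem Q Q.2).2] at h1
    exact h1.place_eq hrat₀ ((hιp Q).comapResidue f') (hι.comapResidue f') hP₀
  obtain ⟨π, hπ⟩ := (w.comap f').exists_uniformizer
  let I : Finset (Place k' K') := Finset.univ.image p
  have hIcard : I.card = d := by
    rw [Finset.card_image_of_injective _ hpinj, Finset.card_univ, Fintype.card_coe, hscard]
  have hres : ∀ c ∈ (w.comap f').ring, ∃ a : k', c - algebraMap k' K₀' a ∈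
      (w.comap f').ring.nonunits := fun c hc =>
    hP₀.exists_sub_mem_nonunits hrat₀ (hι.comapResidue f') hc
  obtain ⟨h1, h2⟩ := Place.sum_ord_le_of_comap_eq f' hfin hd hres hπ.2 (insert w I) (by
    intro w' hw'
    rcases Finset.mem_insert.1 hw' with rfl | hw'
    · rfl
    · obtain ⟨Q, _, rfl⟩ := Finset.mem_image.1 hw'
      exact hpv Q)
  have hwI : w ∈ I := by
    by_contra hw
    rw [Finset.sum_insert hw] at h2
    have h3 := Finset.card_nsmul_le_sum I (fun w => w.ord (f' π)) 1
      fun w' hw' => h1 w' (Finset.mem_insert_of_mem hw')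
    have h4 := h1 w (Finset.mem_insert_self _ _)
    simp only [hIcard, nsmul_eq_mul, mul_one] at h3
    omega
  rw [Finset.insert_eq_of_mem hwI] at h1 h2
  have he : w.ord (f' π) = 1 := by
    rw [← Finset.add_sum_erase _ _ hwI] at h2
    have h3 := Finset.card_nsmul_le_sum (I.erase w) (fun w => w.ord (f' π)) 1
      fun w' hw' => h1 w' (Finset.mem_of_mem_erase hw')
    have h4 := h1 w hwI
    have h5 : 0 < I.card := Finset.card_pos.2 ⟨w, hwI⟩
    rw [Finset.card_erase_of_mem hwI, nsmul_eq_mul, mul_one, Nat.cast_sub h5, hIcard] at h3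
    push_cast at h3
    omega
  refine ⟨?_, fun x hx => by rw [w.ord_algHom f' hπ.2 hx, he, one_mul]⟩
  obtain ⟨Q, _, hQ⟩ := Finset.mem_image.1 hwI
  refine ⟨Q, (hmem Q Q.2).1, ?_⟩
  have h := hp Q
  have h' := hιp Q
  generalize ιp Q = ι' at h h'
  revert ι'
  rw [hQ]
  exact fun ι' h h' => h.of_isRational (hT Q (hmem Q Q.2).1) h' hι

lemma finite_setOf_center (S : Set M.Pt) (hS : S.Finite) (hrat : ∀ P ∈ S, M.IsRational P k') :
    {w : Place k' K' | ∃ ι : w.ring →+* Ω, w.IsResidueMap ι ∧ ∃ P ∈ S, M.IsCenter w ι P}.Finite := by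
  refine (hS.biUnion (t := fun P => {w : Place k' K' | ∃ ι : w.ring →+* Ω, w.IsResidueMap ι ∧
    P ∈ S ∧ M.IsCenter w ι P}) fun P hP => Set.Subsingleton.finite ?_).subset ?_
  · rintro w ⟨ι, h1, _, h2⟩ w' ⟨ι', h1', _, h2'⟩
    exact h2.place_eq (hrat P hP) h1 h1' h2'
  · rintro w ⟨ι, h1, P, hP, h2⟩
    exact Set.mem_biUnion hP ⟨ι, h1, hP, h2⟩

/-- The function which the complete set `S` and the regular set `T` yield: a non-constant function
`ψ` on the target with the same pullback under `f` and `g`. A suitable function `φ` with divisor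
supported on the images of `S` and `T` has pullbacks with the same divisor, and over a finite field
a power of it has the same pullbacks. -/
theorem exists_transcendental_pullback_eq [IsAlgClosed Ω] {f g : M.Hom M₀} {f' g' : K₀' →ₐ[k'] K'}
    (hf' : ∀ x, f' (algebraMap K₀ K₀' x) = algebraMap K K' (f.pull x))
    (hg' : ∀ x, g' (algebraMap K₀ K₀' x) = algebraMap K K' (g.pull x))
    (hffin : (f' : K₀' →+* K').Finite) (hgfin : (g' : K₀' →+* K').Finite) {d : ℕ} (hd0 : 0 < d)
    (hfd : @Module.finrank K₀' K' _ _ (f' : K₀' →+* K').toAlgebra.toModule ≤ d)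
    (hgd : @Module.finrank K₀' K' _ _ (g' : K₀' →+* K').toAlgebra.toModule ≤ d)
    {S T : Set M.Pt} (hSfin : S.Finite) (hSne : S.Nonempty) (hTfin : T.Finite) (hTne : T.Nonempty)
    (hST : Disjoint T S)
    (hSrat : ∀ P ∈ S, M.IsRational P k') (hTrat : ∀ P ∈ T, M.IsRational P k')
    (hSfg : f.pt '' S = g.pt '' S) (hSf : ∀ P, f.pt P ∈ g.pt '' S → P ∈ S)
    (hSg : ∀ P, g.pt P ∈ f.pt '' S → P ∈ S)
    (hSe : ∀ P ∈ S, ∃ e, f.HasRamIndex P e ∧ g.HasRamIndex P e)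
    (hTout : ∀ P ∈ T, {Q ∈ T | f.pt P = g.pt Q}.ncard = d)
    (hTin : ∀ P ∈ T, {Q ∈ T | f.pt Q = g.pt P}.ncard = d) :
    ∃ ψ : K₀', Transcendental k' ψ ∧ f' ψ = g' ψ := by
  classical
  -- `f` and `g` have the same image on `T`, over which the fibres have `d` elements
  have hout : ∀ P ∈ T, ∃ Q ∈ T, f.pt P = g.pt Q := fun P hP => by
    obtain ⟨Q, hQ⟩ := Set.nonempty_of_ncard_ne_zero (by rw [hTout P hP]; exact hd0.ne')
    exact ⟨Q, hQ⟩
  have hin : ∀ P ∈ T, ∃ Q ∈ T, f.pt Q = g.pt P := fun P hP => by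
    obtain ⟨Q, hQ⟩ := Set.nonempty_of_ncard_ne_zero (by rw [hTin P hP]; exact hd0.ne')
    exact ⟨Q, hQ⟩
  have hTfg : f.pt '' T = g.pt '' T := by
    refine Set.Subset.antisymm ?_ ?_
    · rintro _ ⟨P, hP, rfl⟩
      obtain ⟨Q, hQ, h⟩ := hout P hP
      exact ⟨Q, hQ, h.symm⟩
    · rintro _ ⟨P, hP, rfl⟩
      obtain ⟨Q, hQ, h⟩ := hin P hP
      exact ⟨Q, hQ, h⟩
  have hfT : ∀ P₀ ∈ f.pt '' T, {Q ∈ T | f.pt Q = P₀}.ncard = d := fun P₀ hP₀ => by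
    rw [hTfg] at hP₀
    obtain ⟨P, hP, rfl⟩ := hP₀
    exact hTin P hP
  have hgT : ∀ P₀ ∈ f.pt '' T, {Q ∈ T | g.pt Q = P₀}.ncard = d := fun P₀ hP₀ => by
    obtain ⟨P, hP, rfl⟩ := hP₀
    rw [← hTout P hP]
    simp only [eq_comm]
  have hS₀rat : ∀ P ∈ f.pt '' S, M₀.IsRational P k' := by
    rintro _ ⟨P, hP, rfl⟩; exact (hSrat P hP).pt f
  have hT₀rat : ∀ P ∈ f.pt '' T, M₀.IsRational P k' := by
    rintro _ ⟨P, hP, rfl⟩; exact (hTrat P hP).pt f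
  have hST₀ : ∀ P ∈ f.pt '' T, P ∉ f.pt '' S := by
    rintro _ ⟨P, hP, rfl⟩ h
    rw [hSfg] at h
    exact Set.disjoint_left.1 hST hP (hSf P h)
  let cen (S : Set M₀.Pt) : Set (Place k' K₀') :=
    {w | ∃ ι : w.ring →+* Ω, w.IsResidueMap ι ∧ ∃ P ∈ S, M₀.IsCenter w ι P}
  have hcS : (cen (f.pt '' S)).Finite := finite_setOf_center _ (hSfin.image _) hS₀rat
  have hcT : (cen (f.pt '' T)).Finite := finite_setOf_center _ (hTfin.image _) hT₀rat
  -- membership may be tested with any residue map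
  have hcen : ∀ {S : Set M₀.Pt}, (∀ P ∈ S, M₀.IsRational P k') → ∀ {w : Place k' K₀'}
      {ι : w.ring →+* Ω}, w.IsResidueMap ι → ∀ {P}, M₀.IsCenter w ι P →
      (w ∈ cen S ↔ P ∈ S) := by
    intro S hS w ι hι P hP
    refine ⟨?_, fun h => ⟨ι, hι, P, h, hP⟩⟩
    rintro ⟨ι', hι', Q, hQ, hQc⟩
    rw [hP.eq hι (hQc.of_isRational (hS Q hQ) hι' hι)]
    exact hQ
  have hne : ∀ {S : Set M.Pt}, S.Nonempty → (∀ P ∈ f.pt '' S, M₀.IsRational P k') →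
      (cen (f.pt '' S)).Nonempty := by
    rintro S ⟨P, hP⟩ hS
    obtain ⟨w, ι, hι, hw⟩ := exists_place (K' := K₀') (hS _ ⟨P, hP, rfl⟩)
    exact ⟨w, ι, hι, _, ⟨P, hP, rfl⟩, hw⟩
  obtain ⟨φ, α, β, hφ0, hα, hφT, hφS, hφ⟩ := exists_ord_eq (S := hcS.toFinset) (T := hcT.toFinset)
    (by rw [Set.Finite.toFinset_nonempty]; exact hne hSne hS₀rat) (by
      rw [Finset.disjoint_left]
      intro w hw hw'
      rw [Set.Finite.mem_toFinset] at hw hw'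
      obtain ⟨ι, hι, P, hP, hPc⟩ := hw'
      exact hST₀ P hP ((hcen hS₀rat hι hPc).1 hw))
  simp only [Set.Finite.mem_toFinset] at hφT hφS hφ
  have hf0 : f' φ ≠ 0 := by simpa using hφ0
  have hg0 : g' φ ≠ 0 := by simpa using hφ0
  have hord : ∀ w : Place k' K', w.ord (f' φ) = w.ord (g' φ) := by
    intro w
    obtain ⟨ι, hι⟩ := w.exists_isResidueMap (Ω := Ω)
    obtain ⟨P, hP⟩ := exists_isCenter (M := M) hι
    have hιf := hι.comapResidue f'
    have hιg := hι.comapResidue g'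
    have hPf := hP.comap f hf'
    have hPg := hP.comap g hg'
    have hfT' := hcen hT₀rat hιf hPf
    have hgT' := hcen hT₀rat hιg hPg
    have hfS' := hcen hS₀rat hιf hPf
    have hgS' := hcen hS₀rat hιg hPg
    have hTf : f.pt P ∈ f.pt '' T → P ∈ T ∧ ∀ x ≠ 0, w.ord (f' x) = (w.comap f').ord x := by
      intro h
      obtain ⟨⟨Q, hQ, hQc⟩, h'⟩ := Hom.unramified_of_ncard hf' hffin hfd (hT₀rat _ h) hTfin hTrat
        (hfT _ h) hι hPf
      rw [hP.eq hι hQc]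
      exact ⟨hQ, h'⟩
    have hTg : g.pt P ∈ f.pt '' T → P ∈ T ∧ ∀ x ≠ 0, w.ord (g' x) = (w.comap g').ord x := by
      intro h
      obtain ⟨⟨Q, hQ, hQc⟩, h'⟩ := Hom.unramified_of_ncard hg' hgfin hgd (hT₀rat _ h) hTfin hTrat
        (hgT _ h) hι hPg
      rw [hP.eq hι hQc]
      exact ⟨hQ, h'⟩
    by_cases hPT : P ∈ T
    · have h1 : f.pt P ∈ f.pt '' T := ⟨P, hPT, rfl⟩
      have h2 : g.pt P ∈ f.pt '' T := hTfg ▸ ⟨P, hPT, rfl⟩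
      rw [(hTf h1).2 φ hφ0, (hTg h2).2 φ hφ0, hφT _ (hfT'.2 h1), hφT _ (hgT'.2 h2)]
    by_cases hPS : P ∈ S
    · have h1 : f.pt P ∈ f.pt '' S := ⟨P, hPS, rfl⟩
      have h2 : g.pt P ∈ f.pt '' S := hSfg ▸ ⟨P, hPS, rfl⟩
      obtain ⟨e, hef, heg⟩ := hSe P hPS
      rw [hef.ord_eq (hSrat P hPS) hf' hι hP hφ0, heg.ord_eq (hSrat P hPS) hg' hι hP hφ0,
        hφS _ (hfS'.2 h1), hφS _ (hgS'.2 h2)]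
    · have h1 : (w.comap f').ord φ = 0 := hφ _
        (fun h => hPS (hSf P (hSfg ▸ hfS'.1 h))) (fun h => hPT (hTf (hfT'.1 h)).1)
      have h2 : (w.comap g').ord φ = 0 := hφ _
        (fun h => hPS (hSg P (hgS'.1 h))) (fun h => hPT (hTg (hgT'.1 h)).1)
      rw [w.ord_algHom f' (w.comap f').ord_uniformizer hφ0, h1,
        w.ord_algHom g' (w.comap g').ord_uniformizer hφ0, h2, mul_zero, mul_zero]
  obtain ⟨n, hn, hun⟩ := exists_pow_eq_one_of_forall_ord (k := k') (u := f' φ / g' φ)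
    (div_ne_zero hf0 hg0) fun w => by rw [w.ord_div hf0 hg0, hord w, sub_self]
  refine ⟨φ ^ n, fun halg => ?_, ?_⟩
  · obtain ⟨w, hw⟩ := hne hTne hT₀rat
    have h := w.ord_eq_zero_of_isAlgebraic halg
    rw [w.ord_pow, hφT w hw] at h
    have : 0 < (n : ℤ) * α := mul_pos (by exact_mod_cast hn) hα
    omega
  · rw [div_pow, div_eq_one_iff_eq (pow_ne_zero _ hg0)] at hun
    rw [map_pow, map_pow, hun]

end Extension

end CurveModel

end

noncomputable section

/-! ### Extending homomorphisms of function fields -/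

section ExtendHom

variable {k K k' K' : Type*} [Field k] [Field K] [Algebra k K]
  [Field k'] [Field K'] [Algebra k k'] [Algebra K K']
  [Algebra k' K'] [Algebra k K'] [IsScalarTower k K K'] [IsScalarTower k k' K']
  {K₀ K₀' : Type*} [Field K₀] [Algebra k K₀]
  [Field K₀'] [Algebra K₀ K₀']
  [Algebra k' K₀'] [Algebra k K₀'] [IsScalarTower k K₀ K₀'] [IsScalarTower k k' K₀']
  [Algebra.IsPushout k k' K₀ K₀']

variable (K₀') in
/-- The `k'`-linear extension to `K₀' = k' ⊗ K₀` of a homomorphism from `K₀` to a field over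
`k'`. -/
def extendHom {L : Type*} [Field L] [Algebra k L] [Algebra k' L] [IsScalarTower k k' L]
    (x : K₀ →ₐ[k] L) : K₀' →ₐ[k'] L :=
  { Algebra.pushoutDesc K₀' (IsScalarTower.toAlgHom k k' L) x fun _ _ => mul_comm _ _ with
    commutes' := fun c => Algebra.pushoutDesc_left K₀' (IsScalarTower.toAlgHom k k' L) x
      (fun _ _ => mul_comm _ _) c }

lemma extendHom_algebraMap {L : Type*} [Field L] [Algebra k L] [Algebra k' L]
    [IsScalarTower k k' L] (x : K₀ →ₐ[k] L) (a : K₀) :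
    extendHom K₀' (k' := k') x (algebraMap K₀ K₀' a) = x a :=
  Algebra.pushoutDesc_right K₀' (IsScalarTower.toAlgHom k k' L) x (fun _ _ => mul_comm _ _) a

lemma algHom_ext_of_isPushout (hout : Algebra.IsPushout k k' K₀ K₀') {L : Type*} [Field L]
    [Algebra k' L] {x y : K₀' →ₐ[k'] L}
    (h : ∀ a, x (algebraMap K₀ K₀' a) = y (algebraMap K₀ K₀' a)) : x = y := by
  refine AlgHom.ext fun z => ?_
  induction z using hout.out.inductionOn with
  | zero => simp
  | tmul a => exact h a
  | smul c a ha => rw [map_smul, map_smul, ha]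
  | add a b ha hb => rw [map_add, map_add, ha, hb]

/-- A constant field extension does not increase degrees. -/
lemma finite_of_isPushout [Algebra.IsPushout k k' K K'] (f : K₀ →ₐ[k] K) (f' : K₀' →ₐ[k'] K')
    (hf' : ∀ x, f' (algebraMap K₀ K₀' x) = algebraMap K K' (f x))
    (hfin : (f : K₀ →+* K).Finite) :
    (f' : K₀' →+* K').Finite ∧ @Module.finrank K₀' K' _ _ (f' : K₀' →+* K').toAlgebra.toModule ≤
      @Module.finrank K₀ K _ _ (f : K₀ →+* K).toAlgebra.toModule := by
  classical
  let _ : Algebra K₀ K := (f : K₀ →+* K).toAlgebra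
  let _ : Algebra K₀' K' := (f' : K₀' →+* K').toAlgebra
  have : FiniteDimensional K₀ K := hfin
  let b := Module.finBasis K₀ K
  have hspan : ⊤ ≤ Submodule.span K₀' (Set.range fun i => algebraMap K K' (b i)) := by
    rintro z -
    have hout := Algebra.IsPushout.out (R := k) (S := k') (R' := K) (S' := K')
    induction z using hout.inductionOn with
    | zero => exact zero_mem _
    | tmul x =>
      change algebraMap K K' x ∈ _
      rw [← b.sum_repr x, map_sum]
      refine sum_mem fun i _ => ?_
      have : algebraMap K K' (b.repr x i • b i) =
          algebraMap K₀ K₀' (b.repr x i) • algebraMap K K' (b i) := by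
        rw [Algebra.smul_def, Algebra.smul_def, map_mul]
        exact congrArg (· * _) (hf' _).symm
      rw [this]
      exact Submodule.smul_mem _ _ (Submodule.subset_span ⟨i, rfl⟩)
    | smul c x hx =>
      have : c • x = algebraMap k' K₀' c • x := by
        rw [Algebra.smul_def, Algebra.smul_def]
        exact congrArg (· * x) (f'.commutes c).symm
      rw [this]
      exact Submodule.smul_mem _ _ hx
    | add x y hx hy => exact add_mem hx hy
  refine ⟨⟨⟨Finset.univ.image fun i => algebraMap K K' (b i), ?_⟩⟩, ?_⟩
  · rw [Finset.coe_image, Finset.coe_univ, Set.image_univ]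
    exact top_le_iff.1 hspan
  · have h := finrank_range_le_card (R := K₀') fun i => algebraMap K K' (b i)
    rw [Set.finrank, top_le_iff.1 hspan, finrank_top, Fintype.card_fin] at h
    exact h

/-- If `f` and `g` have the same values at a transcendental element `ψ` of the constant field
extension, then long chains of homomorphisms `xᵢ` with `xᵢ ∘ f = xᵢ₊₁ ∘ g` have repetitions: the
extensions of the `xᵢ` agree on `k'(h)`, where `h = f ψ = g ψ`, over which `K'` is finite. -/
theorem exists_forall_chain_eq [Algebra.IsPushout k k' K K'] [IsFunctionField k' K']
    {f g : K₀ →ₐ[k] K} {f' g' : K₀' →ₐ[k'] K'}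
    (hf' : ∀ x, f' (algebraMap K₀ K₀' x) = algebraMap K K' (f x))
    (hg' : ∀ x, g' (algebraMap K₀ K₀' x) = algebraMap K K' (g x)) {ψ : K₀'}
    (hψ : Transcendental k' ψ) (hfg : f' ψ = g' ψ) :
    ∃ N : ℕ, ∀ (L : Type*) [Field L] [Algebra k L] [Algebra k' L] [IsScalarTower k k' L]
      (x : ℕ → K →ₐ[k] L), (∀ i < N, (x i).comp f = (x (i + 1)).comp g) →
      ∃ i j, i < j ∧ j ≤ N ∧ x i = x j := by
  have hh : Transcendental k' (f' ψ) := fun h =>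
    hψ ((isAlgebraic_algHom_iff f' f'.injective).1 h)
  set h := f' ψ with hh_def
  have hfin := IsFunctionField.finite_adjoin h hh
  set E := IntermediateField.adjoin k' {h}
  refine ⟨Module.finrank E K', fun L _ _ _ _ x hx => ?_⟩
  set N := Module.finrank E K'
  let y : ℕ → K' →ₐ[k'] L := fun i => extendHom K' (x i)
  have hyx : ∀ i a, y i (algebraMap K K' a) = x i a := fun i a => extendHom_algebraMap _ _
  have hy : ∀ i < N, (y i).comp f' = (y (i + 1)).comp g' := fun i hi => by
    refine algHom_ext_of_isPushout (k := k) (K₀ := K₀) inferInstance fun a => ?_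
    rw [AlgHom.comp_apply, AlgHom.comp_apply, hf', hg', hyx, hyx]
    exact DFunLike.congr_fun (hx i hi) a
  have hyh : ∀ i ≤ N, y i h = y 0 h := by
    intro i
    induction i with
    | zero => intro _; rfl
    | succ i ih =>
      intro hi
      rw [← ih (by omega)]
      calc y (i + 1) h = y (i + 1) (g' ψ) := congrArg _ hfg
        _ = y i h := (DFunLike.congr_fun (hy i (by omega)) ψ).symm
  let _ : Algebra E L := (((y 0).comp E.val : E →ₐ[k'] L) : E →+* L).toAlgebra
  have hyE : ∀ i ≤ N, ∀ e : E, y i e = y 0 e := fun i hi e => by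
    have := IntermediateField.algHom_ext_of_eq_adjoin (F := k') (E := K') (S := E) rfl
      (φ₁ := (y i).comp E.val) (φ₂ := (y 0).comp E.val) (by
        rintro _ rfl; exact hyh i hi)
    exact DFunLike.congr_fun this e
  let z : Fin (N + 1) → K' →ₐ[E] L := fun i =>
    { (y i : K' →+* L) with commutes' := fun e => hyE i (by omega) e }
  have hcard : Nat.card (K' →ₐ[E] L) ≤ N := card_algHom_le_finrank E K' L
  obtain ⟨i, j, hij, hzij⟩ : ∃ i j, i ≠ j ∧ z i = z j := by
    have := Fintype.ofFinite (K' →ₐ[E] L)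
    refine Fintype.exists_ne_map_eq_of_card_lt z ?_
    rw [Fintype.card_fin, ← Nat.card_eq_fintype_card]
    omega
  have hxij : x i = x j := AlgHom.ext fun a => by
    rw [← hyx, ← hyx]
    exact DFunLike.congr_fun hzij (algebraMap K K' a)
  rcases lt_or_gt_of_ne hij with hlt | hlt
  · exact ⟨i, j, hlt, by omega, hxij⟩
  · exact ⟨j, i, hlt, by omega, hxij.symm⟩

end ExtendHom

end

noncomputable section

/-! ### Local rings which are étale over a polynomial ring in one variable -/

section Local

lemma exists_eq_unit_mul_pow {R : Type*} [CommRing R] [IsLocalRing R] [IsNoetherianRing R] {ϖ : R}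
    (hϖ : IsLocalRing.maximalIdeal R = Ideal.span {ϖ}) {x : R} (hx : x ≠ 0) :
    ∃ (n : ℕ) (u : Rˣ), x = u * ϖ ^ n := by
  have hex : ∃ n : ℕ, x ∉ IsLocalRing.maximalIdeal R ^ n := by
    by_contra! h
    have h1 : x ∈ ⨅ i : ℕ, IsLocalRing.maximalIdeal R ^ i := Ideal.mem_iInf.2 h
    rw [Ideal.iInf_pow_eq_bot_of_isLocalRing _ (Ideal.IsPrime.ne_top inferInstance)] at h1
    exact hx h1
  classical
  have h0 : Nat.find hex ≠ 0 := fun h => by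
    have := Nat.find_spec hex
    rw [h, pow_zero, Ideal.one_eq_top] at this
    exact this trivial
  obtain ⟨n, hn⟩ := Nat.exists_eq_succ_of_ne_zero h0
  have h1 : x ∈ IsLocalRing.maximalIdeal R ^ n := by
    by_contra h
    have := Nat.find_min' hex h
    omega
  have h2 := Nat.find_spec hex
  rw [hn] at h2
  rw [hϖ, Ideal.span_singleton_pow, Ideal.mem_span_singleton] at h1 h2
  obtain ⟨y, rfl⟩ := h1
  have hy : IsUnit y := by
    by_contra hy
    rw [← mem_nonunits_iff, ← IsLocalRing.mem_maximalIdeal, hϖ, Ideal.mem_span_singleton] at hy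
    exact h2 (by rw [Nat.succ_eq_add_one, pow_succ]; exact mul_dvd_mul_left _ hy)
  exact ⟨n, hy.unit, mul_comm _ _⟩

lemma isDomain_of_maximalIdeal_eq_span {R : Type*} [CommRing R] [IsLocalRing R]
    [IsNoetherianRing R] {ϖ : R} (hϖ : IsLocalRing.maximalIdeal R = Ideal.span {ϖ})
    (hreg : ϖ = 0 ∨ IsLeftRegular ϖ) : IsDomain R := by
  have : NoZeroDivisors R := by
    refine ⟨fun {a b} hab => ?_⟩
    by_contra! h
    obtain ⟨m, u, hu⟩ := exists_eq_unit_mul_pow hϖ h.1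
    obtain ⟨n, v, hv⟩ := exists_eq_unit_mul_pow hϖ h.2
    have h0 : ϖ ^ (m + n) = 0 := by
      rw [hu, hv] at hab
      have : (↑(u * v) : R) * ϖ ^ (m + n) = 0 := by
        rw [← hab, Units.val_mul, pow_add]; ring
      rwa [Units.mul_right_eq_zero] at this
    rcases hreg with hreg | hreg
    · have hm : m = 0 := by
        by_contra hm
        exact h.1 (by rw [hu, hreg, zero_pow hm, mul_zero])
      have hn : n = 0 := by
        by_contra hn
        exact h.2 (by rw [hv, hreg, zero_pow hn, mul_zero])
      rw [hm, hn, pow_zero] at h0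
      exact one_ne_zero h0
    · have := (hreg.pow (m + n)) (show ϖ ^ (m + n) * 1 = ϖ ^ (m + n) * 0 by
        rw [mul_one, mul_zero, h0])
      exact one_ne_zero this
  exact NoZeroDivisors.to_isDomain R

/-- The maximal ideal of a local ring which is essentially unramified over a principal ideal ring
is generated by an element of the latter. -/
lemma exists_maximalIdeal_eq_span (A : Type*) {B : Type*} [CommRing A] [IsPrincipalIdealRing A]
    [CommRing B] [IsLocalRing B] [Algebra A B] [Algebra.EssFiniteType A B]
    [Algebra.FormallyUnramified A B] :
    ∃ ϖ : A, IsLocalRing.maximalIdeal B = Ideal.span {algebraMap A B ϖ} := by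
  let p : Ideal A := (IsLocalRing.maximalIdeal B).comap (algebraMap A B)
  have hunit : ∀ y : p.primeCompl, IsUnit (algebraMap A B y) := fun y => by
    by_contra h
    exact y.2 ((IsLocalRing.mem_maximalIdeal _).2 h)
  let R := Localization.AtPrime p
  let φ : R →+* B := IsLocalization.lift hunit
  let _ : Algebra R B := φ.toAlgebra
  have hφ : ∀ a, φ (algebraMap A R a) = algebraMap A B a := fun a => IsLocalization.lift_eq _ a
  have : IsScalarTower A R B := .of_algebraMap_eq fun a => (hφ a).symm
  have : IsLocalHom (algebraMap R B) := by
    refine ⟨fun x hx => ?_⟩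
    obtain ⟨a, s, rfl⟩ := IsLocalization.exists_mk'_eq p.primeCompl x
    have ha : a ∈ p.primeCompl := fun ha => by
      have h1 : algebraMap R B (IsLocalization.mk' R a s) * algebraMap A B s = algebraMap A B a := by
        rw [IsScalarTower.algebraMap_apply A R B, ← map_mul, IsLocalization.mk'_spec,
          ← IsScalarTower.algebraMap_apply]
      have h2 : IsUnit (algebraMap A B a) := h1 ▸ hx.mul (hunit s)
      exact (IsLocalRing.mem_maximalIdeal _).1 ha h2
    exact (IsLocalization.AtPrime.isUnit_mk'_iff R p a s).2 ha
  have : Algebra.EssFiniteType R B := .of_comp A _ _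
  have : Algebra.FormallyUnramified R B := .of_restrictScalars A _ _
  obtain ⟨ϖ, hϖ⟩ := IsPrincipalIdealRing.principal p
  refine ⟨ϖ, ?_⟩
  rw [← Algebra.FormallyUnramified.map_maximalIdeal (R := R) (S := B),
    ← Localization.AtPrime.map_eq_maximalIdeal, Ideal.map_map, ← IsScalarTower.algebraMap_eq,
    show p = Ideal.span {ϖ} from hϖ, Ideal.map_span, Set.image_singleton]

/-- A local ring of an étale algebra over `k[t]` is a discrete valuation ring or a field. -/
theorem local_of_etale {k S : Type*} [Field k] [CommRing S] [Algebra (Polynomial k) S]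
    [Algebra.Etale (Polynomial k) S] (q : Ideal S) [q.IsPrime] (B : Type*) [CommRing B]
    [IsLocalRing B] [Algebra S B] [Algebra (Polynomial k) B] [IsScalarTower (Polynomial k) S B]
    [IsLocalization.AtPrime B q] :
    IsDomain B ∧ IsNoetherianRing B ∧ Algebra.EssFiniteType (Polynomial k) B ∧
      Algebra.FormallyUnramified (Polynomial k) B ∧
      Function.Injective (algebraMap (Polynomial k) B) ∧
      ∃ ϖ : Polynomial k, IsLocalRing.maximalIdeal B = Ideal.span {algebraMap _ B ϖ} := by
  have h1 : Algebra.EssFiniteType S B := .of_isLocalization _ q.primeCompl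
  have h2 : Algebra.EssFiniteType (Polynomial k) B := .comp _ S _
  have h3 : Algebra.FormallyUnramified S B := .of_isLocalization q.primeCompl
  have h4 : Algebra.FormallyUnramified (Polynomial k) B := .comp _ S _
  have h5 : IsNoetherianRing B := by
    have : IsNoetherianRing S := Algebra.FiniteType.isNoetherianRing (Polynomial k) S
    exact IsLocalization.isNoetherianRing q.primeCompl B this
  have h6 : Module.Flat (Polynomial k) B := by
    have : Module.Flat S B := IsLocalization.flat B q.primeCompl
    exact Module.Flat.trans _ S _
  obtain ⟨ϖ, hϖ⟩ := exists_maximalIdeal_eq_span (Polynomial k) (B := B)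
  have hreg : ∀ a : Polynomial k, a ≠ 0 → IsLeftRegular (algebraMap _ B a) := fun a ha => by
    have := Module.Flat.isSMulRegular_of_nonZeroDivisors (M := B) (mem_nonZeroDivisors_of_ne_zero ha)
    intro x y hxy
    refine this ?_
    simpa [Algebra.smul_def] using hxy
  refine ⟨isDomain_of_maximalIdeal_eq_span hϖ ?_, h5, h2, h4, ?_, ϖ, hϖ⟩
  · by_cases h : ϖ = 0
    · left; rw [h, map_zero]
    · exact Or.inr (hreg ϖ h)
  · rw [injective_iff_map_eq_zero]
    intro a ha
    by_contra h
    have := hreg a h (show algebraMap _ B a * 1 = algebraMap _ B a * 0 by rw [ha]; simp)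
    exact one_ne_zero this

end Local

/-! ### Recognizing function fields of one variable -/

section FunctionField

universe v

lemma isFunctionField_of_trdeg {k : Type*} {F : Type v} [Field k] [Field F] [Algebra k F]
    [Algebra.EssFiniteType k F] (h : Algebra.trdeg k F = 1) : IsFunctionField k F where
  exists_transcendental := by
    have : Algebra.Transcendental k F := trdeg_ne_zero_iff.1 (by rw [h]; exact one_ne_zero)
    exact this.transcendental
  finite_adjoin z hz := by
    have hind : AlgebraicIndependent k (fun _ : Unit => z) :=
      algebraicIndependent_unique_type_iff.2 hz
    have hb := hind.isTranscendenceBasis_of_lift_trdeg_le_of_finite (by rw [h]; simp)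
    have := hb.isAlgebraic_field
    rw [Set.range_const] at this
    have : Algebra.EssFiniteType (IntermediateField.adjoin k {z}) F := .of_comp k _ _
    exact Algebra.finite_of_essFiniteType_of_isAlgebraic

/-- A field which is essentially unramified over `k[t]` is algebraic over it. -/
lemma trdeg_eq_one_of_formallyUnramified {k : Type v} {F : Type v} [Field k] [Field F] [Algebra k F]
    [Algebra (Polynomial k) F] [IsScalarTower k (Polynomial k) F]
    [Algebra.EssFiniteType (Polynomial k) F] [Algebra.FormallyUnramified (Polynomial k) F]
    (hinj : Function.Injective (algebraMap (Polynomial k) F)) : Algebra.trdeg k F = 1 := by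
  have : FaithfulSMul (Polynomial k) F := (faithfulSMul_iff_algebraMap_injective _ _).2 hinj
  let E := FractionRing (Polynomial k)
  let φ : E →+* F := IsFractionRing.lift hinj
  let _ : Algebra E F := φ.toAlgebra
  have : IsScalarTower (Polynomial k) E F := .of_algebraMap_eq fun a =>
    (IsFractionRing.lift_algebraMap hinj a).symm
  have : Algebra.EssFiniteType E F := .of_comp (Polynomial k) _ _
  have : Algebra.FormallyUnramified E F := .of_restrictScalars (Polynomial k) _ _
  have : Module.Finite E F := Algebra.FormallyUnramified.finite_of_free E F
  have : Algebra.IsAlgebraic (Polynomial k) F :=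
    (IsFractionRing.comap_isAlgebraic_iff (A := Polynomial k) (K := E) (C := F)).2 inferInstance
  rw [← trdeg_add_eq k (Polynomial k) (A := F), Polynomial.trdeg_of_isDomain,
    trdeg_eq_zero (R := Polynomial k) (A := F), add_zero]

/-- The constant field extension of a function field by an algebraic extension of the constants. -/
lemma isFunctionField_of_isPushout {k F k' F' : Type v} [Field k] [Field F] [Algebra k F] [Field k']
    [Algebra k k'] [Algebra.IsAlgebraic k k'] [Field F'] [Algebra F F'] [Algebra k' F']
    [Algebra k F'] [IsScalarTower k F F'] [IsScalarTower k k' F'] [Algebra.IsPushout k k' F F']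
    [Algebra.EssFiniteType k F] (h : Algebra.trdeg k F = 1) : IsFunctionField k' F' := by
  have h1 : Algebra.EssFiniteType k' F' :=
    (Algebra.EssFiniteType.iff_of_algEquiv (Algebra.IsPushout.equiv k k' F F')).1 inferInstance
  have h2 : Algebra.IsAlgebraic F F' := by
    have : Algebra.IsPushout k F k' F' := Algebra.IsPushout.symm inferInstance
    have : Algebra.IsIntegral F (TensorProduct k F k') := inferInstance
    have : Algebra.IsIntegral F F' := .of_surjective
      (Algebra.IsPushout.equiv k F k' F').toAlgHom (Algebra.IsPushout.equiv k F k' F').surjective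
    infer_instance
  refine isFunctionField_of_trdeg ?_
  have h3 := trdeg_add_eq k F (A := F')
  have h4 := trdeg_add_eq k k' (A := F')
  rw [h, trdeg_eq_zero (R := F) (A := F'), add_zero] at h3
  rw [trdeg_eq_zero (R := k) (A := k'), zero_add, ← h3] at h4
  exact h4

end FunctionField

end

noncomputable section

/-! ### Constant field extensions of geometrically irreducible function fields -/

section ConstantExtension

open TensorProduct

/-- A common denominator in `S` for an element of `K ⊗ k'`. -/
lemma exists_smul_mem_range_tensor {k S K k' : Type*} [CommRing k] [CommRing S] [IsDomain S]
    [Field K] [CommRing k'] [Algebra k S] [Algebra S K] [IsFractionRing S K] [Algebra k K]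
    [IsScalarTower k S K] [Algebra k k'] (z : K ⊗[k] k') :
    ∃ s : S, s ≠ 0 ∧ ∃ y : S ⊗[k] k',
      (algebraMap S K s ⊗ₜ 1) * z = Algebra.TensorProduct.map (IsScalarTower.toAlgHom k S K)
        (AlgHom.id k k') y := by
  induction z using TensorProduct.induction_on with
  | zero => exact ⟨1, one_ne_zero, 0, by simp⟩
  | tmul x c =>
    obtain ⟨a, b, hb, rfl⟩ := IsFractionRing.div_surjective (A := S) x
    refine ⟨b, nonZeroDivisors.ne_zero hb, a ⊗ₜ c, ?_⟩
    have : algebraMap S K b ≠ 0 := by simpa using nonZeroDivisors.ne_zero hb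
    rw [Algebra.TensorProduct.tmul_mul_tmul, one_mul, mul_div_cancel₀ _ this]
    rfl
  | add x y hx hy =>
    obtain ⟨s, hs, a, ha⟩ := hx
    obtain ⟨t, ht, b, hb⟩ := hy
    refine ⟨s * t, mul_ne_zero hs ht, (t ⊗ₜ 1) * a + (s ⊗ₜ 1) * b, ?_⟩
    rw [map_add, map_mul _ (t ⊗ₜ 1) a, map_mul _ (s ⊗ₜ 1) b, ← ha, ← hb, map_mul]
    have h : ∀ a b : K, (a * b) ⊗ₜ[k] (1 : k') = a ⊗ₜ 1 * b ⊗ₜ 1 := fun a b => by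
      rw [Algebra.TensorProduct.tmul_mul_tmul, one_mul]
    simp only [Algebra.TensorProduct.map_tmul, map_one, IsScalarTower.toAlgHom_apply, h]
    ring

/-- If `Spec (S ⊗ k')` is irreducible, `k'` is a finite separable extension of `k` and `K` is the
fraction field of `S`, then `K ⊗ k'` is a field. -/
theorem isField_tensorProduct {k S K k' : Type*} [Field k] [CommRing S] [IsDomain S]
    [Field K] [Field k'] [Algebra k S] [Algebra S K] [IsFractionRing S K] [Algebra k K]
    [IsScalarTower k S K] [Algebra k k'] [FiniteDimensional k k'] [Algebra.IsSeparable k k']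
    (hirr : IrreducibleSpace (PrimeSpectrum (S ⊗[k] k'))) : IsField (K ⊗[k] k') := by
  have : Algebra.FormallyUnramified k k' := Algebra.FormallyUnramified.of_isSeparable k k'
  have : IsReduced (K ⊗[k] k') := Algebra.FormallyUnramified.isReduced_of_field K _
  let j := Algebra.TensorProduct.map (IsScalarTower.toAlgHom k S K) (AlgHom.id k k')
  have hj : Function.Injective j :=
    Module.Flat.rTensor_preserves_injective_linearMap (M := k')
      (IsScalarTower.toAlgHom k S K).toLinearMap (IsFractionRing.injective S K)
  have : IsReduced (S ⊗[k] k') := isReduced_of_injective j hj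
  have : IsDomain (S ⊗[k] k') := by
    rw [PrimeSpectrum.irreducibleSpace_iff_isPrime_nilradical, nilradical_eq_zero] at hirr
    have : (⊥ : Ideal (S ⊗[k] k')).IsPrime := hirr
    exact IsDomain.of_bot_isPrime _
  have hunit : ∀ s : S, s ≠ 0 → IsUnit ((algebraMap S K s) ⊗ₜ[k] (1 : k')) := fun s hs => by
    have : IsUnit (algebraMap S K s) := by
      rw [isUnit_iff_ne_zero]; simpa using hs
    exact this.map (Algebra.TensorProduct.includeLeft : K →ₐ[k] K ⊗[k] k')
  have : NoZeroDivisors (K ⊗[k] k') := by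
    refine ⟨fun {x y} hxy => ?_⟩
    obtain ⟨s, hs, a, ha⟩ := exists_smul_mem_range_tensor (S := S) x
    obtain ⟨t, ht, b, hb⟩ := exists_smul_mem_range_tensor (S := S) y
    have hab : a * b = 0 := by
      apply hj
      rw [map_mul, map_zero]
      refine (congrArg₂ (· * ·) ha hb).symm.trans ?_
      change _ * x * (_ * y) = 0
      rw [mul_mul_mul_comm, hxy, mul_zero]
    rcases mul_eq_zero.1 hab with h | h
    · left
      rw [h, map_zero] at ha
      exact ((hunit s hs).mul_right_eq_zero).1 ha
    · right
      rw [h, map_zero] at hb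
      exact ((hunit t ht).mul_right_eq_zero).1 hb
  have : IsDomain (K ⊗[k] k') := NoZeroDivisors.to_isDomain _
  exact isField_of_isIntegral_of_isField' (Field.toIsField K)

end ConstantExtension

/-- A geometrically irreducible affine scheme stays irreducible under extension of the base
field. -/
lemma irreducibleSpace_tensorProduct {k S k' : Type u} [Field k] [CommRing S] [Algebra k S] [Field k']
    [Algebra k k'] [h : GeometricallyIrreducible (Spec.map (CommRingCat.ofHom (algebraMap k S)))] :
    IrreducibleSpace (PrimeSpectrum (TensorProduct k S k')) := by
  have h1 : IrreducibleSpace ↥(pullback (Spec.map (CommRingCat.ofHom (algebraMap k S)))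
      (Spec.map (CommRingCat.ofHom (algebraMap k k')))) :=
    GeometricallyIrreducible.geometrically_irreducibleSpace _ _ _ (.of_hasPullback _ _)
  let e := Scheme.homeoOfIso (pullbackSpecIso k S k')
  have : Nonempty ↥(Spec (CommRingCat.of (TensorProduct k S k'))) :=
    ⟨e (Classical.arbitrary _)⟩
  exact e.symm.isOpenEmbedding.irreducibleSpace

end

noncomputable section

/-! ### Curves locally: étale coordinates -/

section Charts

variable {k : Type u} [Field k] (X : Over (Base k))

/-- The structure morphism of a scheme over `k`, with its target spelled out. -/
abbrev structMap : X.left ⟶ Spec (CommRingCat.of k) := X.hom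

/-- The constants among the germs at a point. -/
def stalkConst (x : X.left) : CommRingCat.of k ⟶ X.left.presheaf.stalk x :=
  Spec.preimage (X.left.fromSpecStalk x ≫ structMap X)

lemma map_stalkConst (x : X.left) :
    Spec.map (stalkConst X x) = X.left.fromSpecStalk x ≫ structMap X := Spec.map_preimage _

/-- The constants among the functions on an affine open subset. -/
def sectionConst {V : X.left.Opens} (hV : IsAffineOpen V) : CommRingCat.of k ⟶ Γ(X.left, V) :=
  Spec.preimage (hV.fromSpec ≫ structMap X)

lemma map_sectionConst {V : X.left.Opens} (hV : IsAffineOpen V) :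
    Spec.map (sectionConst X hV) = hV.fromSpec ≫ structMap X := Spec.map_preimage _

lemma sectionConst_germ {V : X.left.Opens} (hV : IsAffineOpen V) {x : X.left} (hx : x ∈ V) :
    sectionConst X hV ≫ X.left.presheaf.germ V x hx = stalkConst X x := by
  apply Spec.map_injective
  rw [Spec.map_comp, map_sectionConst, map_stalkConst, ← Category.assoc,
    ← hV.fromSpecStalk_eq_fromSpecStalk hx]
  rfl

lemma stalkConst_stalkSpecializes {x y : X.left} (h : x ⤳ y) :
    stalkConst X y ≫ X.left.presheaf.stalkSpecializes h = stalkConst X x := by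
  apply Spec.map_injective
  rw [Spec.map_comp, map_stalkConst, map_stalkConst, ← Category.assoc,
    Scheme.SpecMap_stalkSpecializes_fromSpecStalk]

variable [hX : IsCurve X]

/-- Each point of a curve has an affine open neighbourhood which is étale over the affine line. -/
lemma exists_etale_chart (x : X.left) :
    ∃ (V : X.left.Opens) (hV : IsAffineOpen V) (_ : x ∈ V) (g : Polynomial k →+* Γ(X.left, V)),
      g.Etale ∧ g.comp Polynomial.C = (sectionConst X hV).hom := by
  obtain ⟨U, hU, V, hV, hxV, e, hsm⟩ :=
    hX.smooth.exists_isStandardSmoothOfRelativeDimension x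
  have hUtop : U = ⊤ := by
    refine eq_top_iff.2 fun y _ => ?_
    have : y = X.hom x := Subsingleton.elim (α := PrimeSpectrum k) _ _
    rw [this]
    exact e hxV
  subst hUtop
  refine ⟨V, hV, hxV, ?_⟩
  have h1 := IsAffineOpen.SpecMap_appLE_fromSpec (structMap X) hU hV e
  have h2 : hU.fromSpec = Spec.map (Scheme.ΓSpecIso (CommRingCat.of k)).inv := by
    rw [show hU = isAffineOpen_top _ from rfl, IsAffineOpen.fromSpec_top]
    exact Scheme.isoSpec_Spec_inv _
  have h3 : sectionConst X hV = (Scheme.ΓSpecIso (CommRingCat.of k)).inv ≫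
      (structMap X).appLE ⊤ V e := by
    apply Spec.map_injective
    rw [Spec.map_comp, map_sectionConst, ← h1, h2]
  have h4 : (sectionConst X hV).hom.IsStandardSmoothOfRelativeDimension 1 := by
    rw [h3]
    exact RingHom.isStandardSmoothOfRelativeDimension_respectsIso.2 _
      (Scheme.ΓSpecIso (CommRingCat.of k)).symm.commRingCatIsoToRingEquiv hsm
  obtain ⟨g, hg, hget⟩ := h4.exists_etale_mvPolynomial
  let e' : Polynomial k ≃ₐ[k] MvPolynomial (Fin 1) k := (MvPolynomial.uniqueAlgEquiv k (Fin 1)).symm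
  refine ⟨g.comp (e' : Polynomial k →+* MvPolynomial (Fin 1) k), ?_, ?_⟩
  · exact RingHom.Etale.respectsIso.2 _ e'.toRingEquiv hget
  · rw [← hg]
    refine RingHom.ext fun c => ?_
    change g (e' (algebraMap k _ c)) = g (algebraMap k _ c)
    rw [e'.commutes]

/-- The local rings of a curve: the local parameter is a polynomial in an étale coordinate. -/
lemma exists_local_parameter (x : X.left) :
    ∃ g : Polynomial k →+* X.left.presheaf.stalk x, g.comp Polynomial.C = (stalkConst X x).hom ∧
      IsDomain (X.left.presheaf.stalk x) ∧ IsNoetherianRing (X.left.presheaf.stalk x) ∧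
      g.EssFiniteType ∧ g.FormallyUnramified ∧ Function.Injective g ∧
      ∃ ϖ : Polynomial k, IsLocalRing.maximalIdeal (X.left.presheaf.stalk x) =
        Ideal.span {g ϖ} := by
  obtain ⟨V, hV, hxV, g, hg, hgC⟩ := exists_etale_chart X x
  let _ : Algebra (Polynomial k) Γ(X.left, V) := g.toAlgebra
  let _ : Algebra Γ(X.left, V) (X.left.presheaf.stalk x) :=
    X.left.presheaf.algebra_section_stalk ⟨x, hxV⟩
  let g' : Polynomial k →+* X.left.presheaf.stalk x :=
    (X.left.presheaf.germ V x hxV).hom.comp g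
  let _ : Algebra (Polynomial k) (X.left.presheaf.stalk x) := g'.toAlgebra
  have : IsScalarTower (Polynomial k) Γ(X.left, V) (X.left.presheaf.stalk x) :=
    .of_algebraMap_eq fun _ => rfl
  have : Algebra.Etale (Polynomial k) Γ(X.left, V) := hg
  have hloc := hV.isLocalization_stalk ⟨x, hxV⟩
  obtain ⟨h1, h2, h3, h4, h5, ϖ, h6⟩ := local_of_etale (k := k)
    (hV.primeIdealOf ⟨x, hxV⟩).asIdeal (X.left.presheaf.stalk x)
  refine ⟨g', ?_, h1, h2, h3, h4, h5, ϖ, h6⟩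
  rw [← sectionConst_germ X hV hxV, RingHom.comp_assoc, hgC]
  rfl

instance : IsIntegral X.left := by
  have : ∀ x : X.left, _root_.IsReduced (X.left.presheaf.stalk x) := fun x => by
    obtain ⟨g, _, h, _⟩ := exists_local_parameter X x
    infer_instance
  have : IsReduced X.left := isReduced_of_isReduced_stalk _
  exact isIntegral_of_irreducibleSpace_of_isReduced _

instance : Algebra k X.left.functionField := (stalkConst X (genericPoint X.left)).hom.toAlgebra

lemma algebraMap_functionField (c : k) :
    algebraMap k X.left.functionField c = stalkConst X (genericPoint X.left) c := rfl

lemma functionField_essFiniteType_and_trdeg :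
    Algebra.EssFiniteType k X.left.functionField ∧ Algebra.trdeg k X.left.functionField = 1 := by
  obtain ⟨g, hgC, _, _, h3, h4, h5, _⟩ := exists_local_parameter X (genericPoint X.left)
  let _ : Algebra (Polynomial k) X.left.functionField := g.toAlgebra
  have : Algebra.EssFiniteType (Polynomial k) X.left.functionField := h3
  have : Algebra.FormallyUnramified (Polynomial k) X.left.functionField := h4
  have : IsScalarTower k (Polynomial k) X.left.functionField :=
    .of_algebraMap_eq fun c => (RingHom.congr_fun hgC c).symm
  exact ⟨.comp k (Polynomial k) _, trdeg_eq_one_of_formallyUnramified h5⟩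

instance : Algebra.EssFiniteType k X.left.functionField :=
  (functionField_essFiniteType_and_trdeg X).1

/-- The constant field extension of the function field of a curve is a field. -/
lemma isField_tensor_functionField (k' : Type u) [Field k'] [Algebra k k'] [FiniteDimensional k k']
    [Algebra.IsSeparable k k'] : IsField (TensorProduct k X.left.functionField k') := by
  obtain ⟨V, hV, hxV, -⟩ := exists_etale_chart X (genericPoint X.left)
  have : Nonempty V := ⟨⟨_, hxV⟩⟩
  let _ : Algebra k Γ(X.left, V) := (sectionConst X hV).hom.toAlgebra
  have := functionField_isFractionRing_of_isAffineOpen X.left V hV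
  have : IsScalarTower k Γ(X.left, V) X.left.functionField :=
    .of_algebraMap_eq fun c => by
      rw [algebraMap_functionField, ← sectionConst_germ X hV hxV]
      rfl
  have := hX.geomIrreducible
  have : IsDomain Γ(X.left, V) := inferInstance
  have : Surjective (hV.fromSpec ≫ structMap X) := by
    have : Nonempty (Spec Γ(X.left, V)) := inferInstanceAs (Nonempty (PrimeSpectrum Γ(X.left, V)))
    exact ⟨fun y => ⟨Classical.arbitrary _, Subsingleton.elim (α := PrimeSpectrum k) _ _⟩⟩
  have hgi : GeometricallyIrreducible (Spec.map (CommRingCat.ofHom (algebraMap k Γ(X.left, V)))) := by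
    have : GeometricallyIrreducible (structMap X) := hX.geomIrreducible
    have h : GeometricallyIrreducible (hV.fromSpec ≫ structMap X) := inferInstance
    rw [← map_sectionConst] at h
    exact h
  exact isField_tensorProduct (S := Γ(X.left, V)) irreducibleSpace_tensorProduct

end Charts

end

noncomputable section

/-! ### The points of a curve and its function field -/

lemma exists_specMap_fromSpecStalk {X : Scheme.{u}} {W : CommRingCat.{u}} [IsLocalRing W]
    (l : Spec W ⟶ X) {x : X} (hx : l (IsLocalRing.closedPoint W) = x) :
    ∃ j : X.presheaf.stalk x ⟶ W, IsLocalHom j.hom ∧ Spec.map j ≫ X.fromSpecStalk x = l := by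
  subst hx
  exact ⟨Scheme.stalkClosedPointTo l, inferInstance, Scheme.Spec_stalkClosedPointTo_fromSpecStalk l⟩

lemma specMap_fromSpecStalk_injective {X : Scheme.{u}} {W : CommRingCat.{u}} {x : X}
    {j j' : X.presheaf.stalk x ⟶ W}
    (h : Spec.map j ≫ X.fromSpecStalk x = Spec.map j' ≫ X.fromSpecStalk x) : j = j' :=
  Spec.map_injective ((cancel_mono _).1 h)

section Model

variable {k : Type u} [Field k] (X : Over (Base k)) [hX : IsCurve X]

variable {X} in
/-- The morphism of schemes underlying a geometric point. -/
abbrev GeomPoint.hom (P : GeomPoint X) : Spec (CommRingCat.of (AlgebraicClosure k)) ⟶ X.left :=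
  P.left

variable {X} in
lemma GeomPoint.hom_structMap (P : GeomPoint X) :
    P.hom ≫ structMap X = Spec.map (CommRingCat.ofHom (algebraMap k (AlgebraicClosure k))) :=
  Over.w P

/-- Evaluation at a geometric point. -/
def evalAt (P : GeomPoint X) : X.left.presheaf.stalk P.toPoint ⟶
    CommRingCat.of (AlgebraicClosure k) :=
  Scheme.stalkClosedPointTo P.hom

variable {X} in
lemma map_evalAt (P : GeomPoint X) :
    Spec.map (evalAt X P) ≫ X.left.fromSpecStalk P.toPoint = P.hom :=
  Scheme.Spec_stalkClosedPointTo_fromSpecStalk _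

instance (P : GeomPoint X) : IsLocalHom (evalAt X P).hom :=
  Scheme.isLocalHom_stalkClosedPointTo' _

lemma stalkConst_evalAt (P : GeomPoint X) :
    stalkConst X P.toPoint ≫ evalAt X P =
      CommRingCat.ofHom (algebraMap k (AlgebraicClosure k)) := by
  apply Spec.map_injective
  rw [Spec.map_comp, map_stalkConst, ← Category.assoc, map_evalAt, GeomPoint.hom_structMap]

/-- The inclusion of a local ring in the function field. -/
abbrev stalkIncl (x : X.left) : X.left.presheaf.stalk x ⟶ X.left.functionField :=
  X.left.presheaf.stalkSpecializes (genericPoint_specializes x)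

lemma map_stalkIncl (x : X.left) : Spec.map (stalkIncl X x) ≫ X.left.fromSpecStalk x =
    X.left.fromSpecStalk (genericPoint X.left) :=
  Scheme.SpecMap_stalkSpecializes_fromSpecStalk _

lemma stalkIncl_injective (x : X.left) : Function.Injective (stalkIncl X x) :=
  IsFractionRing.injective (X.left.presheaf.stalk x) X.left.functionField

/-- The local rings at geometric points are discrete valuation rings. -/
lemma exists_uniformizer_stalk (P : GeomPoint X) : ∃ π : X.left.presheaf.stalk P.toPoint,
    evalAt X P π = 0 ∧ π ≠ 0 ∧ ∀ z : X.left.functionField, z ≠ 0 →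
      ∃ (n : ℤ) (u : (X.left.presheaf.stalk P.toPoint)ˣ),
        z = stalkIncl X P.toPoint u * stalkIncl X P.toPoint π ^ n := by
  obtain ⟨g, hgC, hdom, hnoeth, -, -, hinj, ϖ, hϖ⟩ := exists_local_parameter X P.toPoint
  have hmax : ∀ r, evalAt X P r = 0 ↔ r ∈ IsLocalRing.maximalIdeal _ := fun r => by
    rw [IsLocalRing.mem_maximalIdeal, mem_nonunits_iff,
      ← isUnit_map_iff (evalAt X P).hom, isUnit_iff_ne_zero, not_not]
  have hϖ0 : g ϖ ≠ 0 := by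
    intro h0
    -- the value of the coordinate at `P` is algebraic over `k`
    have h1 : IsAlgebraic k (evalAt X P (g Polynomial.X)) := Algebra.IsAlgebraic.isAlgebraic _
    obtain ⟨a, ha, ha0⟩ := h1
    have h2 : evalAt X P (g a) = 0 := by
      rw [← ha0]
      have h3 : ((evalAt X P).hom.comp g) = (Polynomial.aeval (R := k)
          (evalAt X P (g Polynomial.X)) : Polynomial k →+* AlgebraicClosure k) := by
        refine Polynomial.ringHom_ext (fun c => ?_) ?_
        · rw [RingHom.comp_apply, show g (Polynomial.C c) = stalkConst X P.toPoint c from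
            RingHom.congr_fun hgC c]
          rw [RingHom.coe_coe, Polynomial.aeval_C]
          exact congrArg (fun φ => φ.hom c) (stalkConst_evalAt X P)
        · rw [RingHom.coe_coe, Polynomial.aeval_X]
          rfl
      exact RingHom.congr_fun h3 a
    rw [hmax, hϖ, h0, Ideal.mem_span_singleton, zero_dvd_iff] at h2
    exact ha (hinj (by rw [h2, map_zero]))
  refine ⟨g ϖ, (hmax _).2 (by rw [hϖ]; exact Ideal.mem_span_singleton_self _), hϖ0, fun z hz => ?_⟩
  obtain ⟨a, b, hb, rfl⟩ := IsFractionRing.div_surjective (A := X.left.presheaf.stalk P.toPoint) z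
  have hb0 : b ≠ 0 := nonZeroDivisors.ne_zero hb
  have ha0 : a ≠ 0 := by rintro rfl; simp at hz
  obtain ⟨m, u, rfl⟩ := exists_eq_unit_mul_pow hϖ ha0
  obtain ⟨n, v, rfl⟩ := exists_eq_unit_mul_pow hϖ hb0
  refine ⟨m - n, u * v⁻¹, ?_⟩
  change stalkIncl X P.toPoint _ / stalkIncl X P.toPoint _ = _
  have hinc : stalkIncl X P.toPoint (g ϖ) ≠ 0 := fun h =>
    hϖ0 (stalkIncl_injective X _ (by rw [h, map_zero]))
  have hv : stalkIncl X P.toPoint v ≠ 0 := (v.isUnit.map (stalkIncl X P.toPoint).hom).ne_zero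
  have hv' : stalkIncl X P.toPoint ↑v⁻¹ = (stalkIncl X P.toPoint v)⁻¹ := by
    exact eq_inv_of_mul_eq_one_left (by rw [← map_mul, Units.inv_mul, map_one])
  rw [map_mul, map_mul, map_pow, map_pow, Units.val_mul, map_mul, hv', zpow_sub₀ hinc,
    zpow_natCast, zpow_natCast]
  field_simp

/-- By the valuative criterion of properness, a curve satisfies the axioms of `CurveModel`. -/
def curveModel : CurveModel k (AlgebraicClosure k) X.left.functionField where
  Pt := GeomPoint X
  R P := X.left.presheaf.stalk P.toPoint
  incl P := (stalkIncl X P.toPoint).hom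
  ev P := (evalAt X P).hom
  const P := (stalkConst X P.toPoint).hom
  incl_const P c := RingHom.congr_fun (congrArg CommRingCat.Hom.hom
    (stalkConst_stalkSpecializes X (genericPoint_specializes P.toPoint))) c
  ev_const P c := congrArg (fun φ => φ.hom c) (stalkConst_evalAt X P)
  incl_injective P := stalkIncl_injective X _
  exists_uniformizer P := exists_uniformizer_stalk X P
  exists_center W hW ι hι hιc := by
    let i : CommRingCat.of W ⟶ X.left.functionField := CommRingCat.ofHom W.subtype
    let c : CommRingCat.of k ⟶ CommRingCat.of W :=
      CommRingCat.ofHom ((algebraMap k X.left.functionField).codRestrict W.toSubring hW)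
    let ι' : CommRingCat.of W ⟶ CommRingCat.of (AlgebraicClosure k) := CommRingCat.ofHom ι
    have hci : c ≫ i = stalkConst X (genericPoint X.left) := rfl
    have hcι : c ≫ ι' = CommRingCat.ofHom (algebraMap k (AlgebraicClosure k)) :=
      CommRingCat.hom_ext (RingHom.ext hιc)
    have hproper : IsProper (structMap X) := hX.proper
    let sq : ValuativeCommSq (structMap X) :=
      { R := W
        K := X.left.functionField
        i₁ := X.left.fromSpecStalk (genericPoint X.left)
        i₂ := Spec.map c
        commSq := ⟨by
          rw [← map_stalkConst, ← hci, Spec.map_comp]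
          rfl⟩ }
    rw [IsProper.eq_valuativeCriterion] at hproper
    obtain ⟨l, hl1, hl2⟩ : ∃ l : Spec (CommRingCat.of W) ⟶ X.left,
        Spec.map i ≫ l = X.left.fromSpecStalk (genericPoint X.left) ∧
        l ≫ structMap X = Spec.map c := by
      obtain ⟨⟨l, hl1, hl2⟩⟩ := (hproper.1.1.1.existence sq).exists_lift
      exact ⟨l, hl1, hl2⟩
    let P : GeomPoint X := Over.homMk (Spec.map ι' ≫ l) (by
      change (Spec.map ι' ≫ l) ≫ structMap X = Spec.map _
      rw [Category.assoc, hl2, ← Spec.map_comp, hcι])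
    have hPl : P.hom = Spec.map ι' ≫ l := rfl
    have hPx : l (IsLocalRing.closedPoint W) = P.toPoint := by
      change _ = l (Spec.map ι' (IsLocalRing.closedPoint (AlgebraicClosure k)))
      exact congrArg l (IsLocalRing.comap_closedPoint ι).symm
    obtain ⟨j, -, hj⟩ := exists_specMap_fromSpecStalk (W := CommRingCat.of W) l hPx
    refine ⟨P, j.hom, fun r => ?_, fun r => ?_⟩
    · have : j ≫ i = stalkIncl X P.toPoint := specMap_fromSpecStalk_injective (by
        rw [Spec.map_comp, Category.assoc, hj, hl1, map_stalkIncl])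
      exact congrArg (fun φ => φ.hom r) this
    · have : j ≫ ι' = evalAt X P := specMap_fromSpecStalk_injective (by
        rw [Spec.map_comp, Category.assoc, hj, map_evalAt, hPl])
      exact congrArg (fun φ => φ.hom r) this
  center_unique W hW ι hιc P Q j j' hj hιj hj' hιj' := by
    let i : CommRingCat.of W ⟶ X.left.functionField := CommRingCat.ofHom W.subtype
    let ι' : CommRingCat.of W ⟶ CommRingCat.of (AlgebraicClosure k) := CommRingCat.ofHom ι
    let c : CommRingCat.of k ⟶ CommRingCat.of W :=
      CommRingCat.ofHom ((algebraMap k X.left.functionField).codRestrict W.toSubring hW)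
    have key : ∀ (P : GeomPoint X) (j : X.left.presheaf.stalk P.toPoint →+* W),
        (∀ r, (j r : X.left.functionField) = stalkIncl X P.toPoint r) →
        (∀ r, ι (j r) = evalAt X P r) → ∃ l : Spec (CommRingCat.of W) ⟶ X.left,
          Spec.map i ≫ l = X.left.fromSpecStalk (genericPoint X.left) ∧
          Spec.map ι' ≫ l = P.hom ∧ l ≫ structMap X = Spec.map c := by
      intro P j hj hιj
      have h1 : CommRingCat.ofHom j ≫ i = stalkIncl X P.toPoint :=
        CommRingCat.hom_ext (RingHom.ext hj)
      have h2 : CommRingCat.ofHom j ≫ ι' = evalAt X P := CommRingCat.hom_ext (RingHom.ext hιj)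
      refine ⟨Spec.map (CommRingCat.ofHom j) ≫ X.left.fromSpecStalk P.toPoint, ?_, ?_, ?_⟩
      · rw [← Category.assoc, ← Spec.map_comp, h1, map_stalkIncl]
      · rw [← Category.assoc, ← Spec.map_comp, h2, map_evalAt]
      · rw [Category.assoc, ← map_stalkConst, ← Spec.map_comp]
        congr 1
        refine CommRingCat.hom_ext (RingHom.ext fun a => Subtype.ext ?_)
        refine (hj _).trans ?_
        exact RingHom.congr_fun (congrArg CommRingCat.Hom.hom
          (stalkConst_stalkSpecializes X (genericPoint_specializes P.toPoint))) a
    obtain ⟨l, hl1, hl2, hl3⟩ := key P j hj hιj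
    obtain ⟨l', hl1', hl2', hl3'⟩ := key Q j' hj' hιj'
    have hproper : IsProper (structMap X) := hX.proper
    have hdom : IsDominant (Spec.map i) := by
      refine ⟨(PrimeSpectrum.denseRange_comap_iff_ker_le_nilRadical W.subtype).2 ?_⟩
      rw [(RingHom.injective_iff_ker_eq_bot _).1 Subtype.val_injective]
      exact bot_le
    have hll : l = l' := ext_of_isDominant_of_isSeparated (structMap X) (by rw [hl3, hl3'])
      (Spec.map i) (by rw [hl1, hl1'])
    have hPQ : P.hom = Q.hom := by rw [← hl2, hll, hl2']
    exact Over.OverMorphism.ext hPQ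

end Model

end

noncomputable section

/-! ### Dominant morphisms of curves and their function fields -/

lemma map_genericPoint_of_isDominant {X Y : Scheme.{u}} [IrreducibleSpace X] [IrreducibleSpace Y]
    (f : X ⟶ Y) [IsDominant f] : f (genericPoint X) = genericPoint Y := by
  have h := (genericPoint_spec X).image f.continuous
  rw [Set.image_univ, f.denseRange.closure_range] at h
  exact h.eq (genericPoint_spec Y)

section Dominant

variable {k : Type u} [Field k] {X X₀ : Over (Base k)} [hX : IsCurve X] [hX₀ : IsCurve X₀]

/-- The pullback of rational functions under a dominant morphism of curves. -/
def pullHom (f : X ⟶ X₀) [IsDominant f.left] : X₀.left.functionField ⟶ X.left.functionField :=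
  X₀.left.presheaf.stalkSpecializes
    (specializes_of_eq (map_genericPoint_of_isDominant f.left)) ≫
    f.left.stalkMap (genericPoint X.left)

lemma map_pullHom (f : X ⟶ X₀) [IsDominant f.left] :
    Spec.map (pullHom f) ≫ X₀.left.fromSpecStalk (genericPoint X₀.left) =
      X.left.fromSpecStalk (genericPoint X.left) ≫ f.left := by
  rw [pullHom, Spec.map_comp, Category.assoc]
  rw [Scheme.SpecMap_stalkSpecializes_fromSpecStalk, Scheme.SpecMap_stalkMap_fromSpecStalk]

lemma hom_structMap (f : X ⟶ X₀) : f.left ≫ structMap X₀ = structMap X := Over.w f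

lemma stalkConst_pullHom (f : X ⟶ X₀) [IsDominant f.left] :
    stalkConst X₀ (genericPoint X₀.left) ≫ pullHom f = stalkConst X (genericPoint X.left) := by
  apply Spec.map_injective
  rw [Spec.map_comp, map_stalkConst, ← Category.assoc, map_pullHom, Category.assoc,
    hom_structMap, map_stalkConst]

lemma onPoints_hom (f : X ⟶ X₀) (P : GeomPoint X) : (onPoints f P).hom = P.hom ≫ f.left := rfl

/-- The pullback of germs at a geometric point. -/
def pullAt (f : X ⟶ X₀) (P : GeomPoint X) :
    X₀.left.presheaf.stalk (onPoints f P).toPoint ⟶ X.left.presheaf.stalk P.toPoint :=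
  f.left.stalkMap P.toPoint

lemma map_pullAt (f : X ⟶ X₀) (P : GeomPoint X) :
    Spec.map (pullAt f P) ≫ X₀.left.fromSpecStalk (onPoints f P).toPoint =
      X.left.fromSpecStalk P.toPoint ≫ f.left :=
  Scheme.SpecMap_stalkMap_fromSpecStalk _

lemma pullAt_stalkIncl (f : X ⟶ X₀) [IsDominant f.left] (P : GeomPoint X) :
    pullAt f P ≫ stalkIncl X P.toPoint = stalkIncl X₀ (onPoints f P).toPoint ≫ pullHom f := by
  refine specMap_fromSpecStalk_injective ?_
  rw [Spec.map_comp, Spec.map_comp, Category.assoc, Category.assoc, map_pullAt, map_stalkIncl,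
    map_pullHom, ← Category.assoc, map_stalkIncl]

lemma pullAt_evalAt (f : X ⟶ X₀) (P : GeomPoint X) :
    pullAt f P ≫ evalAt X P = evalAt X₀ (onPoints f P) := by
  refine specMap_fromSpecStalk_injective ?_
  rw [Spec.map_comp, Category.assoc, map_pullAt, map_evalAt, onPoints_hom, ← Category.assoc,
    map_evalAt]

/-- The morphism of `CurveModel`s which a dominant morphism of curves induces. -/
def curveModelHom (f : X ⟶ X₀) [IsDominant f.left] : (curveModel X).Hom (curveModel X₀) where
  pull := { (pullHom f).hom with
    commutes' := fun c => congrArg (fun φ => φ.hom c) (stalkConst_pullHom f) }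
  pt := onPoints f
  loc P := (pullAt f P).hom
  incl_loc P r := congrArg (fun φ => φ.hom r) (pullAt_stalkIncl f P)
  ev_loc P r := congrArg (fun φ => φ.hom r) (pullAt_evalAt f P)

lemma stalkSpecializes_bijective {X : Scheme.{u}} {x y : X} (h : x = y) :
    Function.Bijective (X.presheaf.stalkSpecializes (specializes_of_eq h)) := by
  subst h
  rw [TopCat.Presheaf.stalkSpecializes_refl]
  exact Function.bijective_id

/-- The degree of a dominant morphism of curves is the degree of the extension of function
fields. -/
lemma finrank_pull_eq_residueDegree (f : X ⟶ X₀) [IsDominant f.left] :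
    @Module.finrank X₀.left.functionField X.left.functionField _ _
      ((curveModelHom f).pull : X₀.left.functionField →+* X.left.functionField).toAlgebra.toModule =
      f.left.residueDegree (genericPoint X.left) := by
  set η := genericPoint X.left
  let _ : Algebra X₀.left.functionField X.left.functionField := (pullHom f).hom.toAlgebra
  let _ : Algebra (X₀.left.residueField (f.left η)) (X.left.residueField η) :=
    (f.left.residueFieldMap η).hom.toAlgebra
  let i : X₀.left.functionField ⟶ X₀.left.residueField (f.left η) :=
    X₀.left.presheaf.stalkSpecializes
      (specializes_of_eq (map_genericPoint_of_isDominant f.left)) ≫ X₀.left.residue (f.left η)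
  let j : X.left.functionField ⟶ X.left.residueField η := X.left.residue η
  have hi : Function.Bijective i.hom := by
    refine ⟨i.hom.injective, ?_⟩
    exact (X₀.left.residue_surjective _).comp (stalkSpecializes_bijective
      (map_genericPoint_of_isDominant f.left)).2
  have hj : Function.Bijective j.hom := ⟨j.hom.injective, X.left.residue_surjective _⟩
  refine Algebra.finrank_eq_of_equiv_equiv (RingEquiv.ofBijective i.hom hi)
    (RingEquiv.ofBijective j.hom hj) ?_
  have : i ≫ f.left.residueFieldMap η = pullHom f ≫ j := by
    rw [Category.assoc, Scheme.residue_residueFieldMap, pullHom, Category.assoc]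
  exact congrArg CommRingCat.Hom.hom this

lemma finite_pull (f : X ⟶ X₀) [IsDominant f.left]
    (h : 0 < f.left.residueDegree (genericPoint X.left)) :
    ((curveModelHom f).pull : X₀.left.functionField →+* X.left.functionField).Finite := by
  rw [← finrank_pull_eq_residueDegree] at h
  let _ := ((curveModelHom f).pull : X₀.left.functionField →+* X.left.functionField).toAlgebra
  exact Module.finite_of_finrank_pos h

lemma maximalIdeal_stalk_eq_span {P : GeomPoint X} {π : X.left.presheaf.stalk P.toPoint}
    (hπ : (curveModel X).IsUniformizer P π) :
    IsLocalRing.maximalIdeal (X.left.presheaf.stalk P.toPoint) = Ideal.span {π} := by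
  have hmax : ∀ r, r ∈ IsLocalRing.maximalIdeal _ ↔ evalAt X P r = 0 := fun r => by
    rw [IsLocalRing.mem_maximalIdeal, mem_nonunits_iff,
      ← isUnit_map_iff (evalAt X P).hom, isUnit_iff_ne_zero, not_not]
  ext r
  rw [hmax, Ideal.mem_span_singleton]
  refine ⟨fun h => hπ.dvd_of_ev_eq_zero h, ?_⟩
  rintro ⟨a, rfl⟩
  rw [map_mul, show evalAt X P π = 0 from hπ.1, zero_mul]

lemma ramificationIdx'_eq_of_uniformizer {A B : Type*} [CommRing A] [CommRing B] [IsDomain B]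
    (φ : A →+* B) {p : Ideal A} {q : Ideal B} {π₀ : A} {π : B} (hp : p = Ideal.span {π₀})
    (hq : q = Ideal.span {π}) (hπ : π ≠ 0) (hπu : ¬ IsUnit π) {u : Bˣ} {n : ℕ}
    (h : φ π₀ = u * π ^ n) :
    letI : Algebra A B := φ.toAlgebra
    Ideal.ramificationIdx' p q = n := by
  let _ : Algebra A B := φ.toAlgebra
  have hmap : Ideal.map (algebraMap A B) p = Ideal.span {π ^ n} := by
    rw [hp, Ideal.map_span, Set.image_singleton]
    change Ideal.span {φ π₀} = _
    rw [h, mul_comm, Ideal.span_singleton_mul_right_unit u.isUnit]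
  refine Ideal.ramificationIdx'_spec ?_ ?_
  · rw [hmap, hq, Ideal.span_singleton_pow]
  · rw [hmap, hq, Ideal.span_singleton_pow, Ideal.span_singleton_le_span_singleton,
      pow_dvd_pow_iff hπ hπu]
    omega

/-- The ramification index, as defined by powers of the maximal ideal, is the order of the pullback
of a uniformizer. -/
lemma hasRamIndex_ramIndex (f : X ⟶ X₀) [IsDominant f.left] (P : GeomPoint X) :
    (curveModelHom f).HasRamIndex P (ramIndex f P) := by
  intro (π : X.left.presheaf.stalk P.toPoint)
    (π₀ : X₀.left.presheaf.stalk (onPoints f P).toPoint) hπ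
    (hπ₀ : (curveModel X₀).IsUniformizer (onPoints f P) π₀)
  have hinj : Function.Injective (pullAt f P) := by
    have h := ((pullHom f).hom.injective).comp (stalkIncl_injective X₀ (onPoints f P).toPoint)
    refine Function.Injective.of_comp (f := stalkIncl X P.toPoint) ?_
    convert h
    exact congrArg (fun φ => φ.hom.toFun) (pullAt_stalkIncl f P)
  have h0 : pullAt f P π₀ ≠ 0 := fun h => hπ₀.2.1 (hinj (by rw [h]; exact (map_zero _).symm))
  obtain ⟨g, -, hdom, hnoeth, -⟩ := exists_local_parameter X P.toPoint
  have hspan := maximalIdeal_stalk_eq_span hπ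
  have hπu : ¬ IsUnit π := fun hu => (hu.map (evalAt X P).hom).ne_zero hπ.1
  obtain ⟨n, u, hn⟩ := exists_eq_unit_mul_pow hspan h0
  have hram : ramIndex f P = n := ramificationIdx'_eq_of_uniformizer (pullAt f P).hom
    (maximalIdeal_stalk_eq_span hπ₀) hspan hπ.2.1 hπu hn
  rw [hram]
  exact ⟨u, hn⟩

end Dominant

end

noncomputable section

/-! ### Fields of definition and constant field extensions -/

lemma exists_intermediateField_of_essFiniteType {k B Ω : Type*} [Field k] [CommRing B]
    [Algebra k B] [Algebra.EssFiniteType k B] [Field Ω] [Algebra k Ω] [Algebra.IsAlgebraic k Ω]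
    (φ : B →ₐ[k] Ω) : ∃ E : IntermediateField k Ω, FiniteDimensional k E ∧ ∀ b, φ b ∈ E := by
  set s := Algebra.EssFiniteType.finset k B
  let E := IntermediateField.adjoin k (φ '' s)
  have : Finite (φ '' (s : Set B)) := (s.finite_toSet.image φ).to_subtype
  refine ⟨E, IntermediateField.finiteDimensional_adjoin fun x _ =>
    Algebra.IsIntegral.isIntegral x, fun b => ?_⟩
  have hsub : ∀ a ∈ Algebra.EssFiniteType.subalgebra k B, φ a ∈ E := fun a ha => by
    have h : φ a ∈ (Algebra.adjoin k (s : Set B)).map φ := ⟨a, ha, rfl⟩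
    rw [AlgHom.map_adjoin] at h
    exact IntermediateField.algebra_adjoin_le_adjoin k _ h
  obtain ⟨⟨a, t⟩, hat⟩ := IsLocalization.surj (Algebra.EssFiniteType.submonoid k B) b
  have ht : φ (t : Algebra.EssFiniteType.subalgebra k B) ≠ 0 :=
    ((IsLocalization.map_units B t).map φ).ne_zero
  have : φ b = φ a / φ (t : Algebra.EssFiniteType.subalgebra k B) := by
    rw [eq_div_iff ht]
    exact (map_mul φ _ _).symm.trans (congrArg φ hat)
  rw [this]
  exact div_mem (hsub _ a.2) (hsub _ t.1.2)

section Curve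

variable {k : Type u} [Field k] (X : Over (Base k)) [hX : IsCurve X]

/-- Finitely many geometric points are defined over a common finite extension. -/
lemma exists_intermediateField_isRational {S : Set (GeomPoint X)} (hS : S.Finite) :
    ∃ E : IntermediateField k (AlgebraicClosure k), FiniteDimensional k E ∧
      ∀ P ∈ S, (curveModel X).IsRational P E := by
  have h1 : ∀ P : GeomPoint X, ∃ E : IntermediateField k (AlgebraicClosure k),
      FiniteDimensional k E ∧ ∀ b, evalAt X P b ∈ E := fun P => by
    obtain ⟨g, hgC, -, -, h3, -⟩ := exists_local_parameter X P.toPoint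
    let _ : Algebra (Polynomial k) (X.left.presheaf.stalk P.toPoint) := g.toAlgebra
    let _ : Algebra k (X.left.presheaf.stalk P.toPoint) := (stalkConst X P.toPoint).hom.toAlgebra
    have : Algebra.EssFiniteType (Polynomial k) (X.left.presheaf.stalk P.toPoint) := h3
    have : IsScalarTower k (Polynomial k) (X.left.presheaf.stalk P.toPoint) :=
      .of_algebraMap_eq fun c => (RingHom.congr_fun hgC c).symm
    have : Algebra.EssFiniteType k (X.left.presheaf.stalk P.toPoint) := .comp k (Polynomial k) _
    let φ : X.left.presheaf.stalk P.toPoint →ₐ[k] AlgebraicClosure k :=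
      { (evalAt X P).hom with
        commutes' := fun c => congrArg (fun φ => φ.hom c) (stalkConst_evalAt X P) }
    exact exists_intermediateField_of_essFiniteType φ
  choose E hE hEP using h1
  have := hS.to_subtype
  refine ⟨⨆ P : S, E P, IntermediateField.finiteDimensional_iSup_of_finite, fun P hP b => ?_⟩
  exact ⟨⟨evalAt X P b, le_iSup (fun P : S => E P) ⟨P, hP⟩ (hEP P b)⟩, rfl⟩

/-- The constant field extension of the function field of a curve. -/
lemma exists_constantFieldExtension (k' : Type u) [Field k'] [Algebra k k'] [FiniteDimensional k k']
    [Algebra.IsSeparable k k'] :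
    ∃ (K' : Type u) (_ : Field K') (_ : Algebra X.left.functionField K') (_ : Algebra k' K')
      (_ : Algebra k K') (_ : IsScalarTower k X.left.functionField K')
      (_ : IsScalarTower k k' K'),
      Algebra.IsPushout k k' X.left.functionField K' ∧ IsFunctionField k' K' := by
  let _ : Field (TensorProduct k X.left.functionField k') :=
    (isField_tensor_functionField X k').toField
  let _ : Algebra k' (TensorProduct k X.left.functionField k') := Algebra.TensorProduct.rightAlgebra
  have hpush : Algebra.IsPushout k k' X.left.functionField
    (TensorProduct k X.left.functionField k') := inferInstance
  exact ⟨TensorProduct k X.left.functionField k', inferInstance, inferInstance, inferInstance,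
    inferInstance, inferInstance, inferInstance, hpush,
    isFunctionField_of_isPushout (functionField_essFiniteType_and_trdeg X).2⟩

end Curve

section Main

variable {k : Type u} [Field k] [Finite k] {X X₀ : Over (Base k)} [hX : IsCurve X]
  [hX₀ : IsCurve X₀]

/-- In the presence of `S` and `T`, each point over a field of a high floor of the tower, whose
coordinates are generic points of the curve, has two equal coordinates. -/
theorem exists_forall_chain_curveModelHom_eq {f g : X ⟶ X₀} [IsDominant f.left]
    [IsDominant g.left] {d : ℕ} (hd : 0 < d)
    (hf : f.left.residueDegree (genericPoint X.left) = d)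
    (hg : g.left.residueDegree (genericPoint X.left) = d)
    {S T : Set (GeomPoint X)} (hSne : S.Nonempty) (hSfin : S.Finite) (hS : IsComplete f g S)
    (hfg : onPoints f '' S = onPoints g '' S)
    (hD : ∀ P ∈ S, ramIndex f P = ramIndex g P)
    (hTne : T.Nonempty) (hT : IsRegularSet (geomGraph f g) d T) (hTS : Disjoint T S) :
    ∃ N : ℕ, ∀ (L : Type u) [Field L] [Algebra k L] [IsAlgClosed L]
      (x : ℕ → X.left.functionField →ₐ[k] L),
      (∀ i < N, (x i).comp (curveModelHom f).pull = (x (i + 1)).comp (curveModelHom g).pull) →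
      ∃ i j, i < j ∧ j ≤ N ∧ x i = x j := by
  obtain ⟨E, hE, hrat⟩ := exists_intermediateField_isRational X (hSfin.union hT.1)
  have : Finite E := Module.finite_of_finite k
  obtain ⟨K', _, _, _, _, _, _, hK, _⟩ := exists_constantFieldExtension X E
  obtain ⟨K₀', _, _, _, _, _, _, hK₀, _⟩ := exists_constantFieldExtension X₀ E
  have hext : ∀ x : X₀.left.functionField →ₐ[k] X.left.functionField,
      ∃ x' : K₀' →ₐ[E] K', ∀ a, x' (algebraMap _ K₀' a) = algebraMap _ K' (x a) := fun x =>
    ⟨extendHom K₀' ((IsScalarTower.toAlgHom k X.left.functionField K').comp x),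
      fun a => extendHom_algebraMap _ a⟩
  obtain ⟨f', hf'⟩ := hext (curveModelHom f).pull
  obtain ⟨g', hg'⟩ := hext (curveModelHom g).pull
  obtain ⟨hffin, hfd⟩ := finite_of_isPushout _ f' hf' (finite_pull f (hf ▸ hd))
  obtain ⟨hgfin, hgd⟩ := finite_of_isPushout _ g' hg' (finite_pull g (hg ▸ hd))
  rw [finrank_pull_eq_residueDegree, hf] at hfd
  rw [finrank_pull_eq_residueDegree, hg] at hgd
  obtain ⟨ψ, hψ, hψfg⟩ := CurveModel.exists_transcendental_pullback_eq (M := curveModel X)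
    (M₀ := curveModel X₀) (f := curveModelHom f) (g := curveModelHom g)
    hf' hg' hffin hgfin hd hfd hgd hSfin hSne hT.1 hTne hTS
    (fun P hP => hrat P (.inl hP)) (fun P hP => hrat P (.inr hP)) hfg
    (fun P hP => hS.2 hP) (fun P hP => hS.1 hP)
    (fun P hP => ⟨ramIndex f P, hasRamIndex_ramIndex f P, hD P hP ▸ hasRamIndex_ramIndex g P⟩)
    (fun P hP => (hT.2 P hP).1) (fun P hP => (hT.2 P hP).2)
  obtain ⟨N, hN⟩ := exists_forall_chain_eq hf' hg' hψ hψfg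
  refine ⟨N, fun L _ _ _ x hx => ?_⟩
  let i : E →ₐ[k] L := IsAlgClosed.lift
  let _ : Algebra E L := (i : E →+* L).toAlgebra
  have : IsScalarTower k E L := .of_algebraMap_eq fun c => (i.commutes c).symm
  exact hN L x hx

end Main

end

noncomputable section

/-! ### The floors of the tower -/

/-- The locus where two morphisms to a separated scheme agree is closed. If it is dense, the
morphisms agree on all reduced schemes mapping to the source, which itself need not be reduced. -/
lemma comp_eq_comp_of_isDominant {B : Scheme.{u}} {X Y Z : Over B} [IsSeparated X.hom]
    {p q : Y ⟶ X} {W : Scheme.{u}} (ℓ : W ⟶ Y.left) [IsDominant ℓ]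
    (h : ℓ ≫ p.left = ℓ ≫ q.left) (Q : Z ⟶ Y) [IsReduced Z.left] : Q ≫ p = Q ≫ q := by
  let ℓ' : Over.mk (ℓ ≫ Y.hom) ⟶ Y := Over.homMk ℓ
  have : IsDominant (equalizer.ι p q).left := by
    apply +allowSynthFailures IsDominant.of_comp (equalizer.lift ℓ' ?_).left
    · rwa [← Over.comp_left, equalizer.lift_ι]
    · ext1; exact h
  have : Surjective (equalizer.ι p q).left :=
    surjective_of_isDominant_of_isClosed_range _ (Scheme.Hom.isClosedEmbedding _).isClosed_range
  let s := pullback.snd (equalizer.ι p q).left Q.left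
  have : IsIso s := isIso_of_isClosedImmersion_of_surjective s
  ext1
  rw [← cancel_epi s]
  change s ≫ Q.left ≫ p.left = s ≫ Q.left ≫ q.left
  rw [← pullback.condition_assoc, ← pullback.condition_assoc, ← Over.comp_left, ← Over.comp_left,
    equalizer.condition]

lemma surjective_pullback_fst_left {B : Scheme.{u}} {X Y Z : Over B} (f : X ⟶ Z) (g : Y ⟶ Z)
    [hg : Surjective g.left] : Surjective (pullback.fst f g).left := by
  have h := (IsPullback.of_hasPullback f g).map (Over.forget B)
  exact MorphismProperty.of_isPullback (P := @Surjective) h.flip hg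

lemma surjective_pullback_snd_left {B : Scheme.{u}} {X Y Z : Over B} (f : X ⟶ Z) (g : Y ⟶ Z)
    [hf : Surjective f.left] : Surjective (pullback.snd f g).left := by
  have h := (IsPullback.of_hasPullback f g).map (Over.forget B)
  exact MorphismProperty.of_isPullback (P := @Surjective) h hf

section Floor

variable {k : Type u} [Field k] {X X₀ : Over (Base k)} (f g : X ⟶ X₀)

/-- The projection `(P₁, …, Pₙ₊₂) ↦ (P₁, …, Pₙ₊₁)` between consecutive floors. -/
def floorFst (n : ℕ) : floor f g (n + 1) ⟶ floor f g n :=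
  pullback.fst ((towerAux f g n).2 ≫ f) g

/-- The last coordinate on a floor. -/
def floorLast (n : ℕ) : floor f g n ⟶ X := (towerAux f g n).2

lemma floorFst_comp (n : ℕ) :
    floorFst f g n ≫ floorLast f g n ≫ f = floorLast f g (n + 1) ≫ g :=
  pullback.condition

lemma exists_floor_lift {Z : Over (Base k)} {n : ℕ} {a : Z ⟶ floor f g n} {b : Z ⟶ X}
    (h : a ≫ floorLast f g n ≫ f = b ≫ g) :
    ∃ l : Z ⟶ floor f g (n + 1), l ≫ floorFst f g n = a ∧ l ≫ floorLast f g (n + 1) = b :=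
  ⟨pullback.lift a b h, pullback.lift_fst _ _ _, pullback.lift_snd _ _ _⟩

lemma surjective_floorFst [Surjective g.left] (n : ℕ) : Surjective (floorFst f g n).left :=
  surjective_pullback_fst_left _ g

lemma surjective_floorLast [Surjective f.left] (n : ℕ) : Surjective (floorLast f g n).left := by
  induction n with
  | zero => exact inferInstanceAs (Surjective (𝟙 X.left))
  | succ n ih =>
    have : Surjective ((floorLast f g n) ≫ f).left := by
      rw [Over.comp_left]
      infer_instance
    exact surjective_pullback_snd_left (floorLast f g n ≫ f) g

/-- The projection `(P₁, …, Pₙ₊₁) ↦ Pᵢ₊₁` from the floor with index `n`, for `i ≤ n`. -/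
def floorProj : ∀ n : ℕ, ℕ → (floor f g n ⟶ X)
  | 0, _ => floorLast f g 0
  | n + 1, i => if i = n + 1 then floorLast f g (n + 1) else floorFst f g n ≫ floorProj n i

lemma floorProj_self (n : ℕ) : floorProj f g n n = floorLast f g n := by
  cases n with
  | zero => rfl
  | succ n => rw [floorProj, if_pos rfl]

lemma floorProj_succ_of_le {n i : ℕ} (h : i ≤ n) :
    floorProj f g (n + 1) i = floorFst f g n ≫ floorProj f g n i := by
  rw [floorProj, if_neg (by omega)]

lemma floorProj_comp {n i : ℕ} (h : i < n) :
    floorProj f g n i ≫ f = floorProj f g n (i + 1) ≫ g := by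
  induction n with
  | zero => omega
  | succ n ih =>
    rw [floorProj_succ_of_le f g (by omega), Category.assoc]
    rcases (Nat.lt_succ_iff.1 h).lt_or_eq with h' | rfl
    · rw [ih h', floorProj_succ_of_le f g (by omega), Category.assoc]
    · rw [floorProj_self, floorProj_self, floorFst_comp]

lemma surjective_floorProj [Surjective f.left] [Surjective g.left] (n i : ℕ) :
    Surjective (floorProj f g n i).left := by
  induction n with
  | zero => exact surjective_floorLast f g 0
  | succ n ih =>
    have := surjective_floorFst f g n
    rw [floorProj]
    split_ifs
    · exact surjective_floorLast f g (n + 1)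
    · rw [Over.comp_left]
      infer_instance

/-- A path in the geometric graph is a geometric point of a floor of the tower. -/
lemma exists_geomPoint_floor {P : ℕ → GeomPoint X}
    (hP : ∀ i, (geomGraph f g).Adj (P i) (P (i + 1))) (n : ℕ) :
    ∃ Q : GeomPoint (floor f g n), ∀ i ≤ n, Q ≫ floorProj f g n i = P i := by
  induction n with
  | zero =>
    refine ⟨P 0, fun i hi => ?_⟩
    obtain rfl : i = 0 := by omega
    exact Category.comp_id _
  | succ n ih =>
    obtain ⟨Q, hQ⟩ := ih
    obtain ⟨l, hl1, hl2⟩ := exists_floor_lift f g (a := Q) (b := P (n + 1)) (by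
      rw [← floorProj_self, ← Category.assoc, hQ n le_rfl]
      exact hP n)
    refine ⟨l, fun i hi => ?_⟩
    rcases hi.lt_or_eq with h | rfl
    · rw [floorProj_succ_of_le f g (by omega), ← Category.assoc, hl1, hQ i (by omega)]
    · rw [floorProj_self, hl2]

end Floor

/-! ### Repetitions of coordinates -/

section Generic

variable {k : Type u} [Field k] {X X₀ : Over (Base k)} [hX : IsCurve X] [hX₀ : IsCurve X₀]
  (f g : X ⟶ X₀)

lemma surjective_left_of_isDominant [IsDominant f.left] :
    Surjective f.left := by
  have := hX₀.proper
  have : IsProper (f.left ≫ X₀.hom) := by rw [Over.w]; exact hX.proper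
  have : IsProper f.left := .of_comp f.left X₀.hom
  exact surjective_of_isDominant_of_isClosed_range _ f.left.isClosedMap.isClosed_range

lemma exists_specHom_genericPoint (Y : Scheme.{u}) [IrreducibleSpace Y] :
    ∃ (L : Type u) (_ : Field L) (_ : IsAlgClosed L) (ℓ : Spec (CommRingCat.of L) ⟶ Y),
      ∀ z, ℓ z = genericPoint Y := by
  have h : ∀ (F : Type u) [Field F], ∃ (L : Type u) (_ : Field L) (_ : IsAlgClosed L),
      Nonempty (F →+* L) := fun F _ =>
    ⟨AlgebraicClosure F, inferInstance, inferInstance, ⟨algebraMap F _⟩⟩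
  obtain ⟨L, _, hL, ⟨i⟩⟩ := h (Y.residueField (genericPoint Y))
  let j : Y.residueField (genericPoint Y) ⟶ CommRingCat.of L := CommRingCat.ofHom i
  refine ⟨L, _, hL, Spec.map j ≫ Y.fromSpecResidueField (genericPoint Y), fun z => ?_⟩
  rw [Scheme.Hom.comp_apply]
  exact Scheme.fromSpecResidueField_apply _ (Spec.map j z)

/-- If all chains of homomorphisms from the function field have repetitions, this applies to the
generic point of an irreducible scheme `Y` of chains of points, and so two of its coordinates
agree. -/
theorem exists_comp_eq_of_chain [IsDominant f.left] [IsDominant g.left] {N : ℕ}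
    (hN : ∀ (L : Type u) [Field L] [Algebra k L] [IsAlgClosed L]
      (x : ℕ → X.left.functionField →ₐ[k] L),
      (∀ i < N, (x i).comp (curveModelHom f).pull = (x (i + 1)).comp (curveModelHom g).pull) →
      ∃ i j, i < j ∧ j ≤ N ∧ x i = x j)
    {Y : Over (Base k)} [IrreducibleSpace Y.left] (p : ℕ → (Y ⟶ X))
    (hp : ∀ i, IsDominant (p i).left) (hpc : ∀ i < N, p i ≫ f = p (i + 1) ≫ g) :
    ∃ i j, i < j ∧ j ≤ N ∧ ∀ Q : GeomPoint Y, Q ≫ p i = Q ≫ p j := by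
  obtain ⟨L, _, _, ℓ, hℓη⟩ := exists_specHom_genericPoint Y.left
  have hdom : IsDominant ℓ := by
    refine ⟨?_⟩
    rw [denseRange_iff_closure_range]
    refine Set.eq_univ_of_subset ?_ (genericPoint_closure (α := Y.left))
    refine closure_mono ?_
    rw [Set.singleton_subset_iff]
    exact ⟨IsLocalRing.closedPoint L, hℓη _⟩
  let c : CommRingCat.of k ⟶ CommRingCat.of L := Spec.preimage (ℓ ≫ structMap Y)
  have hc : Spec.map c = ℓ ≫ structMap Y := Spec.map_preimage _
  let _ : Algebra k L := c.hom.toAlgebra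
  have hj : ∀ i, ∃ j : X.left.functionField ⟶ CommRingCat.of L,
      Spec.map j ≫ X.left.fromSpecStalk (genericPoint X.left) =
        ℓ ≫ (p i).left := by
    intro i
    obtain ⟨j, -, hj⟩ := exists_specMap_fromSpecStalk (W := CommRingCat.of L)
      (ℓ ≫ (p i).left) (x := genericPoint X.left) (by
        refine (congrArg (p i).left (hℓη _)).trans ?_
        exact map_genericPoint_of_isDominant _)
    exact ⟨j, hj⟩
  choose j hj using hj
  have hjc : ∀ i, stalkConst X (genericPoint X.left) ≫ j i = c := fun i => by
    apply Spec.map_injective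
    rw [Spec.map_comp, map_stalkConst, ← Category.assoc, hj, Category.assoc, hc]
    exact congrArg (ℓ ≫ ·) (Over.w (p i))
  obtain ⟨i, i', hlt, hle, hii⟩ := hN L
    (fun i => { (j i).hom with commutes' := fun a => congrArg (fun φ => φ.hom a) (hjc i) }) (by
      intro i hi
      have h : pullHom f ≫ j i = pullHom g ≫ j (i + 1) := by
        refine specMap_fromSpecStalk_injective ?_
        rw [Spec.map_comp, Spec.map_comp, Category.assoc, Category.assoc, map_pullHom, map_pullHom,
          ← Category.assoc, ← Category.assoc, hj, hj, Category.assoc, Category.assoc,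
          ← Over.comp_left, ← Over.comp_left, hpc i hi]
      exact AlgHom.ext fun a => congrArg (fun φ => φ.hom a) h)
  have hjj : j i = j i' := CommRingCat.hom_ext (RingHom.ext fun a => DFunLike.congr_fun hii a)
  have := hX.proper
  refine ⟨i, i', hlt, hle, fun Q => ?_⟩
  have : IsReduced (geomBase k).left :=
    inferInstanceAs (IsReduced (Spec (CommRingCat.of (AlgebraicClosure k))))
  exact comp_eq_comp_of_isDominant ℓ (by rw [← hj, ← hj, hjj]) Q

end Generic

/-! ### Paths in regular graphs -/

/-- In a `d`-regular set with `d ≥ 2` there are paths which do not return after a given time to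
a given position. -/
lemma exists_path_ne {V : Type*} {G : Digraph V} {d : ℕ} (hd : 2 ≤ d) {T : Set V}
    (hT : IsRegularSet G d T) (hTne : T.Nonempty) {i j : ℕ} (hij : i < j) :
    ∃ P : ℕ → V, (∀ n, G.Adj (P n) (P (n + 1))) ∧ P i ≠ P j := by
  have hex : ∀ P : T, ∀ R : V, ∃ Q : T, G.Adj P Q ∧ (Q : V) ≠ R := fun P R => by
    have h : 1 < {Q ∈ T | G.Adj P Q}.ncard := by rw [(hT.2 P P.2).1]; omega
    obtain ⟨Q, ⟨hQ, hPQ⟩, hne⟩ := Set.exists_ne_of_one_lt_ncard h R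
    exact ⟨⟨Q, hQ⟩, hPQ, hne⟩
  choose s hs hsne using hex
  obtain ⟨P₀, hP₀⟩ := hTne
  -- an arbitrary path, left just before time `j`
  let q : ℕ → T := fun n => n.rec ⟨P₀, hP₀⟩ fun _ P => s P P
  let r : ℕ → T := fun n => n.rec (s (q (j - 1)) (q i).1) fun _ P => s P P
  refine ⟨fun n => (if n < j then q n else r (n - j) : T), fun n => ?_, ?_⟩
  · rcases lt_trichotomy (n + 1) j with h | h | h
    · simp only [if_pos h, if_pos (show n < j by omega)]
      exact hs _ _
    · simp only [if_pos (show n < j by omega), h, lt_irrefl, if_false, Nat.sub_self]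
      obtain rfl : n = j - 1 := by omega
      exact hs _ _
    · simp only [if_neg h.not_gt, if_neg (show ¬ n < j by omega)]
      rw [show n + 1 - j = n - j + 1 by omega]
      exact hs _ _
  · simp only [if_pos hij, lt_irrefl, if_false, Nat.sub_self]
    exact (hsne _ _).symm

end

end RecursiveTower

theorem mainTheorem2 {k : Type u} [Field k] [Finite k]
    (X X₀ : CategoryTheory.Over (RecursiveTower.Base k))
    [RecursiveTower.IsCurve X] [RecursiveTower.IsCurve X₀]
    (f g : X ⟶ X₀) (d : ℕ) (hd : 2 ≤ d)
    (hf : RecursiveTower.HasDegree f d) (hg : RecursiveTower.HasDegree g d)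
    (hirr : RecursiveTower.IsIrreducibleTower f g)
    (S : Set (RecursiveTower.GeomPoint X)) (S₀ : Set (RecursiveTower.GeomPoint X₀))
    (hSne : S.Nonempty) (hSfin : S.Finite)
    (hS : RecursiveTower.IsComplete f g S)
    (hfS : S₀ = RecursiveTower.onPoints f '' S) (hgS : S₀ = RecursiveTower.onPoints g '' S)
    (hD : RecursiveTower.restrictedDifferent f S₀ = RecursiveTower.restrictedDifferent g S₀) :
    ¬ ∃ T : Set (RecursiveTower.GeomPoint X), T.Nonempty ∧
      RecursiveTower.IsRegularSet (RecursiveTower.geomGraph f g) d T ∧ Disjoint T S := by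
  rintro ⟨T, hTne, hT, hTS⟩
  have := hf.1
  have := hg.1
  have hram : ∀ P ∈ S, RecursiveTower.ramIndex f P = RecursiveTower.ramIndex g P := by
    intro P hP
    have h := congrFun hD P
    rw [RecursiveTower.restrictedDifferent, RecursiveTower.restrictedDifferent,
      if_pos (hfS ▸ ⟨P, hP, rfl⟩), if_pos (hgS ▸ ⟨P, hP, rfl⟩)] at h
    omega
  obtain ⟨N, hN⟩ := RecursiveTower.exists_forall_chain_curveModelHom_eq (by omega) hf.2 hg.2 hSne
    hSfin hS (hfS.symm.trans hgS) hram hTne hT hTS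
  have := hirr N
  have := RecursiveTower.surjective_left_of_isDominant f
  have := RecursiveTower.surjective_left_of_isDominant g
  have := RecursiveTower.surjective_floorProj f g N
  obtain ⟨i, j, hij, hjN, h⟩ := RecursiveTower.exists_comp_eq_of_chain f g hN
    (RecursiveTower.floorProj f g N) (fun i => inferInstance)
    fun i hi => RecursiveTower.floorProj_comp f g hi
  obtain ⟨P, hP, hne⟩ := RecursiveTower.exists_path_ne hd hT hTne hij
  obtain ⟨Q, hQ⟩ := RecursiveTower.exists_geomPoint_floor f g hP N
  exact hne (by rw [← hQ i (by omega), ← hQ j hjN, h])
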